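/- **Conventions.** A valued field $(K,V)$ is a field $K$ with a valuation ring $V$ of $K$ (for every $x\in K^\times$, $x\in V$ or $1/x\in V$); $M_V$ is the maximal ideal of $V$ and $v$ the valuation, with $v(0)=\infty$. We say that $x$ divides $y$ if $v(y)\ge v(x)$, i.e. $y\in Vx$. A valued extension of $(K,V)$ is a valued field $(L,W)$ with $K\subseteq L$ and $W\cap K=V$. A Hensel code over $V$ is a pair $(P,a)\in V[X]\times V$ with $P(a)\in M_V$ and $P'(a)\in V^\times$; in a valued extension $(L,W)$, a Hensel zero coded by $(P,a)$ is an element $\alpha$ with $P(\alpha)=0$ and $\alpha-a\in M_W$. We say that $(L,W)$ is *generated by adjoining Hensel zeros* if $L$ is the only intermediate field $F$ of $L/K$ that contains every Hensel zero in $L$ of every Hensel code over $W\cap F$. An *immediate description* in $K$ of $x\in L$ is a $y\in K$ with $x=y(1+\mu)$ for some $\mu\in M_W$. A *uniform algorithm* takes as input discrete data and a finite list $\mathbf a$ of elements of $K$; equality and divisibility in $(K,V)$ are available to it as tests: at each step it either asks one of the questions "$P(\mathbf a)=0$?", "$v(P(\mathbf a))\ge v(Q(\mathbf a))$?", where $P,Q$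 are polynomials with integer coefficients, or stops with a discrete output, and what it does at each step is a computable function of the discrete input and of the answers received so far. An element $x$ of $L$ is *described* by a list $\mathbf a$ of elements of $K$ and a discrete code if $x=r(\mathbf a,\xi_1,\dots,\xi_n)$, where each $\xi_i$ is the Hensel zero of a Hensel code $(P_i,a_i)$ over $W$, where the coefficients of $P_i$ and the element $a_i$ are values at $(\mathbf a,\xi_1,\dots,\xi_{i-1})$ of polynomials with integer coefficients, and where $r$ is a polynomial with integer coefficients; the code consists of the length of $\mathbf a$ and of these integer polynomials. **Theorem.** Let $(K,V)$ be a valued field. There is a valued extension $(K^{\mathrm H},V^{\mathrm H})$ of $(K,V)$ that contains a Hensel zero for every Hensel code $(P,a)\in V^{\mathrm H}[X]\times V^{\mathrm H}$ and is generated by adjoining Hensel zeros. Every valued extension $(L',W')$ of $(K,V)$ with these two properties is isomorphic to $(K^{\mathrm H},V^{\mathrm H})$ by a unique $K$-isomorphism that carries $V^{\mathrm H}$ onto $W'$. Every element of $K^{\mathrm H}$ is described by some list of elements of $K$ and some code, and has an immediate description in $K$. If equality and divisibility are testable in $(K,V)$, then the extension is explicitly immediate, and equality and divisibility are testable in $(K^{\mathrm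 H},V^{\mathrm H})$. More precisely, there are three uniform algorithms, the same for all $(K,V)$, such that: 1. if $x\in K^{\mathrm H}$ is described by $\mathbf a$ and a code $c$, the first algorithm, run on $c$ and $\mathbf a$, stops and outputs polynomials $p,q$ with integer coefficients such that $q(\mathbf a)\ne0$ and $p(\mathbf a)/q(\mathbf a)$ is an immediate description of $x$; 2. if $x,y\in K^{\mathrm H}$ are described by $\mathbf a$ and $c$, and by $\mathbf b$ and $d$, the second algorithm, run on $(c,d)$ and the concatenated list $(\mathbf a,\mathbf b)$, stops and decides whether $x=y$; 3. in the same situation, the third algorithm stops and decides whether $x$ divides $y$ with respect to $V^{\mathrm H}$. -/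

import Mathlib

open Polynomial

universe u v

namespace HenselizationOfValuedField

/-! ## Hensel codes and Hensel zeros -/

section HenselZeros

variable {R : Type u} [CommRing R] [IsLocalRing R]

/-- `(P, a)` is a Hensel code over the local ring `R` (in the sequel, a valuation ring):
`P(a)` lies in the maximal ideal and `P'(a)` is a unit. -/
def IsHenselCode (P : R[X]) (a : R) : Prop :=
  P.eval a ∈ IsLocalRing.maximalIdeal R ∧ IsUnit (P.derivative.eval a)

/-- `ξ` is a Hensel zero coded by `(P, a)`: `P(ξ) = 0` and `ξ - a` lies in the maximal ideal.
(An element `ξ` of the ambient field with `ξ - a` in the maximal ideal is automatically in `R`.) -/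
def IsHenselZero (P : R[X]) (a ξ : R) : Prop :=
  P.eval ξ = 0 ∧ ξ - a ∈ IsLocalRing.maximalIdeal R

end HenselZeros

/-! ## Valued extensions and henselizations -/

section Extensions

variable {K : Type u} [Field K] {L : Type v} [Field L] [Algebra K L]

/-- `(L, W)` is a valued extension of `(K, V)`: `W ∩ K = V`. -/
def IsValuedExtension (V : ValuationSubring K) (W : ValuationSubring L) : Prop :=
  W.comap (algebraMap K L) = V

/-- The valued field `(L, W)` contains a Hensel zero for every Hensel code over `W`. -/
def ContainsHenselZeros (W : ValuationSubring L) : Prop :=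
  ∀ (P : W[X]) (a : W), IsHenselCode P a → ∃ ξ : W, IsHenselZero P a ξ

/-- The intermediate field `F` of `L / K` is stable under adjunction of Hensel zeros: whenever the
coefficients of `P` and the element `a` of a Hensel code `(P, a)` lie in `W ∩ F`, its Hensel zero
in `L` lies in `F`. -/
def StableUnderHenselZeros (W : ValuationSubring L) (F : IntermediateField K L) : Prop :=
  ∀ (P : W[X]) (a ξ : W), IsHenselCode P a → (∀ n, (P.coeff n : L) ∈ F) → (a : L) ∈ F →
    IsHenselZero P a ξ → (ξ : L) ∈ F

variable (K) in
/-- `(L, W)` is generated over `K` by the process of adjoining Hensel zeros: the only intermediate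
field stable under this process is `L` itself. -/
def IsGeneratedByHenselZeros (W : ValuationSubring L) : Prop :=
  ∀ F : IntermediateField K L, StableUnderHenselZeros W F → F = ⊤

/-- `(L, W)` is a valued extension of `(K, V)` which contains a Hensel zero for every Hensel code
over `W`, and which is generated by adjoining Hensel zeros. -/
structure IsHenselization (V : ValuationSubring K) (W : ValuationSubring L) : Prop where
  isValuedExtension : IsValuedExtension V W
  containsHenselZeros : ContainsHenselZeros W
  isGenerated : IsGeneratedByHenselZeros K W

/-- `y : K` is an immediate description of `x : L`: `x = y (1 + μ)` with `μ` in the maximal ideal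
of `W`. -/
def IsImmediateDescription (W : ValuationSubring L) (y : K) (x : L) : Prop :=
  ∃ μ : W, μ ∈ IsLocalRing.maximalIdeal W ∧ x = algebraMap K L y * (1 + (μ : L))

/-- `x` divides `y` with respect to the valuation ring `V`, that is, `v(y) ≥ v(x)`
(with `v(0) = ∞`). -/
def Divides (V : ValuationSubring K) (x y : K) : Prop :=
  ∃ r ∈ V, y = r * x

end Extensions

/-! ## Uniform algorithms

An algorithm which is uniform in `(K, V)` takes as input some discrete data and a list `a` of
elements of `K`. It has access to `a` only through the tests `P(a) = 0 ?` and
`v(P(a)) ≥ v(Q(a)) ?`, where `P`, `Q` are polynomials with integer coefficients. -/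

/-- A multivariate polynomial with integer coefficients, as the list of its monomials: the pair
`(c, [k₀, k₁, …])` stands for `c * x₀ ^ k₀ * x₁ ^ k₁ * ⋯`. -/
abbrev IntPoly : Type := List (ℤ × List ℕ)

/-- The value of an integer polynomial at a list of elements of a field (exponents of variables
beyond the end of the list are ignored). -/
def IntPoly.evalAt {K : Type u} [Field K] (p : IntPoly) (a : List K) : K :=
  (p.map fun m => (m.1 : K) * (List.zipWith (fun x k => x ^ k) a m.2).prod).sum

/-- The tests which a uniform algorithm may perform: `Sum.inl P` is the test `P(a) = 0 ?`, and
`Sum.inr (P, Q)` is the test `v(P(a)) ≥ v(Q(a)) ?`. -/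
abbrev Test : Type := IntPoly ⊕ (IntPoly × IntPoly)

/-- The answer to a test, on the list `a` of elements of `K`, is positive. -/
def Test.Holds {K : Type u} [Field K] (V : ValuationSubring K) (a : List K) : Test → Prop
  | Sum.inl P => P.evalAt a = 0
  | Sum.inr (P, Q) => Divides V (Q.evalAt a) (P.evalAt a)

/-- A uniform algorithm with discrete input in `I` and discrete output in `O`: a computable
function which, given the input and the list of the answers received so far (the most recent one
first), either asks for one more test or stops with an output. -/
structure UniformAlgorithm (I O : Type) [Primcodable I] [Primcodable O] where
  step : I × List Bool → Test ⊕ O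
  computable : Computable step

namespace UniformAlgorithm

variable {I O : Type} [Primcodable I] [Primcodable O] {K : Type u} [Field K]

/-- `h` is a list of answers which the algorithm receives in its run on the input `i` and the list
`a` of elements of `K`, where the tests are answered according to `(K, V)`. -/
inductive Reaches (A : UniformAlgorithm I O) (V : ValuationSubring K) (a : List K) (i : I) :
    List Bool → Prop
  | start : Reaches A V a i []
  | ask {h : List Bool} {q : Test} {b : Bool} : Reaches A V a i h → A.step (i, h) = Sum.inl q →
      (b = true ↔ q.Holds V a) → Reaches A V a i (b :: h)

/-- The run of the algorithm on the input `i` and the list `a` of elements of `K` stops, with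
output `o`. -/
def Outputs (A : UniformAlgorithm I O) (V : ValuationSubring K) (a : List K) (i : I) (o : O) :
    Prop :=
  ∃ h, A.Reaches V a i h ∧ A.step (i, h) = Sum.inr o

end UniformAlgorithm

/-! ## Codes for the elements obtained by successive adjunction of Hensel zeros -/

/-- The discrete part of the description of an element of the form `r(a, ξ₁, …, ξₙ)`, where `a` is
a list of parameters of `K` and where each `ξᵢ` is the Hensel zero of a code `(Pᵢ, aᵢ)`
the entries of which are polynomials in `a, ξ₁, …, ξᵢ₋₁`. It consists of the number of the
parameters, the list of the pairs (list of the coefficients of `Pᵢ` by increasing degree, `aᵢ`),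
and `r`. -/
abbrev ElementCode : Type := ℕ × List (List IntPoly × IntPoly) × IntPoly

section Codes

variable {K : Type u} [Field K] {L : Type v} [Field L] [Algebra K L]

/-- The univariate polynomial with the given list of coefficients, by increasing degree. -/
noncomputable def polyOfCoeffs (l : List L) : L[X] :=
  l.foldr (fun c p => C c + X * p) 0

/-- `Adjoins W e T e'`: the list `e'` is obtained from the list `e` of elements of `L` by
appending successively the Hensel zeros described by `T`, where the entries of each Hensel code
are polynomials in the elements which are already in the list. -/
inductive Adjoins (W : ValuationSubring L) :
    List L → List (List IntPoly × IntPoly) → List L → Prop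
  | nil (e : List L) : Adjoins W e [] e
  | cons {e e' : List L} {cs : List IntPoly} {c : IntPoly} {T : List (List IntPoly × IntPoly)}
      (P : W[X]) (a ξ : W) :
      P.map W.subtype = polyOfCoeffs (cs.map fun p => p.evalAt e) →
      (a : L) = c.evalAt e →
      IsHenselCode P a → IsHenselZero P a ξ →
      Adjoins W (e ++ [(ξ : L)]) T e' → Adjoins W e ((cs, c) :: T) e'

/-- The element `x` of `L` is described by the code `c` and the list `a` of parameters in `K`. -/
def Represents (W : ValuationSubring L) (a : List K) (c : ElementCode) (x : L) : Prop :=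
  a.length = c.1 ∧
    ∃ e : List L, Adjoins W (a.map (algebraMap K L)) c.2.1 e ∧ c.2.2.evalAt e = x

end Codes

end HenselizationOfValuedField

/-!
The henselization of `(K, V)` is constructed inside the algebraic closure of `K`: the valuation ring
`V` extends to a valuation ring `O` there, every Hensel code over `O` has its Hensel zero
(`containsHenselZeros_of_isAlgClosed`), and the smallest subextension which is stable under
adjunction of Hensel zeros, `henselClosure`, is a henselization. It is immediate because the
adjunction of a single Hensel zero is (`exists_sameLeading_of_mem_adjoin`): after multiplication by
a factor congruent to `1`, an element of the extension has a valuation different from those of its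
other conjugates, and its leading term is then a quotient of two consecutive coefficients of its
minimal polynomial. By Zorn's lemma there is a stable immediate subextension, and it contains
`henselClosure`.

For uniqueness, two henselizations are separable over `K`, hence embed into the separable closure.
The valuation rings above `V` in a Galois extension are conjugate (`exists_algEquiv_mem_iff`, by the
transitivity of the Galois group on the primes of the integral closure of `V`), so that the
embeddings may be chosen compatible with one valuation. The images then coincide, by the uniqueness
of Hensel zeros. The same argument gives the universal property `IsHenselization.exists_algHom`.

Both tests and immediate descriptions are obtained by exhaustive search for certificates. That an
element coded by `c` with parameters `a` has the immediate description `p(a) / q(a)` is a statement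
about all valued fields above `(K, V)`, and a Positivstellensatz for valued fields
(`exists_valuationSubring_of_forall_notMem`) says that a system of conditions "`g` is integral",
"`g` lies in the maximal ideal", "`g` is a unit", "`g = 0`" has no solution above `(K, V)` only if,
modulo the relations and in the `V`-algebra generated by all these elements, a product of prescribed
units lies in the ideal generated by the prescribed small elements and by the maximal ideal of `V`.
This is applied to the system which says that the Hensel zeros are as prescribed by `c` and that
`q x - p` is not zero and divides `p`. The membership is a polynomial identity, with coefficients
which are rational functions of `a` if `K` is generated by `a`, so that it may be verified by
finitely many tests. Soundness of certificates is `sameLeading_of_answered`, their existence is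
`exists_answered`; the general case reduces to that of a field generated by the parameters since
codes and tests are insensitive to the base field.

All ingredients of a certificate are primitive recursive, so that `searchAlgorithm` yields
algorithms in the required sense. Two codes are merged into codes with common parameters; equality
of `x` and `y` is then read off from an immediate description of `x - y`, and divisibility from
immediate descriptions of `x` and `y`.
-/

namespace HenselizationOfValuedField

/-! ### Hensel zeros -/

section ValuationBasics

variable {L : Type*} [Field L] (W : ValuationSubring L)

theorem exists_map_subtype_eq {Q : L[X]} (hQ : ∀ n, Q.coeff n ∈ W) :
    ∃ P : W[X], P.map W.subtype = Q := by
  have : Q ∈ Polynomial.lifts W.subtype :=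
    (Polynomial.lifts_iff_coeff_lifts Q).2 fun n => ⟨⟨_, hQ n⟩, rfl⟩
  exact (Polynomial.mem_lifts Q).1 this

theorem coeff_derivative_mem {Q : L[X]} (hQ : ∀ n, Q.coeff n ∈ W) (n : ℕ) :
    Q.derivative.coeff n ∈ W := by
  rw [Polynomial.coeff_derivative]
  exact mul_mem (hQ _) (add_mem (natCast_mem W n) (one_mem W))

theorem exists_eval_sub_eq {Q : L[X]} (hQ : ∀ n, Q.coeff n ∈ W) {x y : L} (hx : x ∈ W)
    (hy : y ∈ W) : ∃ r ∈ W, Q.eval x - Q.eval y = (x - y) * r := by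
  obtain ⟨P, rfl⟩ := exists_map_subtype_eq W hQ
  obtain ⟨r, hr⟩ := Polynomial.sub_dvd_eval_sub (⟨x, hx⟩ : W) ⟨y, hy⟩ P
  refine ⟨r, r.2, ?_⟩
  have h := congrArg W.subtype hr
  simpa [Polynomial.eval_map, Polynomial.eval₂_at_apply, map_sub, map_mul,
    ← Polynomial.eval₂_at_apply W.subtype] using h

theorem valuation_eval_sub_le {Q : L[X]} (hQ : ∀ n, Q.coeff n ∈ W) {x y : L} (hx : x ∈ W)
    (hy : y ∈ W) : W.valuation (Q.eval x - Q.eval y) ≤ W.valuation (x - y) := by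
  obtain ⟨r, hr, h⟩ := exists_eval_sub_eq W hQ hx hy
  rw [h, map_mul]
  exact mul_le_of_le_one_right' ((W.valuation_le_one_iff r).2 hr)

theorem valuation_eq_one_of_sub_lt {x y : L} (h : W.valuation (x - y) < 1)
    (hy : W.valuation y = 1) : W.valuation x = 1 := by
  have := Valuation.map_add_eq_of_lt_right W.valuation (x := x - y) (y := y) (by rwa [hy])
  rwa [sub_add_cancel, hy] at this

theorem valuation_one_add {μ : L} (h : W.valuation μ < 1) : W.valuation (1 + μ) = 1 :=
  Valuation.map_one_add_of_lt _ h

theorem mem_of_valuation_lt_one {x : L} (h : W.valuation x < 1) : x ∈ W :=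
  (W.valuation_le_one_iff x).1 h.le

theorem mem_of_sub_lt {x y : L} (h : W.valuation (x - y) < 1) (hy : y ∈ W) : x ∈ W := by
  simpa using add_mem (mem_of_valuation_lt_one W h) hy

/-- `x` is the Hensel zero of the Hensel code `(Q, a)` over `W`, expressed with elements of the
field `L`. The condition that `Q(a)` lies in the maximal ideal is not listed, since it follows
from `Q(x) = 0`. -/
structure IsHenselRoot (Q : L[X]) (a x : L) : Prop where
  coeff_mem : ∀ n, Q.coeff n ∈ W
  base_mem : a ∈ W
  valuation_derivative : W.valuation (Q.derivative.eval a) = 1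
  root : Q.eval x = 0
  close : W.valuation (x - a) < 1

variable {W}

namespace IsHenselRoot

variable {Q : L[X]} {a x y : L}

theorem mem (h : IsHenselRoot W Q a x) : x ∈ W := mem_of_sub_lt W h.close h.base_mem

theorem valuation_eval_base (h : IsHenselRoot W Q a x) : W.valuation (Q.eval a) < 1 := by
  have := valuation_eval_sub_le W h.coeff_mem h.mem h.base_mem
  rw [h.root, zero_sub, Valuation.map_neg] at this
  exact this.trans_lt h.close

theorem valuation_derivative_root (h : IsHenselRoot W Q a x) :
    W.valuation (Q.derivative.eval x) = 1 :=
  valuation_eq_one_of_sub_lt W ((valuation_eval_sub_le W (coeff_derivative_mem W h.coeff_mem)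
    h.mem h.base_mem).trans_lt h.close) h.valuation_derivative

theorem derivative_ne_zero (h : IsHenselRoot W Q a x) : Q.derivative.eval x ≠ 0 := by
  intro h0
  simpa [h0] using h.valuation_derivative_root

theorem ne_zero (h : IsHenselRoot W Q a x) : Q ≠ 0 := by
  rintro rfl
  simpa using h.valuation_derivative

/-- Hensel zeros are unique: if `y` is another zero, `Q(x + (y - x)) - Q(x)` is the product of
`y - x` and of an element which is congruent to `Q'(x)`. -/
theorem unique (h : IsHenselRoot W Q a x) (h' : IsHenselRoot W Q a y) : x = y := by
  obtain ⟨P, rfl⟩ := exists_map_subtype_eq W h.coeff_mem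
  lift x to W using h.mem
  lift y to W using h'.mem
  have hd : W.valuation ((y : L) - x) < 1 := by
    have : (y : L) - x = (y - a) - (x - a) := by ring
    rw [this]
    exact (Valuation.map_sub _ _ _).trans_lt (max_lt h'.close h.close)
  obtain ⟨k, hk⟩ := P.binomExpansion x (y - x)
  rw [add_sub_cancel] at hk
  have e (z : W) : (P.map W.subtype).eval (z : L) = (P.eval z : W) := by
    rw [← W.subtype_apply, Polynomial.eval_map, Polynomial.eval₂_at_apply]; rfl
  have e' (z : W) : (P.map W.subtype).derivative.eval (z : L) = (P.derivative.eval z : W) := by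
    rw [Polynomial.derivative_map, ← W.subtype_apply, Polynomial.eval_map,
      Polynomial.eval₂_at_apply]; rfl
  have hx : P.eval x = 0 := Subtype.ext (by rw [← e]; exact h.root)
  have hy : P.eval y = 0 := Subtype.ext (by rw [← e]; exact h'.root)
  rw [hx, hy, zero_add] at hk
  have h2 : (y - x) * (P.derivative.eval x + k * (y - x)) = 0 := by rw [hk]; ring
  rcases mul_eq_zero.1 h2 with h3 | h3
  · exact congrArg _ (sub_eq_zero.1 h3).symm
  · exfalso
    have h4 : W.valuation ((P.derivative.eval x + k * (y - x) : W) : L) = 1 := by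
      refine valuation_eq_one_of_sub_lt W (y := (P.derivative.eval x : W)) ?_ ?_
      · have : ((P.derivative.eval x + k * (y - x) : W) : L) - (P.derivative.eval x : W)
            = k * ((y : L) - x) := by push_cast; ring
        rw [this, map_mul]
        exact (mul_le_of_le_one_left' (W.valuation_le_one k)).trans_lt hd
      · rw [← e']; exact h.valuation_derivative_root
    rw [h3] at h4
    simp at h4

theorem of_codes {P : W[X]} {a ξ : W} (h : IsHenselCode P a) (h' : IsHenselZero P a ξ) :
    IsHenselRoot W (P.map W.subtype) a ξ where
  coeff_mem n := by rw [Polynomial.coeff_map]; exact (P.coeff n).2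
  base_mem := a.2
  valuation_derivative := by
    rw [Polynomial.derivative_map, ← W.subtype_apply, Polynomial.eval_map,
      Polynomial.eval₂_at_apply]
    exact (W.valuation_eq_one_iff _).1 h.2
  root := by
    rw [← W.subtype_apply, Polynomial.eval_map, Polynomial.eval₂_at_apply, h'.1, map_zero]
  close := (W.valuation_lt_one_iff _).1 h'.2

theorem to_codes {P : W[X]} {a ξ : W} (h : IsHenselRoot W (P.map W.subtype) a ξ) :
    IsHenselCode P a ∧ IsHenselZero P a ξ := by
  have e (R : W[X]) (z : W) : (R.map W.subtype).eval (z : L) = (R.eval z : W) := by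
    rw [← W.subtype_apply, Polynomial.eval_map, Polynomial.eval₂_at_apply]; rfl
  refine ⟨⟨(W.valuation_lt_one_iff _).2 ?_, (W.valuation_eq_one_iff _).2 ?_⟩,
    Subtype.ext ?_, (W.valuation_lt_one_iff _).2 h.close⟩
  · rw [← e]; exact h.valuation_eval_base
  · rw [← e, ← Polynomial.derivative_map]; exact h.valuation_derivative
  · rw [← e]; exact h.root

end IsHenselRoot

theorem containsHenselZeros_iff : ContainsHenselZeros W ↔ ∀ (Q : L[X]) (a : L),
    (∀ n, Q.coeff n ∈ W) → a ∈ W → W.valuation (Q.eval a) < 1 →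
    W.valuation (Q.derivative.eval a) = 1 → ∃ x, IsHenselRoot W Q a x := by
  have e (R : W[X]) (z : W) : (R.map W.subtype).eval (z : L) = (R.eval z : W) := by
    rw [← W.subtype_apply, Polynomial.eval_map, Polynomial.eval₂_at_apply]; rfl
  constructor
  · intro h Q a hQ ha h1 h2
    obtain ⟨P, rfl⟩ := exists_map_subtype_eq W hQ
    lift a to W using ha
    have hc : IsHenselCode P a :=
      ⟨(W.valuation_lt_one_iff _).2 (by rwa [← e]),
        (W.valuation_eq_one_iff _).2 (by rwa [← e, ← Polynomial.derivative_map])⟩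
    obtain ⟨ξ, hξ⟩ := h P a hc
    exact ⟨ξ, .of_codes hc hξ⟩
  · intro h P a hc
    obtain ⟨x, hx⟩ := h (P.map W.subtype) a
      (fun n => by rw [Polynomial.coeff_map]; exact (P.coeff n).2) a.2
      (by rw [e]; exact (W.valuation_lt_one_iff _).1 hc.1)
      (by rw [Polynomial.derivative_map, e]; exact (W.valuation_eq_one_iff _).1 hc.2)
    lift x to W using hx.mem
    exact ⟨x, hx.to_codes.2⟩

theorem stableUnderHenselZeros_iff {K : Type*} [Field K] [Algebra K L]
    {F : IntermediateField K L} : StableUnderHenselZeros W F ↔ ∀ (Q : L[X]) (a x : L),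
    IsHenselRoot W Q a x → (∀ n, Q.coeff n ∈ F) → a ∈ F → x ∈ F := by
  constructor
  · intro h Q a x hx hQ ha
    obtain ⟨P, rfl⟩ := exists_map_subtype_eq W hx.coeff_mem
    have h1 := hx.mem
    have h2 := hx.base_mem
    lift x to W using h1
    lift a to W using h2
    exact h P a x hx.to_codes.1 (fun n => by simpa using hQ n) ha hx.to_codes.2
  · intro h P a ξ hc hP ha hξ
    exact h _ a ξ (.of_codes hc hξ) (fun n => by simpa using hP n) ha

end ValuationBasics

/-! ### Valued extensions -/

section Extensions

variable {K : Type*} [Field K] {L : Type*} [Field L] {E : Type*} [Field E]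

theorem valuation_lt_one_iff_inv (W : ValuationSubring L) (x : L) :
    W.valuation x < 1 ↔ x = 0 ∨ x⁻¹ ∉ W := by
  rw [← W.mem_nonunits_iff, W.mem_nonunits_iff_or]

variable {V : ValuationSubring K} {W : ValuationSubring L} {f : K →+* L}

theorem comap_valuation_le_one (h : W.comap f = V) (x : K) :
    W.valuation (f x) ≤ 1 ↔ V.valuation x ≤ 1 := by
  rw [V.valuation_le_one_iff, W.valuation_le_one_iff, ← h, ValuationSubring.mem_comap]

theorem comap_valuation_lt_one (h : W.comap f = V) (x : K) :
    W.valuation (f x) < 1 ↔ V.valuation x < 1 := by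
  rw [valuation_lt_one_iff_inv, valuation_lt_one_iff_inv, ← h, ValuationSubring.mem_comap,
    map_inv₀, map_eq_zero]

theorem comap_valuation_eq_one (h : W.comap f = V) (x : K) :
    W.valuation (f x) = 1 ↔ V.valuation x = 1 := by
  have h1 := comap_valuation_le_one h x
  have h2 := comap_valuation_lt_one h x
  rw [le_iff_lt_or_eq, le_iff_lt_or_eq] at h1
  constructor <;> intro h3
  · exact (h1.1 (Or.inr h3)).resolve_left fun h4 => (h2.2 h4).ne h3
  · exact (h1.2 (Or.inr h3)).resolve_left fun h4 => (h2.1 h4).ne h3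

theorem IsHenselRoot.map (h : W.comap f = V) {Q : K[X]} {a x : K} (hx : IsHenselRoot V Q a x) :
    IsHenselRoot W (Q.map f) (f a) (f x) where
  coeff_mem n := by
    rw [Polynomial.coeff_map, ← ValuationSubring.mem_comap, h]
    exact hx.coeff_mem n
  base_mem := by rw [← ValuationSubring.mem_comap, h]; exact hx.base_mem
  valuation_derivative := by
    rw [Polynomial.derivative_map, Polynomial.eval_map_apply, comap_valuation_eq_one h]
    exact hx.valuation_derivative
  root := by rw [Polynomial.eval_map_apply, hx.root, map_zero]
  close := by rw [← map_sub, comap_valuation_lt_one h]; exact hx.close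

theorem IsHenselRoot.of_map (h : W.comap f = V) {Q : K[X]} {a x : K}
    (hx : IsHenselRoot W (Q.map f) (f a) (f x)) : IsHenselRoot V Q a x where
  coeff_mem n := by
    have := hx.coeff_mem n
    rwa [Polynomial.coeff_map, ← ValuationSubring.mem_comap, h] at this
  base_mem := by have := hx.base_mem; rwa [← ValuationSubring.mem_comap, h] at this
  valuation_derivative := by
    have := hx.valuation_derivative
    rwa [Polynomial.derivative_map, Polynomial.eval_map_apply, comap_valuation_eq_one h] at this
  root := by have := hx.root; rwa [Polynomial.eval_map_apply, map_eq_zero] at this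
  close := by have := hx.close; rwa [← map_sub, comap_valuation_lt_one h] at this

/-- In a larger valued field, a Hensel code over a field which contains all Hensel zeros has its
Hensel zero in the smaller field. -/
theorem exists_isHenselRoot_of_map (h : W.comap f = V) (hV : ContainsHenselZeros V) {Q : K[X]}
    {a : K} {x : L} (hx : IsHenselRoot W (Q.map f) (f a) x) :
    ∃ z, f z = x ∧ IsHenselRoot V Q a z := by
  have h1 : W.valuation ((Q.map f).eval (f a)) < 1 := hx.valuation_eval_base
  rw [Polynomial.eval_map_apply, comap_valuation_lt_one h] at h1
  have h2 := hx.valuation_derivative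
  rw [Polynomial.derivative_map, Polynomial.eval_map_apply, comap_valuation_eq_one h] at h2
  have h3 : ∀ n, Q.coeff n ∈ V := fun n => by
    have := hx.coeff_mem n
    rwa [Polynomial.coeff_map, ← ValuationSubring.mem_comap, h] at this
  have h4 : a ∈ V := by have := hx.base_mem; rwa [← ValuationSubring.mem_comap, h] at this
  obtain ⟨z, hz⟩ := containsHenselZeros_iff.1 hV Q a h3 h4 h1 h2
  exact ⟨z, (hz.map h).unique hx, hz⟩

/-- A valuation ring extends to every field extension. -/
theorem exists_valuationSubring_comap_eq (V : ValuationSubring K) (f : K →+* L) :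
    ∃ W : ValuationSubring L, W.comap f = V := by
  obtain ⟨W, hW, hloc⟩ := IsLocalRing.exists_factor_valuationRing (f.comp V.subtype)
  refine ⟨W, ValuationSubring.ext _ _ fun x => ?_⟩
  rw [ValuationSubring.mem_comap]
  constructor
  · intro hx
    by_contra hxV
    have hx0 : x ≠ 0 := fun h => hxV (h ▸ zero_mem V)
    have hi : x⁻¹ ∈ V := (V.mem_or_inv_mem x).resolve_left hxV
    have hu : IsUnit (⟨x⁻¹, hi⟩ : V) := by
      apply hloc.map_nonunit
      refine IsUnit.of_mul_eq_one ⟨f x, hx⟩ (Subtype.ext ?_)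
      change f x⁻¹ * f x = 1
      rw [← map_mul, inv_mul_cancel₀ hx0, map_one]
    obtain ⟨⟨y, hy⟩, hxy⟩ := hu.exists_right_inv
    have : x⁻¹ * y = 1 := congrArg Subtype.val hxy
    rw [inv_mul_eq_one₀ hx0] at this
    exact hxV (this ▸ hy)
  · intro hx
    exact hW ⟨x, hx⟩

end Extensions

/-! ### Hensel zeros in algebraically closed fields -/

section AlgClosed

variable {Ω : Type*} [Field Ω]

/-- Over an algebraically closed field every valuation ring contains its Hensel zeros: if no zero
`r` of `Q` is congruent to `a`, then `Q'(a) = Q(a) ∑ 1 / (a - r)` lies in the maximal ideal. -/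
theorem containsHenselZeros_of_isAlgClosed [IsAlgClosed Ω] (O : ValuationSubring Ω) :
    ContainsHenselZeros O := by
  rw [containsHenselZeros_iff]
  intro Q a hQ ha h1 h2
  by_cases h0 : Q.eval a = 0
  · exact ⟨a, hQ, ha, h2, h0, by simp⟩
  by_contra hno
  have hfar : ∀ r ∈ Q.roots, 1 / (a - r) ∈ O := by
    intro r hr
    by_contra hmem
    refine hno ⟨r, hQ, ha, h2, ?_, ?_⟩
    · exact (Polynomial.mem_roots'.1 hr).2
    · rw [valuation_lt_one_iff_inv, ← neg_sub a r, inv_neg, neg_mem_iff]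
      exact Or.inr (by simpa using hmem)
  have hs := (IsAlgClosed.splits Q).eval_derivative_div_eval_of_ne_zero h0
  rw [div_eq_iff h0] at hs
  rw [hs, map_mul] at h2
  have h3 : O.valuation (Q.roots.map fun z => 1 / (a - z)).sum ≤ 1 := by
    rw [O.valuation_le_one_iff]
    exact multiset_sum_mem _ fun y hy => by
      obtain ⟨r, hr, rfl⟩ := Multiset.mem_map.1 hy
      exact hfar r hr
  exact ((mul_le_of_le_one_left' h3).trans_lt h1).ne h2

end AlgClosed

/-! ### Leading terms -/

section Similarity

variable {Ω : Type*} [Field Ω]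

/-- `x` and `y` have the same leading term: `x = y (1 + μ)` with `μ` in the maximal ideal. -/
def SameLeading (O : ValuationSubring Ω) (x y : Ω) : Prop :=
  ∃ μ, O.valuation μ < 1 ∧ x = y * (1 + μ)

variable {O : ValuationSubring Ω}

theorem one_add_ne_zero {μ : Ω} (h : O.valuation μ < 1) : 1 + μ ≠ 0 := by
  intro h0
  simpa [h0] using valuation_one_add O h

theorem SameLeading.refl (x : Ω) : SameLeading O x x := ⟨0, by simp, by simp⟩

theorem SameLeading.trans {x y z : Ω} (h : SameLeading O x y) (h' : SameLeading O y z) :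
    SameLeading O x z := by
  obtain ⟨μ, hμ, rfl⟩ := h
  obtain ⟨ν, hν, rfl⟩ := h'
  refine ⟨ν + μ * (1 + ν), ?_, by ring⟩
  refine Valuation.map_add_lt _ hν ?_
  rwa [map_mul, valuation_one_add O hν, mul_one]

theorem SameLeading.symm {x y : Ω} (h : SameLeading O x y) : SameLeading O y x := by
  obtain ⟨μ, hμ, rfl⟩ := h
  have h0 := one_add_ne_zero hμ
  refine ⟨-μ / (1 + μ), ?_, ?_⟩
  · rwa [map_div₀, Valuation.map_neg, valuation_one_add O hμ, div_one]
  · field_simp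
    ring

theorem sameLeading_of_valuation_sub_lt {x y : Ω} (hy : y ≠ 0)
    (h : O.valuation (x / y - 1) < 1) : SameLeading O x y :=
  ⟨x / y - 1, h, by field_simp; ring⟩

theorem SameLeading.valuation_eq {x y : Ω} (h : SameLeading O x y) :
    O.valuation x = O.valuation y := by
  obtain ⟨μ, hμ, rfl⟩ := h
  rw [map_mul, valuation_one_add O hμ, mul_one]

theorem SameLeading.eq_zero_iff {x y : Ω} (h : SameLeading O x y) : x = 0 ↔ y = 0 := by
  obtain ⟨μ, hμ, rfl⟩ := h
  simp [one_add_ne_zero hμ]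

theorem valuation_pow_sub_one_lt {z : Ω} (hz : O.valuation (z - 1) < 1) (k : ℕ) :
    O.valuation (z ^ k - 1) < 1 := by
  have h := valuation_eval_sub_le O (Q := X ^ k)
    (fun n => by rw [Polynomial.coeff_X_pow]; split_ifs <;> simp [one_mem, zero_mem])
    (mem_of_sub_lt O hz (one_mem O)) (one_mem O)
  simpa using h.trans_lt (by simpa using hz)

theorem isImmediateDescription_iff {K : Type*} [Field K] [Algebra K Ω] {y : K} {x : Ω} :
    IsImmediateDescription O y x ↔ SameLeading O x (algebraMap K Ω y) := by
  constructor
  · rintro ⟨μ, hμ, h⟩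
    exact ⟨μ, (O.valuation_lt_one_iff _).1 hμ, h⟩
  · rintro ⟨μ, hμ, h⟩
    exact ⟨⟨μ, mem_of_valuation_lt_one O hμ⟩, (O.valuation_lt_one_iff _).2 hμ, h⟩

theorem SameLeading.of_map {K : Type*} [Field K] {V : ValuationSubring K} {f : K →+* Ω}
    (h : O.comap f = V) {x y : K} : SameLeading O (f x) (f y) ↔ SameLeading V x y := by
  constructor
  · intro hs
    by_cases hy : y = 0
    · have : x = 0 := by simpa [hy] using hs.eq_zero_iff
      rw [this, hy]; exact .refl 0
    · refine sameLeading_of_valuation_sub_lt hy ?_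
      obtain ⟨μ, hμ, e⟩ := hs
      have hy' : f y ≠ 0 := by simpa using hy
      have : f (x / y - 1) = μ := by
        rw [map_sub, map_div₀, map_one, e]; field_simp; ring
      rwa [← comap_valuation_lt_one h, this]
  · rintro ⟨μ, hμ, rfl⟩
    exact ⟨f μ, (comap_valuation_lt_one h μ).2 hμ, by simp⟩

end Similarity

/-! ### Leading terms of roots -/

section Newton

variable {Ω : Type*} [Field Ω] (O : ValuationSubring Ω)

/-- If no element of `R` has the valuation of `t`, then, up to a constant factor, the polynomial
`∏ (t X - τ)`, for `τ` in `R`, is integral and reduces to a monomial. -/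
theorem exists_prod_eq_C_mul_of_valuation_ne {t : Ω} (ht : t ≠ 0) (R : Multiset Ω)
    (hR : ∀ τ ∈ R, O.valuation τ ≠ O.valuation t) :
    ∃ (c : Ω) (a : ℕ) (G : O[X]), c ≠ 0 ∧ G.map (IsLocalRing.residue O) = X ^ a ∧
      (R.map fun τ => C t * X - C τ).prod = C c * G.map O.subtype := by
  induction R using Multiset.induction with
  | empty => exact ⟨1, 0, 1, one_ne_zero, by simp, by simp⟩
  | cons τ R ih =>
    obtain ⟨c, a, G, hc, hG, hp⟩ := ih fun σ hσ => hR σ (Multiset.mem_cons_of_mem hσ)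
    rw [Multiset.map_cons, Multiset.prod_cons, hp]
    rcases lt_or_gt_of_ne (hR τ (Multiset.mem_cons_self _ _)) with h | h
    · have hlt : O.valuation (τ / t) < 1 := by
        rw [map_div₀]; exact (div_lt_one₀ (by simpa [zero_lt_iff] using ht)).2 h
      let m : O := ⟨τ / t, mem_of_valuation_lt_one O hlt⟩
      have hm : IsLocalRing.residue O m = 0 :=
        (IsLocalRing.residue_eq_zero_iff _).2 ((O.valuation_lt_one_iff m).2 hlt)
      refine ⟨t * c, a + 1, (X - C m) * G, mul_ne_zero ht hc, ?_, ?_⟩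
      · rw [Polynomial.map_mul, hG]; simp [hm, pow_succ']
      · have : C τ = C t * C (τ / t) := by rw [← C_mul, mul_div_cancel₀ _ ht]
        have hm' : O.subtype m = τ / t := rfl
        simp only [Polynomial.map_mul, Polynomial.map_sub, map_X, map_C, C_mul, this, hm']
        ring
    · have hτ : τ ≠ 0 := by
        rintro rfl
        simp at h
      have hlt : O.valuation (t / τ) < 1 := by
        rw [map_div₀]; exact (div_lt_one₀ (by simpa [zero_lt_iff] using hτ)).2 h
      let m : O := ⟨t / τ, mem_of_valuation_lt_one O hlt⟩
      have hm : IsLocalRing.residue O m = 0 :=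
        (IsLocalRing.residue_eq_zero_iff _).2 ((O.valuation_lt_one_iff m).2 hlt)
      refine ⟨-τ * c, a, (1 - C m * X) * G, mul_ne_zero (neg_ne_zero.2 hτ) hc, ?_, ?_⟩
      · rw [Polynomial.map_mul, hG]; simp [hm]
      · have : C t = C τ * C (t / τ) := by rw [← C_mul, mul_div_cancel₀ _ hτ]
        have hm' : O.subtype m = t / τ := rfl
        simp only [Polynomial.map_mul, Polynomial.map_sub, map_X, map_C, C_mul, this, hm',
          Polynomial.map_one, C_neg]
        ring

/-- If the valuation of the root `t` of a polynomial over `F` differs from the valuations of all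
other roots, then `t` has the leading term of a quotient of two consecutive coefficients. -/
theorem exists_sameLeading_of_roots {F : Type*} [Field F] [Algebra F Ω] {Q : F[X]}
    {t : Ω} (ht : t ≠ 0) {R : Multiset Ω}
    (hQ : Q.map (algebraMap F Ω) = ((t ::ₘ R).map fun τ => X - C τ).prod)
    (hR : ∀ τ ∈ R, O.valuation τ ≠ O.valuation t) :
    ∃ y : F, SameLeading O t (algebraMap F Ω y) := by
  obtain ⟨c, a, G, hc, hG, hp⟩ := exists_prod_eq_C_mul_of_valuation_ne O ht R hR
  have hcomp : (Q.map (algebraMap F Ω)).comp (C t * X) =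
      C (c * t) * (G * (X - 1)).map O.subtype := by
    rw [hQ, Multiset.map_cons, Multiset.prod_cons, mul_comp, multiset_prod_comp]
    have : (R.map fun τ => (X - C τ : Polynomial Ω)).map (fun p => p.comp (C t * X)) =
        R.map fun τ => C t * X - C τ := by
      rw [Multiset.map_map]; exact Multiset.map_congr rfl fun τ _ => by simp
    rw [this, hp]
    simp only [sub_comp, X_comp, C_comp, Polynomial.map_mul, Polynomial.map_sub, map_X, C_mul,
      Polynomial.map_one]
    ring
  set g : ℕ → O := fun n => (G * (X - 1)).coeff n with hg
  have hcoeff (n : ℕ) : algebraMap F Ω (Q.coeff n) * t ^ n = c * t * g n := by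
    have := congrArg (fun p => p.coeff n) hcomp
    rw [comp_C_mul_X_coeff, coeff_C_mul, coeff_map, coeff_map] at this
    exact this
  have hres (n : ℕ) : IsLocalRing.residue O (g n) = (X ^ (a + 1) - X ^ a :
      Polynomial (IsLocalRing.ResidueField O)).coeff n := by
    have : (G * (X - 1)).map (IsLocalRing.residue O) = X ^ (a + 1) - X ^ a := by
      rw [Polynomial.map_mul, hG]; simp; ring
    rw [← this, coeff_map]
  have key (z : O) (h : IsLocalRing.residue O z = 1) : O.valuation ((z : Ω) - 1) < 1 := by
    have : z - 1 ∈ IsLocalRing.maximalIdeal O := by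
      rw [← IsLocalRing.residue_eq_zero_iff, map_sub, h, map_one, sub_self]
    exact (O.valuation_lt_one_iff _).1 this
  have h1 := key (g (a + 1)) (by rw [hres]; simp [coeff_X_pow])
  have h0 := key (-g a) (by rw [map_neg, hres]; simp [coeff_X_pow])
  have e1 := hcoeff (a + 1)
  have e0 := hcoeff a
  set q1 := algebraMap F Ω (Q.coeff (a + 1))
  set q0 := algebraMap F Ω (Q.coeff a)
  have v1 := valuation_eq_one_of_sub_lt O h1 (map_one _)
  have v0 := valuation_eq_one_of_sub_lt O h0 (map_one _)
  have n1 : (g (a + 1) : Ω) ≠ 0 := fun h => by rw [h] at v1; simp at v1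
  have n0 : ((-g a : O) : Ω) ≠ 0 := fun h => by rw [h] at v0; simp at v0
  have n0' : (g a : Ω) ≠ 0 := by simpa using n0
  have hq1 : q1 ≠ 0 := fun h => by
    rw [h, zero_mul] at e1
    exact (mul_ne_zero (mul_ne_zero hc ht) n1) e1.symm
  refine ⟨-(Q.coeff a / Q.coeff (a + 1)), ?_⟩
  have e2 : t = -(q0 / q1) * (g (a + 1) / (-g a : O)) := by
    have hta : t ^ a ≠ 0 := pow_ne_zero _ ht
    have : q1 * t * g a = q0 * g (a + 1) := by
      have : (q1 * t ^ (a + 1)) * (c * t * g a) = (q0 * t ^ a) * (c * t * g (a + 1)) := by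
        rw [e1, e0]; ring
      have h3 : (t ^ a * c * t) * (q1 * t * g a) = (t ^ a * c * t) * (q0 * g (a + 1)) := by
        rw [pow_succ] at this; linear_combination this
      exact mul_left_cancel₀ (mul_ne_zero (mul_ne_zero hta hc) ht) h3
    push_cast
    field_simp
    linear_combination this
  have hs1 : SameLeading O (g (a + 1) : Ω) 1 := ⟨_, h1, by ring⟩
  have hs0 : SameLeading O ((-g a : O) : Ω) 1 := ⟨_, h0, by ring⟩
  obtain ⟨μ, hμ, e3⟩ := hs1.trans hs0.symm
  refine ⟨μ, hμ, ?_⟩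
  rw [map_neg, map_div₀]
  conv_lhs => rw [e2, e3, mul_div_assoc, mul_div_assoc', mul_div_cancel_left₀ _ n0]

end Newton

/-! ### Immediacy of the adjunction of a Hensel zero -/

section OneStep

variable {Ω : Type*} [Field Ω] {O : ValuationSubring Ω}
variable {F : Type*} [Field F] [Algebra F Ω]

/-- A Hensel zero is a simple zero, hence separable. -/
theorem IsHenselRoot.isSeparable {Q : F[X]} {a : F} {ξ : Ω}
    (h : IsHenselRoot O (Q.map (algebraMap F Ω)) (algebraMap F Ω a) ξ) : IsSeparable F ξ := by
  have hr : aeval ξ Q = 0 := by rw [← eval_map_algebraMap]; exact h.root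
  have hQ0 : Q ≠ 0 := fun h0 => h.ne_zero (by rw [h0, Polynomial.map_zero])
  have hint : IsIntegral F ξ := (isAlgebraic_iff_isIntegral).1 ⟨Q, hQ0, hr⟩
  unfold IsSeparable
  rw [separable_iff_derivative_ne_zero (minpoly.irreducible hint)]
  intro h0
  obtain ⟨r, hr⟩ := minpoly.dvd F ξ hr
  apply h.derivative_ne_zero
  rw [derivative_map, eval_map_algebraMap, hr, derivative_mul, h0]
  simp

/-- The adjunction of one Hensel zero `ξ` is an immediate extension. An element `x = g(ξ)` is
multiplied by a power of an element `h(ξ)` which is congruent to `1` and whose other conjugates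
lie in the maximal ideal. For a suitable exponent, the valuation of the product differs from the
valuations of all its other conjugates. -/
theorem exists_sameLeading_of_mem_adjoin [Normal F Ω] {Q : F[X]} {a : F} {ξ : Ω}
    (h : IsHenselRoot O (Q.map (algebraMap F Ω)) (algebraMap F Ω a) ξ) {x : Ω}
    (hx : x ∈ IntermediateField.adjoin F {ξ}) :
    ∃ y : F, SameLeading O x (algebraMap F Ω y) := by
  by_cases hx0 : x = 0
  · exact ⟨0, by rw [hx0, map_zero]; exact .refl 0⟩
  have hsep := h.isSeparable
  obtain ⟨g, rfl⟩ : ∃ g : F[X], aeval ξ g = x := by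
    have hx' : x ∈ (IntermediateField.adjoin F {ξ}).toSubalgebra := hx
    rw [IntermediateField.adjoin_simple_toSubalgebra_of_isAlgebraic hsep.isIntegral.isAlgebraic,
      Algebra.adjoin_singleton_eq_range_aeval] at hx'
    exact hx'
  set ι := algebraMap F Ω with hι
  obtain ⟨S, hS⟩ : ∃ S : F[X], Q = C (Q.eval a) + (X - C a) * S := by
    obtain ⟨S, hS⟩ := X_sub_C_dvd_sub_C_eval (p := Q) (a := a)
    exact ⟨S, by rw [← hS]; ring⟩
  have hSmem : ∀ n, (S.map ι).coeff n ∈ O := by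
    have hQV : ∀ n, Q.coeff n ∈ O.comap ι := fun n => by
      simpa using h.coeff_mem n
    obtain ⟨P, hP⟩ := exists_map_subtype_eq (O.comap ι) hQV
    obtain ⟨S', hS'⟩ := X_sub_C_dvd_sub_C_eval (p := P)
      (a := (⟨a, h.base_mem⟩ : O.comap ι))
    have h3 := congrArg (Polynomial.map (O.comap ι).subtype) hS'
    have h4 : (X - C a) * S = (X - C a) * S'.map (O.comap ι).subtype := by
      have e : (P.eval ⟨a, h.base_mem⟩ : O.comap ι) = Q.eval a := by
        have hb : a ∈ O.comap ι := h.base_mem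
        have := eval_map_apply (p := P) (O.comap ι).subtype (⟨a, hb⟩ : O.comap ι)
        rw [hP] at this
        exact this.symm
      rw [Polynomial.map_sub, hP, map_C, Polynomial.map_mul, Polynomial.map_sub, map_X, map_C,
        ValuationSubring.subtype_apply, ValuationSubring.subtype_apply, e] at h3
      rw [← h3]; linear_combination -hS
    have h5 := mul_left_cancel₀ (X_sub_C_ne_zero a) h4
    intro n
    rw [coeff_map, h5, coeff_map]
    exact (S'.coeff n).2
  have hd : Q.derivative.eval a = S.eval a := by
    rw [hS]; simp
  set d := Q.derivative.eval a with hd'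
  have hvd : O.valuation (ι d) = 1 := by
    have := h.valuation_derivative
    rwa [derivative_map, eval_map_apply] at this
  have hd0 : ι d ≠ 0 := fun h0 => by rw [h0] at hvd; simp at hvd
  set H : F[X] := C d⁻¹ * S with hH
  have evH (z : Ω) : aeval z H = (ι d)⁻¹ * (S.map ι).eval z := by
    rw [hH, map_mul, aeval_C, map_inv₀, eval_map_algebraMap]
  -- `h(ξ)` is congruent to `1`
  have hHξ : O.valuation (aeval ξ H - 1) < 1 := by
    have h1 : aeval ξ H - 1 = (ι d)⁻¹ * ((S.map ι).eval ξ - (S.map ι).eval (ι a)) := by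
      rw [evH, mul_sub, eval_map_apply (x := a), ← hd, inv_mul_cancel₀ hd0]
    rw [h1, map_mul, map_inv₀, hvd, inv_one, one_mul]
    exact (valuation_eval_sub_le O hSmem h.mem h.base_mem).trans_lt h.close
  have hHξ1 : O.valuation (aeval ξ H) = 1 := valuation_eq_one_of_sub_lt O hHξ (map_one _)
  -- at the other zeros of `Q`, the value of `h` lies in the maximal ideal
  have hHother : ∀ z, aeval z Q = 0 → z ≠ ξ → O.valuation (aeval z H) < 1 := by
    intro z hz hne
    have hfar : 1 ≤ O.valuation (z - ι a) := by
      by_contra hlt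
      refine hne (IsHenselRoot.unique (W := O) (Q := Q.map ι) (a := ι a) ?_ h)
      exact ⟨h.coeff_mem, h.base_mem, h.valuation_derivative,
        by rw [eval_map_algebraMap]; exact hz, not_le.1 hlt⟩
    have h1 := hz
    rw [hS] at h1
    simp only [map_add, map_mul, aeval_C, map_sub, aeval_X] at h1
    rw [← eval_map_algebraMap] at h1
    have h2 : (z - ι a) * (S.map ι).eval z = -ι (Q.eval a) := by
      linear_combination h1
    have h3 := congrArg O.valuation h2
    rw [map_mul, Valuation.map_neg] at h3
    have h4 : O.valuation (ι (Q.eval a)) < 1 := by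
      have := h.valuation_eval_base
      rwa [eval_map_apply] at this
    rw [evH, map_mul, map_inv₀, hvd, inv_one, one_mul]
    exact (le_mul_of_one_le_left' hfar).trans_lt (h3 ▸ h4)
  -- the choice of the exponent
  obtain ⟨k, hk⟩ : ∃ k : ℕ, ∀ z, aeval z Q = 0 → z ≠ ξ →
      O.valuation (aeval z (H ^ k * g)) ≠ O.valuation (aeval ξ g) := by
    have hQ0 : Q ≠ 0 := fun h0 => h.ne_zero (by rw [h0, Polynomial.map_zero])
    let bad : Ω → Set ℕ := fun z => {k | O.valuation (aeval z (H ^ k * g)) =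
      O.valuation (aeval ξ g)}
    have hfin : (⋃ z ∈ {z | aeval z Q = 0 ∧ z ≠ ξ}, bad z).Finite := by
      refine Set.Finite.biUnion (((Q.rootSet Ω).toFinite).subset ?_) ?_
      · rintro z ⟨hz, -⟩
        exact (mem_rootSet_of_ne hQ0).2 hz
      · rintro z ⟨hz, hne⟩
        have hb := hHother z hz hne
        refine Set.Subsingleton.finite ?_
        have main : ∀ k l : ℕ, k ∈ bad z → l ∈ bad z → ¬ k < l := by
          intro k l hk hl hkl
          have hx1 : O.valuation (aeval ξ g) ≠ 0 := by simpa using hx0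
          have hk' : O.valuation (aeval z H) ^ k * O.valuation (aeval z g) =
            O.valuation (aeval ξ g) := by simpa [bad] using hk
          have hl' : O.valuation (aeval z H) ^ l * O.valuation (aeval z g) =
            O.valuation (aeval ξ g) := by simpa [bad] using hl
          have hz0 : O.valuation (aeval z g) ≠ 0 := fun h0 => by
            rw [h0, mul_zero] at hk'; exact hx1 hk'.symm
          have hH0 : O.valuation (aeval z H) ≠ 0 := fun h0 => by
            rw [h0, zero_pow (by omega), zero_mul] at hl'; exact hx1 hl'.symm
          have e := mul_right_cancel₀ hz0 (hk'.trans hl'.symm)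
          exact (pow_lt_pow_right_of_lt_one₀ (zero_lt_iff.2 hH0) hb hkl).ne' e
        intro k hk l hl
        rcases lt_trichotomy k l with h1 | h1 | h1
        · exact (main k l hk hl h1).elim
        · exact h1
        · exact (main l k hl hk h1).elim
    obtain ⟨k, hk⟩ := hfin.exists_notMem
    refine ⟨k, fun z hz hne hbad => hk ?_⟩
    simp only [Set.mem_iUnion]
    exact ⟨z, ⟨hz, hne⟩, hbad⟩
  set t := aeval ξ (H ^ k * g) with ht
  have htx : SameLeading O t (aeval ξ g) := by
    refine ⟨aeval ξ H ^ k - 1, valuation_pow_sub_one_lt hHξ k, ?_⟩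
    rw [ht, map_mul, map_pow]; ring
  have ht0 : t ≠ 0 := fun h0 => hx0 (htx.eq_zero_iff.1 h0)
  have htsep : IsSeparable F t := by
    have := (IntermediateField.isSeparable_adjoin_simple_iff_isSeparable F Ω).2 hsep
    have hmem : t ∈ IntermediateField.adjoin F {ξ} := by
      rw [← IntermediateField.mem_toSubalgebra,
        IntermediateField.adjoin_simple_toSubalgebra_of_isAlgebraic hsep.isIntegral.isAlgebraic,
        Algebra.adjoin_singleton_eq_range_aeval]
      exact ⟨_, rfl⟩
    have h1 := Algebra.IsSeparable.isSeparable F (⟨t, hmem⟩ : IntermediateField.adjoin F {ξ})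
    have h2 := h1.map (f := (IntermediateField.adjoin F {ξ}).val)
    simpa using h2
  -- the roots of the minimal polynomial of `t`
  have hsplit : ((minpoly F t).map ι).Splits := Normal.splits inferInstance t
  have htroot : t ∈ ((minpoly F t).map ι).roots := by
    rw [mem_roots ((minpoly.monic htsep.isIntegral).map ι).ne_zero, IsRoot,
      eval_map_algebraMap, minpoly.aeval]
  obtain ⟨R, hR⟩ := Multiset.exists_cons_of_mem htroot
  have hnodup : ((minpoly F t).map ι).roots.Nodup :=
    nodup_roots (Separable.map htsep)
  have hprod : (minpoly F t).map ι = ((t ::ₘ R).map fun τ => X - C τ).prod := by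
    rw [← hR]
    exact hsplit.eq_prod_roots_of_monic ((minpoly.monic htsep.isIntegral).map ι)
  obtain ⟨y, hy⟩ := exists_sameLeading_of_roots O ht0 hprod (by
    intro τ hτ
    rw [hR, Multiset.nodup_cons] at hnodup
    have hτt : τ ≠ t := fun e => hnodup.1 (e ▸ hτ)
    have hτroot : aeval τ (minpoly F t) = 0 := by
      have : τ ∈ ((minpoly F t).map ι).roots := hR ▸ Multiset.mem_cons_of_mem hτ
      rw [← eval_map_algebraMap]
      exact (mem_roots'.1 this).2
    obtain ⟨σ, hσ⟩ := (isConjRoot_of_aeval_eq_zero htsep.isIntegral hτroot).exists_algEquiv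
    have hτ' : τ = aeval (σ.symm ξ) (H ^ k * g) := by
      have h9 : aeval (σ.symm ξ) (H ^ k * g) = σ.symm t := by
        rw [ht]; exact aeval_algHom_apply σ.symm.toAlgHom ξ _
      rw [h9, ← hσ, σ.symm_apply_apply]
    rw [htx.valuation_eq, hτ']
    refine hk _ ?_ ?_
    · have h9 : aeval (σ.symm ξ) Q = σ.symm (aeval ξ Q) :=
        aeval_algHom_apply σ.symm.toAlgHom ξ _
      rw [h9, ← eval_map_algebraMap, h.root, map_zero]
    · intro e
      rw [e] at hτ'
      exact hτt hτ')
  exact ⟨y, htx.symm.trans hy⟩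

end OneStep

/-! ### Existence of an immediate henselization -/

section Closure

variable {K : Type*} [Field K] {Ω : Type*} [Field Ω] [Algebra K Ω]

theorem exists_map_algebraMap_eq {F : IntermediateField K Ω} {Q : Polynomial Ω}
    (hQ : ∀ n, Q.coeff n ∈ F) : ∃ P : Polynomial F, P.map (algebraMap F Ω) = Q := by
  have : Q ∈ Polynomial.lifts (algebraMap F Ω) :=
    (Polynomial.lifts_iff_coeff_lifts Q).2 fun n => ⟨⟨_, hQ n⟩, rfl⟩
  exact (Polynomial.mem_lifts Q).1 this

theorem IsHenselRoot.mem_of_forall_coeff_mem {O : ValuationSubring Ω} {F : IntermediateField K Ω}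
    (hF : StableUnderHenselZeros O F) {Q : Polynomial Ω} {a x : Ω} (h : IsHenselRoot O Q a x)
    (hQ : ∀ n, Q.coeff n ∈ F) (ha : a ∈ F) : x ∈ F :=
  stableUnderHenselZeros_iff.1 hF Q a x h hQ ha

/-- A maximal immediate subextension of `Ω / K` is stable under the adjunction of Hensel zeros. -/
theorem exists_stable_immediate [Normal K Ω] (O : ValuationSubring Ω) :
    ∃ F : IntermediateField K Ω, StableUnderHenselZeros O F ∧
      ∀ x ∈ F, ∃ y : K, SameLeading O x (algebraMap K Ω y) := by
  let S : Set (IntermediateField K Ω) :=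
    {F | ∀ x ∈ F, ∃ y : K, SameLeading O x (algebraMap K Ω y)}
  have hbot : ⊥ ∈ S := by
    intro x hx
    obtain ⟨y, rfl⟩ := IntermediateField.mem_bot.1 hx
    exact ⟨y, .refl _⟩
  obtain ⟨F, -, hmax⟩ := zorn_le_nonempty₀ S (by
    intro c hc hchain F₀ hF₀
    refine ⟨sSup c, ?_, fun F hF => le_sSup hF⟩
    intro x hx
    rw [sSup_eq_iSup'] at hx
    have : Nonempty c := ⟨⟨F₀, hF₀⟩⟩
    have hdir : Directed (· ≤ ·) (fun F : c => (F : IntermediateField K Ω)) :=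
      hchain.directedOn.directed_val
    rw [← SetLike.mem_coe, IntermediateField.coe_iSup_of_directed hdir, Set.mem_iUnion] at hx
    obtain ⟨F, hxF⟩ := hx
    exact hc F.2 x hxF) ⊥ hbot
  refine ⟨F, stableUnderHenselZeros_iff.2 ?_, hmax.1⟩
  intro Q a x hx hQ ha
  obtain ⟨P, rfl⟩ := exists_map_algebraMap_eq hQ
  have hN : Normal F Ω := Normal.tower_top_of_normal K F Ω
  let F' := (IntermediateField.adjoin F {x}).restrictScalars K
  have hle : F ≤ F' := fun z hz => (IntermediateField.adjoin F {x}).algebraMap_mem ⟨z, hz⟩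
  have hF' : F' ∈ S := by
    intro z hz
    obtain ⟨y, hy⟩ := exists_sameLeading_of_mem_adjoin (F := F) (a := ⟨a, ha⟩) hx hz
    obtain ⟨y', hy'⟩ := hmax.1 y y.2
    exact ⟨y', hy.trans hy'⟩
  exact hmax.2 hF' hle (IntermediateField.mem_adjoin_simple_self F x)

variable (K) in
/-- The smallest subextension of `Ω / K` which is stable under the adjunction of Hensel zeros. -/
def henselClosure (O : ValuationSubring Ω) : IntermediateField K Ω :=
  sInf {F | StableUnderHenselZeros O F}

theorem henselClosure_le {O : ValuationSubring Ω} {F : IntermediateField K Ω}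
    (hF : StableUnderHenselZeros O F) : henselClosure K O ≤ F := sInf_le hF

theorem stable_henselClosure (O : ValuationSubring Ω) :
    StableUnderHenselZeros O (henselClosure K O) := by
  rw [stableUnderHenselZeros_iff]
  intro Q a x hx hQ ha
  unfold henselClosure
  rw [IntermediateField.mem_sInf]
  intro F hF
  exact hx.mem_of_forall_coeff_mem hF (fun n => henselClosure_le hF (hQ n))
    (henselClosure_le hF ha)

/-- In a valued extension with all Hensel zeros, the smallest stable subextension is a
henselization: a stable intermediate field of it is stable in the large field. -/
theorem isHenselization_henselClosure {V : ValuationSubring K} {O : ValuationSubring Ω}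
    (hV : IsValuedExtension V O) (hO : ContainsHenselZeros O) :
    IsHenselization V (O.comap (algebraMap (henselClosure K O) Ω)) where
  isValuedExtension := by
    unfold IsValuedExtension at hV ⊢
    rw [ValuationSubring.comap_comap, ← hV]
    rfl
  containsHenselZeros := by
    rw [containsHenselZeros_iff]
    intro Q a hQ ha h1 h2
    obtain ⟨x, hx⟩ := containsHenselZeros_iff.1 hO (Q.map (algebraMap _ Ω)) (algebraMap _ Ω a)
      (fun n => by rw [coeff_map]; exact hQ n) ha
      (by rw [eval_map_apply, comap_valuation_lt_one rfl]; exact h1)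
      (by rw [derivative_map, eval_map_apply, comap_valuation_eq_one rfl]; exact h2)
    have hmem : x ∈ henselClosure K O := hx.mem_of_forall_coeff_mem (stable_henselClosure O)
      (fun n => by rw [coeff_map]; exact (Q.coeff n).2) a.2
    exact ⟨⟨x, hmem⟩, IsHenselRoot.of_map rfl hx⟩
  isGenerated := by
    intro F hF
    rw [stableUnderHenselZeros_iff] at hF
    have hle : henselClosure K O ≤ IntermediateField.lift F := by
      refine henselClosure_le (stableUnderHenselZeros_iff.2 ?_)
      intro Q a x hx hQ ha
      have hle' := IntermediateField.lift_le F
      have hxm := hx.mem_of_forall_coeff_mem (stable_henselClosure O) (fun n => hle' (hQ n))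
        (hle' ha)
      obtain ⟨P, rfl⟩ := exists_map_algebraMap_eq (fun n => hle' (hQ n))
      refine (IntermediateField.mem_lift (⟨x, hxm⟩ : henselClosure K O)).2
        (hF P ⟨a, hle' ha⟩ ⟨x, hxm⟩ (IsHenselRoot.of_map rfl hx) (fun n => ?_) ?_)
      · have := hQ n
        rw [coeff_map] at this
        exact (IntermediateField.mem_lift _).1 this
      · exact (IntermediateField.mem_lift (⟨a, hle' ha⟩ : henselClosure K O)).1 ha
    rw [eq_top_iff]
    intro x _
    exact (IntermediateField.mem_lift x).1 (hle x.2)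

/-- Every valued field has an immediate henselization. -/
theorem exists_isHenselization_immediate {K : Type u} [Field K] (V : ValuationSubring K) :
    ∃ (L : Type u) (_ : Field L) (_ : Algebra K L) (W : ValuationSubring L),
      IsHenselization V W ∧ ∀ x : L, ∃ y : K, SameLeading W x (algebraMap K L y) := by
  obtain ⟨O, hO⟩ := exists_valuationSubring_comap_eq V (algebraMap K (AlgebraicClosure K))
  refine ⟨henselClosure K O, inferInstance, inferInstance, _,
    isHenselization_henselClosure hO (containsHenselZeros_of_isAlgClosed O), ?_⟩
  intro x
  obtain ⟨F, hF, him⟩ := exists_stable_immediate (K := K) O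
  obtain ⟨y, hy⟩ := him x (henselClosure_le hF x.2)
  exact ⟨y, (SameLeading.of_map (f := algebraMap (henselClosure K O) (AlgebraicClosure K))
    rfl).1 hy⟩

end Closure

/-! ### Separability -/

section Separability

variable {K : Type*} [Field K] {L : Type*} [Field L] [Algebra K L] {V : ValuationSubring K}
  {W : ValuationSubring L}

/-- A henselization is separable, since a Hensel zero is a simple zero, so that the separable
closure is stable. -/
theorem IsHenselization.algebra_isSeparable (h : IsHenselization V W) :
    Algebra.IsSeparable K L := by
  rw [← separableClosure.eq_top_iff]
  refine h.isGenerated _ (stableUnderHenselZeros_iff.2 ?_)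
  intro Q a x hx hQ ha
  obtain ⟨P, rfl⟩ := exists_map_algebraMap_eq hQ
  have := IsHenselRoot.isSeparable (F := separableClosure K L) (a := ⟨a, ha⟩) hx
  rw [mem_separableClosure_iff]
  exact IsSeparable.of_algebra_isSeparable_of_isSeparable K this

end Separability

/-! ### Conjugacy of valuation rings -/

section Conjugacy

variable {K : Type*} [Field K] {Ω : Type*} [Field Ω] [Algebra K Ω]

/-- An algebraic element is a zero of a polynomial over `V` in which one coefficient is `1` and
all higher coefficients lie in the maximal ideal. -/
theorem exists_poly_coeff_eq_one (V : ValuationSubring K) {x : Ω} (hx : IsAlgebraic K x) :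
    ∃ (q : K[X]) (j : ℕ), aeval x q = 0 ∧ (∀ i, q.coeff i ∈ V) ∧ q.coeff j = 1 ∧
      ∀ i, j < i → V.valuation (q.coeff i) < 1 := by
  obtain ⟨p, hp, hpx⟩ := hx
  obtain ⟨i₀, hi₀, hmax⟩ := Finset.exists_max_image p.support (fun i => V.valuation (p.coeff i))
    (by simpa [Finset.nonempty_iff_ne_empty] using hp)
  let T := p.support.filter fun i => V.valuation (p.coeff i) = V.valuation (p.coeff i₀)
  have hT : T.Nonempty := ⟨i₀, by simp only [T, Finset.mem_filter]; exact ⟨hi₀, trivial⟩⟩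
  let j := T.max' hT
  obtain ⟨hj, hjv⟩ := Finset.mem_filter.1 (T.max'_mem hT)
  change j ∈ p.support at hj
  change V.valuation (p.coeff j) = _ at hjv
  have hle (i : ℕ) : V.valuation (p.coeff i) ≤ V.valuation (p.coeff j) := by
    by_cases hi : i ∈ p.support
    · exact hjv ▸ hmax i hi
    · simp [notMem_support_iff.1 hi]
  have hlt (i : ℕ) (hi : j < i) : V.valuation (p.coeff i) < V.valuation (p.coeff j) := by
    refine lt_of_le_of_ne (hle i) fun e => ?_
    have hiT : i ∈ T := by
      refine Finset.mem_filter.2 ⟨mem_support_iff.2 fun h0 => ?_, e.trans hjv⟩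
      rw [h0, map_zero, eq_comm, map_eq_zero] at e
      exact mem_support_iff.1 hj e
    exact absurd (T.le_max' i hiT) (not_le.2 hi)
  have hj0 := mem_support_iff.1 hj
  have hpos : 0 < V.valuation (p.coeff j) := by simpa [zero_lt_iff] using hj0
  refine ⟨C (p.coeff j)⁻¹ * p, j, by simp [hpx], fun i => ?_, ?_, fun i hi => ?_⟩
  · rw [coeff_C_mul, ← V.valuation_le_one_iff, map_mul, map_inv₀, mul_comm, ← div_eq_mul_inv]
    exact (div_le_one₀ hpos).2 (hle i)
  · rw [coeff_C_mul, inv_mul_cancel₀ hj0]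
  · rw [coeff_C_mul, map_mul, map_inv₀, mul_comm, ← div_eq_mul_inv]
    exact (div_lt_one₀ hpos).2 (hlt i hi)

/-- An integrally closed subring of a field is an intersection of valuation rings. -/
theorem isIntegral_of_forall_valuationSubring {V : ValuationSubring K} {b : Ω}
    (h : ∀ U : ValuationSubring Ω, (∀ z ∈ V, algebraMap K Ω z ∈ U) → b ∈ U) :
    IsIntegral V b := by
  by_contra hb
  have hb' : b ∉ (integralClosure V Ω).toSubring := hb
  have : IsIntegrallyClosedIn (integralClosure V Ω).toSubring Ω :=
    inferInstanceAs (IsIntegrallyClosedIn (integralClosure V Ω) Ω)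
  obtain ⟨U, hU, hbU⟩ := Subring.exists_le_valuationSubring_of_isIntegrallyClosedIn hb'
  exact hbU (h U fun z hz => hU ((integralClosure V Ω).algebraMap_mem ⟨z, hz⟩))

/-- Every element of a field algebraic over `K` is a quotient of two elements which are integral
over `V`; if the element lies in a given valuation ring `O` above `V`, then the denominator may
be taken to be a unit of `O`. -/
theorem exists_integral_mul_eq {V : ValuationSubring K} {O : ValuationSubring Ω}
    (hO : O.comap (algebraMap K Ω) = V) {x : Ω} (hx : IsAlgebraic K x) (hxO : x ∈ O) :
    ∃ b c : Ω, IsIntegral V b ∧ IsIntegral V c ∧ O.valuation b = 1 ∧ b * x = c := by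
  obtain ⟨q, j, hq, hqV, hj, hlt⟩ := exists_poly_coeff_eq_one V hx
  set n := q.natDegree
  set a : ℕ → Ω := fun i => algebraMap K Ω (q.coeff i)
  set b := ∑ i ∈ Finset.range (n + 1), a (j + i) * x ^ i with hb
  set s := ∑ i ∈ Finset.range j, a i * x ^ i with hs
  have hrel : s + x ^ j * b = 0 := by
    rw [aeval_eq_sum_range' (n := j + (n + 1)) (by omega), Finset.sum_range_add] at hq
    rw [hs, hb, Finset.mul_sum, ← hq]
    congr 1
    · exact Finset.sum_congr rfl fun i _ => (Algebra.smul_def _ _).symm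
    · refine Finset.sum_congr rfl fun i _ => ?_
      rw [Algebra.smul_def, pow_add]; ring
  have key (U : ValuationSubring Ω) (hU : ∀ z ∈ V, algebraMap K Ω z ∈ U) :
      b ∈ U ∧ b * x ∈ U := by
    have ha (i : ℕ) : a i ∈ U := hU _ (hqV i)
    rcases U.mem_or_inv_mem x with hxU | hxU
    · have hbU : b ∈ U := sum_mem fun i _ => mul_mem (ha _) (pow_mem hxU _)
      exact ⟨hbU, mul_mem hbU hxU⟩
    · by_cases hx0 : x = 0
      · have hbU : b ∈ U := sum_mem fun i _ => mul_mem (ha _) (pow_mem (hx0 ▸ zero_mem U) _)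
        exact ⟨hbU, by rw [hx0, mul_zero]; exact zero_mem U⟩
      have hbx : b * x = -∑ i ∈ Finset.range j, a i * x⁻¹ ^ (j - i - 1) := by
        have hxj : x ^ j ≠ 0 := pow_ne_zero _ hx0
        refine mul_left_cancel₀ hxj ?_
        have : x ^ j * ∑ i ∈ Finset.range j, a i * x⁻¹ ^ (j - i - 1) = s * x := by
          rw [hs, Finset.mul_sum, Finset.sum_mul]
          refine Finset.sum_congr rfl fun i hi => ?_
          have hi' := Finset.mem_range.1 hi
          have e : x ^ j = x ^ (i + 1) * x ^ (j - i - 1) := by rw [← pow_add]; congr 1; omega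
          rw [e, inv_pow, pow_succ]
          field_simp
        rw [mul_neg, this]
        linear_combination x * hrel
      have hc : b * x ∈ U := by
        rw [hbx]
        exact neg_mem (sum_mem fun i _ => mul_mem (ha _) (pow_mem hxU _))
      refine ⟨?_, hc⟩
      have := mul_mem hc hxU
      rwa [mul_assoc, mul_inv_cancel₀ hx0, mul_one] at this
  refine ⟨b, b * x, isIntegral_of_forall_valuationSubring fun U hU => (key U hU).1,
    isIntegral_of_forall_valuationSubring fun U hU => (key U hU).2, ?_, rfl⟩
  rw [hb, Finset.sum_range_succ']
  have h0 : a (j + 0) * x ^ 0 = 1 := by simp [a, hj]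
  rw [h0, add_comm]
  refine valuation_one_add O (Valuation.map_sum_lt _ one_ne_zero fun i _ => ?_)
  rw [map_mul]
  refine (mul_le_of_le_one_right' ((O.valuation_le_one_iff _).2 (pow_mem hxO _))).trans_lt ?_
  exact (comap_valuation_lt_one hO _).2 (hlt _ (by omega))

theorem mem_of_isIntegral {V : ValuationSubring K} {O : ValuationSubring Ω}
    (hO : O.comap (algebraMap K Ω) = V) {b : Ω} (hb : IsIntegral V b) : b ∈ O := by
  subst hO
  let f : O.comap (algebraMap K Ω) →+* O :=
    ((algebraMap K Ω).comp (O.comap (algebraMap K Ω)).subtype).codRestrict O.toSubring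
      fun z => z.2
  have h1 : IsIntegral O b := by
    obtain ⟨p, hp, hpb⟩ := hb
    refine ⟨p.map f, hp.map f, ?_⟩
    rw [eval₂_map]
    exact hpb
  obtain ⟨y, hy⟩ := IsIntegrallyClosed.isIntegral_iff.1 h1
  exact hy ▸ y.2

/-- The prime ideal of the integral closure of `V` in `Ω` which is cut out by the maximal ideal of
a valuation ring above `V`. -/
def centerIdeal {V : ValuationSubring K} {O : ValuationSubring Ω}
    (hO : O.comap (algebraMap K Ω) = V) : Ideal (integralClosure V Ω) :=
  (IsLocalRing.maximalIdeal O).comap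
    ((integralClosure V Ω).val.toRingHom.codRestrict O.toSubring fun b =>
      mem_of_isIntegral hO b.2)

theorem mem_centerIdeal {V : ValuationSubring K} {O : ValuationSubring Ω}
    (hO : O.comap (algebraMap K Ω) = V) (b : integralClosure V Ω) :
    b ∈ centerIdeal hO ↔ O.valuation (b : Ω) < 1 :=
  O.valuation_lt_one_iff ⟨(b : Ω), mem_of_isIntegral hO b.2⟩

instance isPrime_centerIdeal {V : ValuationSubring K} {O : ValuationSubring Ω}
    (hO : O.comap (algebraMap K Ω) = V) : (centerIdeal hO).IsPrime :=
  Ideal.comap_isPrime _ _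

/-- The action of the Galois group on the integral closure of `V`. -/
@[reducible]
def integralClosureAction (V : ValuationSubring K) :
    MulSemiringAction (Ω ≃ₐ[K] Ω) (integralClosure V Ω) where
  smul σ b := ⟨σ b, b.2.map (σ.toAlgHom.restrictScalars V)⟩
  one_smul _ := Subtype.ext rfl
  mul_smul _ _ _ := Subtype.ext rfl
  smul_zero σ := Subtype.ext (map_zero σ)
  smul_add σ _ _ := Subtype.ext (map_add σ _ _)
  smul_one σ := Subtype.ext (map_one σ)
  smul_mul σ _ _ := Subtype.ext (map_mul σ _ _)

/-- If `σ` carries units of `O₁` which are integral over `V` to units of `O₂`, then it carries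
`O₁` into `O₂`. -/
theorem map_mem_of_forall_integral [Algebra.IsAlgebraic K Ω] {V : ValuationSubring K}
    {O₁ O₂ : ValuationSubring Ω} (h₁ : O₁.comap (algebraMap K Ω) = V)
    (h₂ : O₂.comap (algebraMap K Ω) = V) (σ : Ω ≃ₐ[K] Ω)
    (hσ : ∀ b, IsIntegral V b → (O₂.valuation (σ b) < 1 → O₁.valuation b < 1)) {x : Ω}
    (hx : x ∈ O₁) : σ x ∈ O₂ := by
  obtain ⟨b, c, hb, hc, hv, rfl⟩ :=
    exists_integral_mul_eq h₁ (Algebra.IsAlgebraic.isAlgebraic x) hx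
  have hint {z : Ω} (hz : IsIntegral V z) : O₂.valuation (σ z) ≤ 1 :=
    (O₂.valuation_le_one_iff _).2
      (mem_of_isIntegral h₂ (hz.map (σ.toAlgHom.restrictScalars V)))
  have h1 : O₂.valuation (σ b) = 1 :=
    (hint hb).eq_or_lt.resolve_right fun h => (hσ b hb h).ne hv
  have h2 := hint hc
  rwa [map_mul, map_mul, h1, one_mul, O₂.valuation_le_one_iff] at h2

open scoped Pointwise in
/-- The valuation rings of a Galois extension of `K` which lie above `V` are conjugate: their
centers on the integral closure of `V` are. -/
theorem exists_algEquiv_mem_iff [IsGalois K Ω] {V : ValuationSubring K}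
    {O₁ O₂ : ValuationSubring Ω} (h₁ : O₁.comap (algebraMap K Ω) = V)
    (h₂ : O₂.comap (algebraMap K Ω) = V) : ∃ σ : Ω ≃ₐ[K] Ω, ∀ x, σ x ∈ O₂ ↔ x ∈ O₁ := by
  let act := integralClosureAction (Ω := Ω) V
  let top : TopologicalSpace (integralClosure V Ω) := ⊥
  have : DiscreteTopology (integralClosure V Ω) := ⟨rfl⟩
  have : SMulCommClass (Ω ≃ₐ[K] Ω) V (integralClosure V Ω) :=
    ⟨fun σ v b => Subtype.ext (map_smul (σ.toAlgHom.restrictScalars V) v (b : Ω))⟩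
  have : ContinuousSMul (Ω ≃ₐ[K] Ω) (integralClosure V Ω) := by
    rw [continuousSMul_iff_stabilizer_isOpen]
    intro b
    convert stabilizer_isOpen_of_isIntegral (K := K) (b : Ω) using 1
    ext σ
    simp only [SetLike.mem_coe, MulAction.mem_stabilizer_iff]
    exact Subtype.ext_iff
  have : Algebra.IsInvariant V (integralClosure V Ω) (Ω ≃ₐ[K] Ω) := by
    refine ⟨fun b hb => ?_⟩
    have hfix : (b : Ω) ∈ (⊥ : IntermediateField K Ω) :=
      (InfiniteGalois.mem_bot_iff_fixed _).2 fun σ => congrArg Subtype.val (hb σ)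
    obtain ⟨k, hk⟩ := IntermediateField.mem_bot.1 hfix
    have hkV : k ∈ V := by
      rw [← h₁, ValuationSubring.mem_comap, hk]
      exact mem_of_isIntegral h₁ b.2
    exact ⟨⟨k, hkV⟩, Subtype.ext hk⟩
  have hunder {O : ValuationSubring Ω} (h : O.comap (algebraMap K Ω) = V) (z : V) :
      z ∈ (centerIdeal h).under V ↔ V.valuation (z : K) < 1 := by
    rw [Ideal.under_def, Ideal.mem_comap, mem_centerIdeal]
    exact comap_valuation_lt_one h (z : K)
  obtain ⟨σ, hσ⟩ := Algebra.IsInvariant.exists_smul_of_under_eq_of_profinite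
    (A := V) (G := Ω ≃ₐ[K] Ω) (centerIdeal h₁) (centerIdeal h₂) (by
      ext z
      rw [hunder h₁, hunder h₂])
  have hmem (b : integralClosure V Ω) :
      O₂.valuation (σ b) < 1 ↔ O₁.valuation (b : Ω) < 1 := by
    rw [← mem_centerIdeal h₁ b, ← Ideal.smul_mem_pointwise_smul_iff (a := σ), ← hσ,
      mem_centerIdeal h₂]
    rfl
  refine ⟨σ, fun x => ⟨fun hx => ?_, map_mem_of_forall_integral h₁ h₂ σ fun b hb =>
    (hmem ⟨b, hb⟩).1⟩⟩
  have := map_mem_of_forall_integral h₂ h₁ σ.symm (fun b hb hlt => ?_) hx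
  · rwa [σ.symm_apply_apply] at this
  · have h3 := (hmem ⟨σ.symm b, hb.map (σ.symm.toAlgHom.restrictScalars V)⟩).2 hlt
    change O₂.valuation (σ (σ.symm b)) < 1 at h3
    rwa [σ.apply_symm_apply] at h3

end Conjugacy

/-! ### Uniqueness and the universal property -/

section Uniqueness

variable {K : Type*} [Field K] {L : Type*} [Field L] [Algebra K L] {L' : Type*} [Field L']
  [Algebra K L'] {Ω : Type*} [Field Ω] [Algebra K Ω]
  {V : ValuationSubring K} {W : ValuationSubring L} {W' : ValuationSubring L'}

/-- For compatible embeddings into one valued field, the image of an extension generated by Hensel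
zeros is contained in the image of an extension with all Hensel zeros: the preimage of the latter
is stable. -/
theorem fieldRange_le_of_isGenerated {O : ValuationSubring Ω} {j : L →ₐ[K] Ω} {i : L' →ₐ[K] Ω}
    (hj : O.comap (j : L →+* Ω) = W) (hi : O.comap (i : L' →+* Ω) = W')
    (hL : IsGeneratedByHenselZeros K W) (hL' : ContainsHenselZeros W') (x : L) :
    ∃ y, i y = j x := by
  have h := hL (i.fieldRange.comap j) (stableUnderHenselZeros_iff.2 ?_)
  · have hx : x ∈ i.fieldRange.comap j := h ▸ IntermediateField.mem_top
    exact hx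
  · rintro Q a x hx hQ ⟨a', ha'⟩
    have h1 := hx.map hj
    have : Q.map (j : L →+* Ω) ∈ Polynomial.lifts (i : L' →+* Ω) :=
      (Polynomial.lifts_iff_coeff_lifts _).2 fun n => by
        obtain ⟨y, hy⟩ := hQ n
        exact ⟨y, by rw [coeff_map]; exact hy⟩
    obtain ⟨P, hP⟩ := (Polynomial.mem_lifts _).1 this
    have ha'' : (j : L →+* Ω) a = (i : L' →+* Ω) a' := ha'.symm
    rw [← hP, ha''] at h1
    obtain ⟨z, hz, -⟩ := exists_isHenselRoot_of_map hi hL' h1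
    exact ⟨z, hz⟩

/-- Embeddings of an extension generated by Hensel zeros are unique: the field on which two of them
agree is stable. -/
theorem algHom_eq_of_isGenerated {φ ψ : L →ₐ[K] L'} (hL : IsGeneratedByHenselZeros K W)
    (hφ : W'.comap (φ : L →+* L') = W) (hψ : W'.comap (ψ : L →+* L') = W) : φ = ψ := by
  let E : IntermediateField K L :=
    { AlgHom.equalizer φ ψ with
      inv_mem' := fun x hx => by
        have hx' : φ x = ψ x := hx
        change φ x⁻¹ = ψ x⁻¹
        rw [map_inv₀, map_inv₀, hx'] }
  have hE : E = ⊤ := hL E (stableUnderHenselZeros_iff.2 (by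
    intro Q a x hx hQ ha
    have h1 := hx.map hφ
    have h2 := hx.map hψ
    have e1 : Q.map (φ : L →+* L') = Q.map (ψ : L →+* L') := by
      ext n
      rw [coeff_map, coeff_map]
      exact hQ n
    have e2 : (φ : L →+* L') a = (ψ : L →+* L') a := ha
    rw [← e1, ← e2] at h2
    exact h1.unique h2))
  ext x
  have : x ∈ E := hE ▸ IntermediateField.mem_top
  exact this

/-- Two henselizations embed into the separable closure; after conjugation, the embeddings are
compatible with the same valuation ring, and then they have the same image. -/
theorem exists_algEquiv_of_isHenselization (h : IsHenselization V W)
    (h' : IsHenselization V W') : ∃ φ : L ≃ₐ[K] L', ∀ x, φ x ∈ W' ↔ x ∈ W := by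
  have hs := h.algebra_isSeparable
  have hs' := h'.algebra_isSeparable
  let Ω := SeparableClosure K
  let i₀ : L →ₐ[K] Ω := IsSepClosed.lift
  let i : L' →ₐ[K] Ω := IsSepClosed.lift
  obtain ⟨O₀, hO₀⟩ := exists_valuationSubring_comap_eq W (i₀ : L →+* Ω)
  obtain ⟨O, hO⟩ := exists_valuationSubring_comap_eq W' (i : L' →+* Ω)
  have h1 : O₀.comap (algebraMap K Ω) = V := by
    have := h.isValuedExtension
    unfold IsValuedExtension at this
    rw [← i₀.comp_algebraMap, ← ValuationSubring.comap_comap, hO₀, this]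
  have h2 : O.comap (algebraMap K Ω) = V := by
    have := h'.isValuedExtension
    unfold IsValuedExtension at this
    rw [← i.comp_algebraMap, ← ValuationSubring.comap_comap, hO, this]
  obtain ⟨σ, hσ⟩ := exists_algEquiv_mem_iff h1 h2
  let j : L →ₐ[K] Ω := (σ : Ω →ₐ[K] Ω).comp i₀
  have hj : O.comap (j : L →+* Ω) = W := by
    rw [← hO₀]
    ext x
    exact hσ (i₀ x)
  have hr : j.range = i.range := by
    apply le_antisymm
    · rintro _ ⟨x, rfl⟩
      exact fieldRange_le_of_isGenerated hj hO h.isGenerated h'.containsHenselZeros x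
    · rintro _ ⟨x, rfl⟩
      exact fieldRange_le_of_isGenerated hO hj h'.isGenerated h.containsHenselZeros x
  let φ : L ≃ₐ[K] L' := ((AlgEquiv.ofInjective j j.injective).trans
    (Subalgebra.equivOfEq _ _ hr)).trans (AlgEquiv.ofInjective i i.injective).symm
  have hφ (x : L) : i (φ x) = j x := by
    have : AlgEquiv.ofInjective i i.injective (φ x) =
        Subalgebra.equivOfEq _ _ hr (AlgEquiv.ofInjective j j.injective x) :=
      AlgEquiv.apply_symm_apply _ _
    exact congrArg Subtype.val this
  refine ⟨φ, fun x => ?_⟩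
  rw [← hO, ← hj, ValuationSubring.mem_comap, ValuationSubring.mem_comap]
  change i (φ x) ∈ O ↔ _
  rw [hφ]
  rfl

theorem existsUnique_algEquiv_of_isHenselization (h : IsHenselization V W)
    (h' : IsHenselization V W') : ∃! φ : L ≃ₐ[K] L', ∀ x, φ x ∈ W' ↔ x ∈ W := by
  obtain ⟨φ, hφ⟩ := exists_algEquiv_of_isHenselization h h'
  refine ⟨φ, hφ, fun ψ hψ => ?_⟩
  have := algHom_eq_of_isGenerated (W := W) (W' := W') (φ := (ψ : L →ₐ[K] L'))
    (ψ := (φ : L →ₐ[K] L')) h.isGenerated (by ext x; exact hψ x) (by ext x; exact hφ x)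
  ext x
  exact DFunLike.congr_fun this x

/-- Every valued extension which contains all Hensel zeros receives the henselization. -/
theorem IsHenselization.exists_algHom (h : IsHenselization V W) (h' : IsValuedExtension V W')
    (hz : ContainsHenselZeros W') :
    ∃ φ : L →ₐ[K] L', W'.comap (φ : L →+* L') = W := by
  obtain ⟨φ, hφ⟩ := exists_algEquiv_of_isHenselization h (isHenselization_henselClosure h' hz)
  refine ⟨(henselClosure K W').val.comp (φ : L →ₐ[K] _), ?_⟩
  ext x
  exact hφ x

end Uniqueness

/-! ### Arithmetic of integer polynomials -/

namespace IntPoly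

section Eval

variable {A : Type*} [CommRing A]

/-- The value of the monomial with the given list of exponents at `z₀, z₁, …`. -/
def monVal : (ℕ → A) → List ℕ → A
  | _, [] => 1
  | z, k :: l => z 0 ^ k * monVal (fun j => z (j + 1)) l

/-- The value of an integer polynomial at a sequence of elements of a commutative ring. -/
def ev (z : ℕ → A) (p : IntPoly) : A := (p.map fun m => (m.1 : A) * monVal z m.2).sum

@[simp] theorem monVal_nil (z : ℕ → A) : monVal z [] = 1 := rfl

@[simp] theorem monVal_cons (z : ℕ → A) (k : ℕ) (l : List ℕ) :
    monVal z (k :: l) = z 0 ^ k * monVal (fun j => z (j + 1)) l := rfl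

theorem monVal_append (z : ℕ → A) (l l' : List ℕ) :
    monVal z (l ++ l') = monVal z l * monVal (fun j => z (l.length + j)) l' := by
  induction l generalizing z with
  | nil => simp
  | cons k l ih =>
    rw [List.cons_append, monVal_cons, monVal_cons, ih, mul_assoc]
    congr 3
    funext j
    congr 1
    rw [List.length_cons]; omega

theorem monVal_eq_prod (z : ℕ → A) (l : List ℕ) {N : ℕ} (hN : l.length ≤ N) :
    monVal z l = ∏ j ∈ Finset.range N, z j ^ l.getD j 0 := by
  induction l generalizing z N with
  | nil => simp
  | cons k l ih =>
    obtain ⟨N, rfl⟩ : ∃ M, N = M + 1 := ⟨N - 1, by simp at hN; omega⟩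
    rw [monVal_cons, Finset.prod_range_succ', ih _ (N := N) (by simpa using hN), mul_comm]
    simp

theorem monVal_congr {z z' : ℕ → A} {l : List ℕ} (h : ∀ j < l.length, z j = z' j) :
    monVal z l = monVal z' l := by
  rw [monVal_eq_prod z l le_rfl, monVal_eq_prod z' l le_rfl]
  exact Finset.prod_congr rfl fun j hj => by rw [h j (Finset.mem_range.1 hj)]

theorem map_monVal {B : Type*} [CommRing B] (f : A →+* B) (z : ℕ → A) (l : List ℕ) :
    f (monVal z l) = monVal (fun j => f (z j)) l := by
  induction l generalizing z with
  | nil => simp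
  | cons k l ih => simp [ih]

@[simp] theorem ev_nil (z : ℕ → A) : ev z [] = 0 := rfl

@[simp] theorem ev_cons (z : ℕ → A) (m : ℤ × List ℕ) (p : IntPoly) :
    ev z (m :: p) = m.1 * monVal z m.2 + ev z p := by simp [ev]

@[simp] theorem ev_append (z : ℕ → A) (p q : IntPoly) : ev z (p ++ q) = ev z p + ev z q := by
  simp [ev]

theorem map_ev {B : Type*} [CommRing B] (f : A →+* B) (z : ℕ → A) (p : IntPoly) :
    f (ev z p) = ev (fun j => f (z j)) p := by
  induction p with
  | nil => simp
  | cons m p ih => simp [ih, map_monVal]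

/-- The constant polynomial. -/
def const (c : ℤ) : IntPoly := [(c, [])]

@[simp] theorem ev_const (z : ℕ → A) (c : ℤ) : ev z (const c) = c := by simp [const]

/-- The variable of index `j`. -/
def var (j : ℕ) : IntPoly := [(1, (List.range j).map (fun _ => 0) ++ [1])]

@[simp] theorem ev_var (z : ℕ → A) (j : ℕ) : ev z (var j) = z j := by
  have : monVal z ((List.range j).map fun _ => 0) = 1 := by
    rw [monVal_eq_prod z _ le_rfl]
    refine Finset.prod_eq_one fun i hi => ?_
    simp at hi
    simp [hi]
  rw [var, ev_cons, monVal_append, this]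
  simp

/-- The product of two monomials: sum of the lists of exponents. -/
def addExp (l l' : List ℕ) : List ℕ :=
  (List.range (max l.length l'.length)).map fun j => l.getD j 0 + l'.getD j 0

theorem monVal_addExp (z : ℕ → A) (l l' : List ℕ) :
    monVal z (addExp l l') = monVal z l * monVal z l' := by
  rw [monVal_eq_prod z l (le_max_left _ l'.length), monVal_eq_prod z l' (le_max_right l.length _),
    ← Finset.prod_mul_distrib, monVal_eq_prod z (addExp l l') (N := max l.length l'.length)
      (by simp [addExp])]
  refine Finset.prod_congr rfl fun j hj => ?_
  rw [← pow_add]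
  congr 1
  have hj' := Finset.mem_range.1 hj
  simp [addExp, List.getD_eq_getElem?_getD, hj']

/-- The product of two integer polynomials. -/
def mul (p q : IntPoly) : IntPoly :=
  p.flatMap fun m => q.map fun m' => (m.1 * m'.1, addExp m.2 m'.2)

@[simp] theorem ev_mul (z : ℕ → A) (p q : IntPoly) : ev z (mul p q) = ev z p * ev z q := by
  induction p with
  | nil => simp [mul]
  | cons m p ih =>
    have h1 : ev z (q.map fun m' => (m.1 * m'.1, addExp m.2 m'.2)) = m.1 * monVal z m.2 * ev z q := by
      clear ih
      induction q with
      | nil => simp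
      | cons m' q ih =>
        rw [List.map_cons, ev_cons, ev_cons, ih, monVal_addExp]; push_cast; ring
    have h2 : mul (m :: p) q = (q.map fun m' => (m.1 * m'.1, addExp m.2 m'.2)) ++ mul p q := rfl
    rw [h2, ev_append, ev_cons, ih, h1]; ring

/-- The polynomial in which the variables of index at least `k` are replaced by `1`. -/
def trunc (k : ℕ) (p : IntPoly) : IntPoly := p.map fun m => (m.1, m.2.take k)

theorem monVal_take (z : ℕ → A) (k : ℕ) (l : List ℕ) :
    monVal z (l.take k) = monVal (fun j => if j < k then z j else 1) l := by
  have h2 : monVal (fun j => if j < k then z j else 1) (l.take k) = monVal z (l.take k) :=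
    monVal_congr fun j hj => if_pos (by rw [List.length_take] at hj; omega)
  conv_rhs => rw [← List.take_append_drop k l, monVal_append, h2]
  rw [monVal_eq_prod _ (l.drop k) le_rfl, Finset.prod_eq_one, mul_one]
  intro j hj
  have hj' := Finset.mem_range.1 hj
  rw [List.length_drop] at hj'
  rw [if_neg (by rw [List.length_take]; omega), one_pow]

theorem ev_trunc (z : ℕ → A) (k : ℕ) (p : IntPoly) :
    ev z (trunc k p) = ev (fun j => if j < k then z j else 1) p := by
  induction p with
  | nil => rfl
  | cons m p ih =>
    rw [ev_cons, ← ih, ← monVal_take]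
    exact ev_cons z _ _

/-- Horner's scheme for the polynomial with the given list of coefficients. -/
def horner (x : IntPoly) (l : List IntPoly) : IntPoly :=
  l.foldr (fun c s => c ++ mul x s) []

/-- Horner's scheme for the value and for the derivative. -/
def horner₂ (x : IntPoly) (l : List IntPoly) : IntPoly × IntPoly :=
  l.foldr (fun c s => (c ++ mul x s.1, s.1 ++ mul x s.2)) ([], [])

end Eval

section Field

variable {L : Type*} [Field L]

theorem ev_horner (z : ℕ → L) (x : IntPoly) (l : List IntPoly) :
    ev z (horner x l) = (polyOfCoeffs (l.map (ev z))).eval (ev z x) := by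
  induction l with
  | nil => simp [horner, polyOfCoeffs]
  | cons c l ih =>
    have h1 : horner x (c :: l) = c ++ mul x (horner x l) := rfl
    have h2 : polyOfCoeffs ((c :: l).map (ev z)) =
      C (ev z c) + X * polyOfCoeffs (l.map (ev z)) := rfl
    rw [h1, h2, ev_append, ev_mul, ih]
    simp

theorem ev_horner₂ (z : ℕ → L) (x : IntPoly) (l : List IntPoly) :
    ev z (horner₂ x l).1 = (polyOfCoeffs (l.map (ev z))).eval (ev z x) ∧
      ev z (horner₂ x l).2 = (polyOfCoeffs (l.map (ev z))).derivative.eval (ev z x) := by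
  induction l with
  | nil => simp [horner₂, polyOfCoeffs]
  | cons c l ih =>
    have h1 : horner₂ x (c :: l) = (c ++ mul x (horner₂ x l).1,
      (horner₂ x l).1 ++ mul x (horner₂ x l).2) := rfl
    have h2 : polyOfCoeffs ((c :: l).map (ev z)) =
      C (ev z c) + X * polyOfCoeffs (l.map (ev z)) := rfl
    rw [h1, h2, ev_append, ev_append, ev_mul, ev_mul, ih.1, ih.2]
    simp

theorem prod_zipWith_eq_monVal (e : List L) (l : List ℕ) :
    (List.zipWith (fun x k => x ^ k) e l).prod = monVal (fun j => e.getD j 1) l := by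
  induction l generalizing e with
  | nil => simp
  | cons k l ih =>
    cases e with
    | nil =>
      rw [monVal_eq_prod _ _ le_rfl]
      simp
    | cons x e => simp [ih]

/-- Evaluation at a list is evaluation at the sequence which continues the list by `1, 1, …`. -/
theorem evalAt_eq_ev (p : IntPoly) (e : List L) :
    p.evalAt e = ev (fun j => e.getD j 1) p := by
  unfold IntPoly.evalAt ev
  simp_rw [prod_zipWith_eq_monVal]

theorem evalAt_mul (p q : IntPoly) (e : List L) :
    (mul p q).evalAt e = p.evalAt e * q.evalAt e := by
  simp only [evalAt_eq_ev, ev_mul]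

theorem ev_trunc_eq_evalAt {z : ℕ → L} {e : List L} {k : ℕ} (hk : e.length = k)
    (h : ∀ j < k, z j = e.getD j 1) (p : IntPoly) : ev z (trunc k p) = p.evalAt e := by
  rw [ev_trunc, evalAt_eq_ev]
  congr 1
  funext j
  split_ifs with hj
  · exact h j hj
  · rw [List.getD_eq_default _ _ (by omega)]

theorem map_evalAt {L' : Type*} [Field L'] (f : L →+* L') (p : IntPoly) (e : List L) :
    f (p.evalAt e) = p.evalAt (e.map f) := by
  rw [evalAt_eq_ev, evalAt_eq_ev, map_ev]
  congr 1
  funext j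
  rw [← map_one f, List.getD_map]

/-- The subring of the values of integer polynomials at a list. -/
def valSubring (e : List L) : Subring L where
  carrier := {x | ∃ p : IntPoly, p.evalAt e = x}
  zero_mem' := ⟨[], rfl⟩
  one_mem' := ⟨const 1, by simp [evalAt_eq_ev]⟩
  add_mem' := by
    rintro _ _ ⟨p, rfl⟩ ⟨q, rfl⟩
    exact ⟨p ++ q, by simp [evalAt_eq_ev]⟩
  mul_mem' := by
    rintro _ _ ⟨p, rfl⟩ ⟨q, rfl⟩
    exact ⟨mul p q, by simp [evalAt_eq_ev]⟩
  neg_mem' := by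
    rintro _ ⟨p, rfl⟩
    exact ⟨mul (const (-1)) p, by simp [evalAt_eq_ev]⟩

theorem evalAt_mem_valSubring (p : IntPoly) (e : List L) : p.evalAt e ∈ valSubring e := ⟨p, rfl⟩

theorem mem_valSubring_of_mem {e : List L} {x : L} (hx : x ∈ e) : x ∈ valSubring e := by
  obtain ⟨j, hj, rfl⟩ := List.getElem_of_mem hx
  exact ⟨var j, by simp [evalAt_eq_ev, hj]⟩

theorem valSubring_le {e : List L} {S : Subring L} (h : ∀ x ∈ e, x ∈ S) : valSubring e ≤ S := by
  rintro _ ⟨p, rfl⟩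
  unfold IntPoly.evalAt
  refine list_sum_mem fun x hx => ?_
  obtain ⟨m, -, rfl⟩ := List.mem_map.1 hx
  refine mul_mem (intCast_mem S _) (list_prod_mem fun y hy => ?_)
  obtain ⟨i, hi, rfl⟩ := List.getElem_of_mem hy
  rw [List.getElem_zipWith]
  exact pow_mem (h _ (List.getElem_mem _)) _

theorem valSubring_mono {e f : List L} (h : e ⊆ f) : valSubring e ≤ valSubring f :=
  valSubring_le fun _ hx => mem_valSubring_of_mem (h hx)

theorem exists_map_evalAt_eq {e : List L} {l : List L} (h : ∀ x ∈ l, x ∈ valSubring e) :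
    ∃ ps : List IntPoly, ps.map (fun p => p.evalAt e) = l := by
  induction l with
  | nil => exact ⟨[], rfl⟩
  | cons x l ih =>
    obtain ⟨ps, hps⟩ := ih fun y hy => h y (List.mem_cons_of_mem _ hy)
    obtain ⟨p, hp⟩ := h x List.mem_cons_self
    exact ⟨p :: ps, by rw [List.map_cons, hps, hp]⟩

end Field

end IntPoly

/-! ### Polynomials given by their coefficients -/

section PolyOfCoeffs

variable {L : Type*} [Field L]

theorem coeff_polyOfCoeffs (l : List L) (n : ℕ) : (polyOfCoeffs l).coeff n = l.getD n 0 := by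
  induction l generalizing n with
  | nil => simp [polyOfCoeffs]
  | cons c l ih =>
    have h2 : polyOfCoeffs (c :: l) = C c + X * polyOfCoeffs l := rfl
    rw [h2]
    cases n with
    | zero => simp
    | succ n => simp [ih]

theorem map_polyOfCoeffs {L' : Type*} [Field L'] (f : L →+* L') (l : List L) :
    (polyOfCoeffs l).map f = polyOfCoeffs (l.map f) := by
  ext n
  rw [coeff_map, coeff_polyOfCoeffs, coeff_polyOfCoeffs, ← map_zero f, List.getD_map]

theorem polyOfCoeffs_map_range (Q : L[X]) :
    polyOfCoeffs ((List.range (Q.natDegree + 1)).map Q.coeff) = Q := by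
  ext n
  rw [coeff_polyOfCoeffs, List.getD_eq_getElem?_getD, List.getElem?_map]
  by_cases hn : n < Q.natDegree + 1
  · simp [List.getElem?_range hn]
  · rw [List.getElem?_eq_none (by simpa using hn)]
    simp [coeff_eq_zero_of_natDegree_lt (show Q.natDegree < n by omega)]

theorem forall_coeff_polyOfCoeffs_mem {W : ValuationSubring L} {l : List L} :
    (∀ n, (polyOfCoeffs l).coeff n ∈ W) ↔ ∀ x ∈ l, x ∈ W := by
  simp_rw [coeff_polyOfCoeffs]
  constructor
  · intro h x hx
    obtain ⟨j, hj, rfl⟩ := List.getElem_of_mem hx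
    simpa [hj] using h j
  · intro h n
    by_cases hn : n < l.length
    · rw [List.getD_eq_getElem _ _ hn]
      exact h _ (List.getElem_mem hn)
    · rw [List.getD_eq_default _ _ (by omega)]
      exact zero_mem W

end PolyOfCoeffs

/-! ### Successive adjunction of Hensel zeros -/

section Adjoins

variable {L : Type*} [Field L] {W : ValuationSubring L}

theorem adjoins_nil_iff {e e' : List L} : Adjoins W e [] e' ↔ e' = e := by
  constructor
  · intro h; cases h; rfl
  · rintro rfl; exact .nil _

theorem adjoins_cons_iff {e e' : List L} {t : List IntPoly × IntPoly}
    {T : List (List IntPoly × IntPoly)} : Adjoins W e (t :: T) e' ↔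
    ∃ ξ, IsHenselRoot W (polyOfCoeffs (t.1.map fun p => p.evalAt e)) (t.2.evalAt e) ξ ∧
      Adjoins W (e ++ [ξ]) T e' := by
  constructor
  · rintro (_ | ⟨P, a, ξ, hP, ha, hc, hz, h⟩)
    exact ⟨ξ, hP ▸ ha ▸ .of_codes hc hz, h⟩
  · rintro ⟨ξ, hξ, h⟩
    obtain ⟨P, hP⟩ := exists_map_subtype_eq W hξ.coeff_mem
    have h1 := hξ.mem
    have h2 := hξ.base_mem
    rw [← hP] at hξ
    obtain ⟨hc, hz⟩ := IsHenselRoot.to_codes (W := W) (a := ⟨_, h2⟩) (ξ := ⟨ξ, h1⟩) hξ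
    exact .cons P ⟨_, h2⟩ ⟨ξ, h1⟩ hP rfl hc hz h

theorem Adjoins.trans {e e' e'' : List L} {T T' : List (List IntPoly × IntPoly)}
    (h : Adjoins W e T e') (h' : Adjoins W e' T' e'') : Adjoins W e (T ++ T') e'' := by
  induction T generalizing e with
  | nil => rw [adjoins_nil_iff] at h; exact h ▸ h'
  | cons t T ih =>
    rw [List.cons_append, adjoins_cons_iff]
    rw [adjoins_cons_iff] at h
    obtain ⟨ξ, hξ, h⟩ := h
    exact ⟨ξ, hξ, ih h⟩

theorem Adjoins.exists_append {e e' : List L} {T : List (List IntPoly × IntPoly)}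
    (h : Adjoins W e T e') : ∃ s, e' = e ++ s ∧ s.length = T.length := by
  induction T generalizing e with
  | nil => rw [adjoins_nil_iff] at h; exact ⟨[], by simp [h], rfl⟩
  | cons t T ih =>
    rw [adjoins_cons_iff] at h
    obtain ⟨ξ, -, h⟩ := h
    obtain ⟨s, rfl, hs⟩ := ih h
    exact ⟨ξ :: s, by simp, by simp [hs]⟩

theorem Adjoins.unique {e e' e'' : List L} {T : List (List IntPoly × IntPoly)}
    (h : Adjoins W e T e') (h' : Adjoins W e T e'') : e' = e'' := by
  induction T generalizing e with
  | nil => rw [adjoins_nil_iff] at h h'; rw [h, h']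
  | cons t T ih =>
    rw [adjoins_cons_iff] at h h'
    obtain ⟨ξ, hξ, h⟩ := h
    obtain ⟨ξ', hξ', h'⟩ := h'
    rw [← hξ.unique hξ'] at h'
    exact ih h h'

theorem map_evalAt_map {L' : Type*} [Field L'] (f : L →+* L') (l : List IntPoly) (e : List L) :
    (l.map fun p => p.evalAt e).map f = l.map fun p => p.evalAt (e.map f) := by
  rw [List.map_map]
  exact List.map_congr_left fun p _ => IntPoly.map_evalAt f p e

theorem Adjoins.map {L' : Type*} [Field L'] {W' : ValuationSubring L'} {f : L →+* L'}
    (hf : W'.comap f = W) {e e' : List L} {T : List (List IntPoly × IntPoly)}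
    (h : Adjoins W e T e') : Adjoins W' (e.map f) T (e'.map f) := by
  induction T generalizing e with
  | nil => rw [adjoins_nil_iff] at h ⊢; rw [h]
  | cons t T ih =>
    rw [adjoins_cons_iff] at h ⊢
    obtain ⟨ξ, hξ, h⟩ := h
    refine ⟨f ξ, ?_, ?_⟩
    · have := hξ.map hf
      rwa [map_polyOfCoeffs, map_evalAt_map, IntPoly.map_evalAt] at this
    · have := ih h
      rwa [List.map_append] at this

/-- A succession of Hensel zeros over a field which contains all Hensel zeros stays in it. -/
theorem Adjoins.exists_of_map {L' : Type*} [Field L'] {W' : ValuationSubring L'} {f : L →+* L'}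
    (hf : W'.comap f = W) (hW : ContainsHenselZeros W) {e : List L} {e' : List L'}
    {T : List (List IntPoly × IntPoly)} (h : Adjoins W' (e.map f) T e') :
    ∃ e₀, e₀.map f = e' ∧ Adjoins W e T e₀ := by
  induction T generalizing e with
  | nil => rw [adjoins_nil_iff] at h; exact ⟨e, h.symm, .nil e⟩
  | cons t T ih =>
    rw [adjoins_cons_iff] at h
    obtain ⟨ξ, hξ, h⟩ := h
    rw [← map_evalAt_map, ← map_polyOfCoeffs, ← IntPoly.map_evalAt] at hξ
    obtain ⟨z, rfl, hz⟩ := exists_isHenselRoot_of_map hf hW hξ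
    have h1 : Adjoins W' ((e ++ [z]).map f) T e' := by rwa [List.map_append]
    obtain ⟨e₀, he₀, h2⟩ := ih h1
    exact ⟨e₀, he₀, adjoins_cons_iff.2 ⟨z, hz, h2⟩⟩

/-- The same Hensel zeros may be adjoined to a larger list. -/
theorem Adjoins.exists_of_subset {e e' f : List L} {T : List (List IntPoly × IntPoly)}
    (h : Adjoins W e T e') (hf : e ⊆ f) :
    ∃ T' f', Adjoins W f T' f' ∧ e' ⊆ f' ∧ f ⊆ f' := by
  induction T generalizing e f with
  | nil => rw [adjoins_nil_iff] at h; exact ⟨[], f, .nil f, h ▸ hf, fun _ hx => hx⟩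
  | cons t T ih =>
    rw [adjoins_cons_iff] at h
    obtain ⟨ξ, hξ, h⟩ := h
    have hle := IntPoly.valSubring_mono hf
    obtain ⟨ps, hps⟩ := IntPoly.exists_map_evalAt_eq (e := f)
      (l := t.1.map fun p => p.evalAt e) (fun x hx => by
        obtain ⟨p, -, rfl⟩ := List.mem_map.1 hx
        exact hle (IntPoly.evalAt_mem_valSubring p e))
    obtain ⟨p, hp⟩ := hle (IntPoly.evalAt_mem_valSubring t.2 e)
    rw [← hps, ← hp] at hξ
    obtain ⟨T', f', hT', h1, h2⟩ := ih (f := f ++ [ξ]) h (by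
      intro x hx
      rw [List.mem_append] at hx ⊢
      exact hx.imp (fun h => hf h) id)
    exact ⟨(ps, p) :: T', f', adjoins_cons_iff.2 ⟨ξ, hξ, hT'⟩, h1,
      fun x hx => h2 (List.mem_append_left _ hx)⟩

end Adjoins

/-! ### Codes for all elements -/

section Represented

variable {K : Type*} [Field K] {L : Type*} [Field L] [Algebra K L] {W : ValuationSubring L}

variable (K W) in
/-- The list `e` arises from a list of elements of `K` by successive adjunction of Hensel
zeros. -/
def IsTower (e : List L) : Prop :=
  ∃ (a : List K) (T : List (List IntPoly × IntPoly)), Adjoins W (a.map (algebraMap K L)) T e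

theorem IsTower.exists_sup {e f : List L} (he : IsTower K W e) (hf : IsTower K W f) :
    ∃ g, IsTower K W g ∧ e ⊆ g ∧ f ⊆ g := by
  obtain ⟨a, T, h⟩ := he
  obtain ⟨b, T', h'⟩ := hf
  obtain ⟨S, g, hg, h1, h2⟩ := h.exists_of_subset (f := (a ++ b).map (algebraMap K L))
    (by rw [List.map_append]; exact List.subset_append_left _ _)
  obtain ⟨S', g', hg', h3, h4⟩ := h'.exists_of_subset (f := g) (fun x hx => h2 (by
    rw [List.map_append]; exact List.mem_append_right _ hx))
  exact ⟨g', ⟨a ++ b, S ++ S', hg.trans hg'⟩, fun x hx => h4 (h1 hx), h3⟩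

theorem IsTower.append {e : List L} (he : IsTower K W e) {Q : L[X]} {a ξ : L}
    (h : IsHenselRoot W Q a ξ) (hQ : ∀ n, Q.coeff n ∈ IntPoly.valSubring e)
    (ha : a ∈ IntPoly.valSubring e) : IsTower K W (e ++ [ξ]) := by
  obtain ⟨b, T, hT⟩ := he
  obtain ⟨ps, hps⟩ := IntPoly.exists_map_evalAt_eq (e := e)
    (l := (List.range (Q.natDegree + 1)).map Q.coeff) (fun x hx => by
      obtain ⟨n, -, rfl⟩ := List.mem_map.1 hx
      exact hQ n)
  obtain ⟨p, rfl⟩ := ha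
  refine ⟨b, T ++ [(ps, p)], hT.trans (adjoins_cons_iff.2 ⟨ξ, ?_, .nil _⟩)⟩
  rwa [hps, polyOfCoeffs_map_range]

variable (K W) in
/-- `x` lies in the ring generated by a tower of Hensel zeros. -/
def IsRepresented (x : L) : Prop := ∃ e, IsTower K W e ∧ x ∈ IntPoly.valSubring e

theorem exists_isTower_forall_mem (l : List L) (h : ∀ x ∈ l, IsRepresented K W x) :
    ∃ e, IsTower K W e ∧ ∀ x ∈ l, x ∈ IntPoly.valSubring e := by
  induction l with
  | nil => exact ⟨[], ⟨[], [], .nil _⟩, by simp⟩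
  | cons x l ih =>
    obtain ⟨e, he, hel⟩ := ih fun y hy => h y (List.mem_cons_of_mem _ hy)
    obtain ⟨f, hf, hfx⟩ := h x List.mem_cons_self
    obtain ⟨g, hg, h1, h2⟩ := he.exists_sup hf
    refine ⟨g, hg, fun y hy => ?_⟩
    rcases List.mem_cons.1 hy with rfl | hy
    · exact IntPoly.valSubring_mono h2 hfx
    · exact IntPoly.valSubring_mono h1 (hel y hy)

theorem isRepresented_algebraMap (k : K) : IsRepresented K W (algebraMap K L k) :=
  ⟨[algebraMap K L k], ⟨[k], [], .nil _⟩, IntPoly.mem_valSubring_of_mem (by simp)⟩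

theorem isRepresented_of_mem_closure {l : List L} (h : ∀ x ∈ l, IsRepresented K W x) {x : L}
    (hx : x ∈ IntPoly.valSubring l) : IsRepresented K W x := by
  obtain ⟨e, he, hel⟩ := exists_isTower_forall_mem l h
  exact ⟨e, he, IntPoly.valSubring_le hel hx⟩

theorem isRepresented_of_isHenselRoot {Q : L[X]} {a ξ : L} (h : IsHenselRoot W Q a ξ)
    (hQ : ∀ n, IsRepresented K W (Q.coeff n)) (ha : IsRepresented K W a) :
    IsRepresented K W ξ := by
  obtain ⟨e, he, hel⟩ := exists_isTower_forall_mem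
    (a :: (List.range (Q.natDegree + 1)).map Q.coeff) (fun x hx => by
      rcases List.mem_cons.1 hx with rfl | hx
      · exact ha
      · obtain ⟨n, -, rfl⟩ := List.mem_map.1 hx
        exact hQ n)
  refine ⟨e ++ [ξ], he.append h (fun n => ?_) (hel a List.mem_cons_self),
    IntPoly.mem_valSubring_of_mem (by simp)⟩
  by_cases hn : n < Q.natDegree + 1
  · exact hel _ (List.mem_cons_of_mem _ (List.mem_map_of_mem (List.mem_range.2 hn)))
  · rw [coeff_eq_zero_of_natDegree_lt (by omega)]; exact zero_mem _

/-- The inverse of a unit `1 + μ` is the Hensel zero of `(1 + μ) X - 1`; in an immediate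
extension, this is enough to represent all inverses. -/
theorem IsRepresented.inv (him : ∀ x : L, ∃ y : K, SameLeading W x (algebraMap K L y)) {x : L}
    (hx : IsRepresented K W x) : IsRepresented K W x⁻¹ := by
  obtain ⟨y, μ, hμ, e⟩ := him x
  by_cases hy : algebraMap K L y = 0
  · rw [e, hy, zero_mul, inv_zero, ← map_zero (algebraMap K L)]
    exact isRepresented_algebraMap 0
  have hy' : IsRepresented K W (algebraMap K L y⁻¹) := isRepresented_algebraMap _
  have hu : IsRepresented K W (1 + μ) := by
    refine isRepresented_of_mem_closure (l := [x, algebraMap K L y⁻¹]) (by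
      intro z hz; simp only [List.mem_cons, List.not_mem_nil, or_false] at hz
      rcases hz with rfl | rfl <;> assumption) ?_
    have : 1 + μ = x * algebraMap K L y⁻¹ := by
      rw [e, map_inv₀]; field_simp
    rw [this]
    exact mul_mem (IntPoly.mem_valSubring_of_mem (by simp))
      (IntPoly.mem_valSubring_of_mem (by simp))
  have hu0 := one_add_ne_zero hμ
  have hv := valuation_one_add W hμ
  have hroot : IsHenselRoot W (C (1 + μ) * X - 1) 1 (1 + μ)⁻¹ := by
    refine ⟨fun n => ?_, one_mem W, by simp [hv], by simp [hu0], ?_⟩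
    · have : (C (1 + μ) * X - 1 : Polynomial L) = C (1 + μ) * X + C (-1) := by
        rw [C_neg, C_1, sub_eq_add_neg]
      rw [this, coeff_add, coeff_C_mul, coeff_X, coeff_C]
      have h1 : 1 + μ ∈ W := (W.valuation_le_one_iff _).1 hv.le
      refine add_mem (mul_mem h1 ?_) ?_ <;> split_ifs <;> simp [zero_mem, one_mem]
    · have : (1 + μ)⁻¹ - 1 = -μ * (1 + μ)⁻¹ := by field_simp; ring
      rwa [this, map_mul, Valuation.map_neg, map_inv₀, hv, inv_one, mul_one]
  have hone : IsRepresented K W 1 := by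
    rw [← map_one (algebraMap K L)]; exact isRepresented_algebraMap 1
  have hinv : IsRepresented K W (1 + μ)⁻¹ := by
    refine isRepresented_of_isHenselRoot hroot (fun n => ?_) hone
    refine isRepresented_of_mem_closure (l := [1 + μ]) (by simpa using hu) ?_
    have : (C (1 + μ) * X - 1 : Polynomial L) = C (1 + μ) * X + C (-1) := by
      rw [C_neg, C_1, sub_eq_add_neg]
    rw [this, coeff_add, coeff_C_mul, coeff_X, coeff_C]
    have h1 : 1 + μ ∈ IntPoly.valSubring [1 + μ] := IntPoly.mem_valSubring_of_mem (by simp)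
    refine add_mem (mul_mem h1 ?_) ?_ <;> split_ifs <;> simp [zero_mem, one_mem]
  refine isRepresented_of_mem_closure (l := [(1 + μ)⁻¹, algebraMap K L y⁻¹]) (by
      intro z hz; simp only [List.mem_cons, List.not_mem_nil, or_false] at hz
      rcases hz with rfl | rfl <;> assumption) ?_
  have : x⁻¹ = (1 + μ)⁻¹ * algebraMap K L y⁻¹ := by rw [e, map_inv₀, mul_inv, mul_comm]
  rw [this]
  exact mul_mem (IntPoly.mem_valSubring_of_mem (by simp))
    (IntPoly.mem_valSubring_of_mem (by simp))

/-- In an immediate extension generated by Hensel zeros, every element has a code. -/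
theorem exists_represents (hL : IsGeneratedByHenselZeros K W)
    (him : ∀ x : L, ∃ y : K, SameLeading W x (algebraMap K L y)) (x : L) :
    ∃ (a : List K) (c : ElementCode), Represents W a c x := by
  have hpair {x y z : L} (hx : IsRepresented K W x) (hy : IsRepresented K W y)
      (hz : z ∈ IntPoly.valSubring [x, y]) : IsRepresented K W z :=
    isRepresented_of_mem_closure (l := [x, y]) (by
      intro z hz; simp only [List.mem_cons, List.not_mem_nil, or_false] at hz
      rcases hz with rfl | rfl <;> assumption) hz
  let F : IntermediateField K L :=
    { carrier := {x | IsRepresented K W x}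
      algebraMap_mem' := isRepresented_algebraMap
      add_mem' := fun hx hy => hpair hx hy (add_mem (IntPoly.mem_valSubring_of_mem (by simp))
        (IntPoly.mem_valSubring_of_mem (by simp)))
      mul_mem' := fun hx hy => hpair hx hy (mul_mem (IntPoly.mem_valSubring_of_mem (by simp))
        (IntPoly.mem_valSubring_of_mem (by simp)))
      inv_mem' := fun _ hx => IsRepresented.inv him hx }
  have hF : F = ⊤ := hL F (stableUnderHenselZeros_iff.2 fun Q a x hx hQ ha =>
    isRepresented_of_isHenselRoot hx hQ ha)
  have hx : x ∈ F := hF ▸ IntermediateField.mem_top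
  obtain ⟨e, ⟨a, T, hT⟩, p, hp⟩ := hx
  exact ⟨a, (a.length, T, p), rfl, e, hT, hp⟩

end Represented

open IntPoly

/-! ### The system of conditions given by a code -/

section System

/-- The coefficients of a Hensel code, as polynomials in the first `k` variables. -/
def stepCoeffs (k : ℕ) (t : List IntPoly × IntPoly) : List IntPoly := t.1.map (trunc k)

/-- The approximate zero of a Hensel code, as a polynomial in the first `k` variables. -/
def stepBase (k : ℕ) (t : List IntPoly × IntPoly) : IntPoly := trunc k t.2

/-- The `i`-th Hensel code of an element code. -/
def stepAt (c : ElementCode) (i : ℕ) : List IntPoly × IntPoly := c.2.1.getD i ([], [])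

/-- The polynomials which must take values in the valuation ring. -/
def integralGens (c : ElementCode) : List IntPoly :=
  (List.range c.2.1.length).flatMap fun i =>
    stepBase (c.1 + i) (stepAt c i) :: stepCoeffs (c.1 + i) (stepAt c i)

/-- The polynomials which must take values in the maximal ideal. -/
def smallGens (c : ElementCode) : List IntPoly :=
  (List.range c.2.1.length).map fun i =>
    var (c.1 + i) ++ mul (const (-1)) (stepBase (c.1 + i) (stepAt c i))

/-- The polynomials the values of which must be units. -/
def unitGens (c : ElementCode) : List IntPoly :=
  (List.range c.2.1.length).map fun i =>
    (horner₂ (stepBase (c.1 + i) (stepAt c i)) (stepCoeffs (c.1 + i) (stepAt c i))).2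

/-- The polynomials which must take the value zero. -/
def relations (c : ElementCode) : List IntPoly :=
  (List.range c.2.1.length).map fun i =>
    horner (var (c.1 + i)) (stepCoeffs (c.1 + i) (stepAt c i))

variable {L : Type*} [Field L] {W : ValuationSubring L}

/-- The sequence `z` satisfies the conditions which express that `z k`, for
`c.1 ≤ k < c.1 + c.2.1.length`, are the Hensel zeros prescribed by `c`. -/
structure Satisfies (W : ValuationSubring L) (z : ℕ → L) (c : ElementCode) : Prop where
  integral : ∀ g ∈ integralGens c, ev z g ∈ W
  small : ∀ g ∈ smallGens c, W.valuation (ev z g) < 1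
  unit : ∀ g ∈ unitGens c, W.valuation (ev z g) = 1
  relation : ∀ g ∈ relations c, ev z g = 0

theorem satisfies_iff {z : ℕ → L} {c : ElementCode} : Satisfies W z c ↔
    ∀ i < c.2.1.length, IsHenselRoot W
      (polyOfCoeffs ((stepCoeffs (c.1 + i) (stepAt c i)).map (ev z)))
      (ev z (stepBase (c.1 + i) (stepAt c i))) (z (c.1 + i)) := by
  constructor
  · intro h i hi
    refine ⟨forall_coeff_polyOfCoeffs_mem.2 fun x hx => ?_, ?_, ?_, ?_, ?_⟩
    · obtain ⟨g, hg, rfl⟩ := List.mem_map.1 hx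
      exact h.integral g (List.mem_flatMap.2
        ⟨i, List.mem_range.2 hi, List.mem_cons_of_mem _ hg⟩)
    · exact h.integral _ (List.mem_flatMap.2 ⟨i, List.mem_range.2 hi, List.mem_cons_self⟩)
    · rw [← (ev_horner₂ _ _ _).2]
      exact h.unit _ (List.mem_map.2 ⟨i, List.mem_range.2 hi, rfl⟩)
    · have := h.relation _ (List.mem_map.2 ⟨i, List.mem_range.2 hi, rfl⟩)
      rwa [ev_horner, ev_var] at this
    · have := h.small _ (List.mem_map.2 ⟨i, List.mem_range.2 hi, rfl⟩)
      simpa [sub_eq_add_neg] using this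
  · intro h
    refine ⟨fun g hg => ?_, fun g hg => ?_, fun g hg => ?_, fun g hg => ?_⟩
    · obtain ⟨i, hi, hg⟩ := List.mem_flatMap.1 hg
      have hr := h i (List.mem_range.1 hi)
      rcases List.mem_cons.1 hg with rfl | hg
      · exact hr.base_mem
      · exact forall_coeff_polyOfCoeffs_mem.1 hr.coeff_mem _ (List.mem_map_of_mem hg)
    · obtain ⟨i, hi, rfl⟩ := List.mem_map.1 hg
      simpa [sub_eq_add_neg] using (h i (List.mem_range.1 hi)).close
    · obtain ⟨i, hi, rfl⟩ := List.mem_map.1 hg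
      rw [(ev_horner₂ _ _ _).2]
      exact (h i (List.mem_range.1 hi)).valuation_derivative
    · obtain ⟨i, hi, rfl⟩ := List.mem_map.1 hg
      rw [ev_horner, ev_var]
      exact (h i (List.mem_range.1 hi)).root

/-- The members of a list obtained by successive adjunction satisfy the conditions prescribed by the
code; `k` is the number of the elements which are there at the beginning. -/
theorem Adjoins.isHenselRoot {e e' : List L} {T : List (List IntPoly × IntPoly)}
    (h : Adjoins W e T e') {z : ℕ → L} (hz : ∀ j < e'.length, z j = e'.getD j 1) {k : ℕ}
    (hk : e.length = k) {i : ℕ} (hi : i < T.length) : IsHenselRoot W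
      (polyOfCoeffs ((stepCoeffs (k + i) (T.getD i ([], []))).map (ev z)))
      (ev z (stepBase (k + i) (T.getD i ([], [])))) (z (k + i)) := by
  induction T generalizing e k i with
  | nil => simp at hi
  | cons t T ih =>
    rw [adjoins_cons_iff] at h
    obtain ⟨ξ, hξ, h⟩ := h
    cases i with
    | zero =>
      obtain ⟨s, rfl, hs⟩ := h.exists_append
      have hz' : ∀ j < k, z j = e.getD j 1 := fun j hj => by
        rw [hz j (by simp; omega), List.append_assoc, List.getD_append _ _ _ _ (by omega)]
      have hzk : z k = ξ := by
        rw [hz k (by simp; omega), List.append_assoc,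
          List.getD_append_right _ _ _ _ (by omega)]
        simp [hk]
      have h1 : (stepCoeffs k t).map (ev z) = t.1.map fun p => p.evalAt e := by
        rw [stepCoeffs, List.map_map]
        exact List.map_congr_left fun p _ => ev_trunc_eq_evalAt hk hz' p
      have h2 : ev z (stepBase k t) = t.2.evalAt e := ev_trunc_eq_evalAt hk hz' _
      simpa [h1, h2, hzk] using hξ
    | succ i =>
      have := ih h (k := k + 1) (by simp [hk]) (i := i) (by simpa using hi)
      rwa [show k + 1 + i = k + (i + 1) by omega] at this

theorem adjoins_of_isHenselRoot {z : ℕ → L} {T : List (List IntPoly × IntPoly)} {k : ℕ}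
    (h : ∀ i < T.length, IsHenselRoot W
      (polyOfCoeffs ((stepCoeffs (k + i) (T.getD i ([], []))).map (ev z)))
      (ev z (stepBase (k + i) (T.getD i ([], [])))) (z (k + i))) :
    Adjoins W ((List.range k).map z) T ((List.range (k + T.length)).map z) := by
  induction T generalizing k with
  | nil => exact .nil _
  | cons t T ih =>
    have hz' : ∀ j < k, z j = ((List.range k).map z).getD j 1 := fun j hj => by
      simp [List.getD_eq_getElem?_getD, hj]
    have hk : ((List.range k).map z).length = k := by simp
    refine adjoins_cons_iff.2 ⟨z k, ?_, ?_⟩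
    · have h1 : (stepCoeffs k t).map (ev z) =
          t.1.map fun p => p.evalAt ((List.range k).map z) := by
        rw [stepCoeffs, List.map_map]
        exact List.map_congr_left fun p _ => ev_trunc_eq_evalAt hk hz' p
      have h2 : ev z (stepBase k t) = t.2.evalAt ((List.range k).map z) :=
        ev_trunc_eq_evalAt hk hz' _
      have := h 0 (by simp)
      rw [← h1, ← h2]
      simpa using this
    · have := ih (k := k + 1) (fun i hi => by
        have := h (i + 1) (by simpa using hi)
        rw [show k + (i + 1) = k + 1 + i by omega] at this
        simpa using this)
      rw [List.range_succ, List.map_append] at this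
      rwa [List.length_cons, show k + (T.length + 1) = k + 1 + T.length by omega]

variable {K : Type*} [Field K] [Algebra K L]

/-- The system of a code is satisfied by every sequence which begins with the parameters and
the Hensel zeros. -/
theorem Represents.satisfies {a : List K} {c : ElementCode} {x : L}
    (h : Represents W a c x) : ∃ e : List L, e.length = c.1 + c.2.1.length ∧
      (∀ j < c.1, e.getD j 1 = algebraMap K L (a.getD j 1)) ∧
      ∀ z : ℕ → L, (∀ j < e.length, z j = e.getD j 1) →
        Satisfies W z c ∧ ev z (trunc (c.1 + c.2.1.length) c.2.2) = x := by
  obtain ⟨hlen, e, he, hx⟩ := h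
  obtain ⟨s, hs, hsl⟩ := he.exists_append
  have hel : e.length = c.1 + c.2.1.length := by rw [hs]; simp [hlen, hsl]
  refine ⟨e, hel, fun j hj => ?_, fun z hz => ⟨satisfies_iff.2 fun i hi => ?_, ?_⟩⟩
  · rw [hs, List.getD_append _ _ _ _ (by simpa [hlen] using hj), ← map_one (algebraMap K L),
      List.getD_map]
  · exact he.isHenselRoot hz (by simpa using hlen) hi
  · rw [← hx]
    exact ev_trunc_eq_evalAt hel (fun j hj => hz j (by omega)) _

/-- A solution of the system of a code consists of the prescribed Hensel zeros. -/
theorem Satisfies.represents {a : List K} {c : ElementCode} (ha : a.length = c.1) {z : ℕ → L}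
    (hz : ∀ j < c.1, z j = algebraMap K L (a.getD j 1)) (h : Satisfies W z c) :
    Represents W a c (ev z (trunc (c.1 + c.2.1.length) c.2.2)) := by
  have h1 := adjoins_of_isHenselRoot (satisfies_iff.1 h)
  refine ⟨ha, (List.range (c.1 + c.2.1.length)).map z, ?_, ?_⟩
  · have : (List.range c.1).map z = a.map (algebraMap K L) := by
      refine List.ext_getElem (by simp [ha]) fun j h1 h2 => ?_
      have hj : j < c.1 := by simpa using h1
      simp [hz j hj, List.getElem?_eq_getElem (show j < a.length by omega)]
    rwa [← this]
  · exact (ev_trunc_eq_evalAt (by simp) (fun j hj => by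
      simp [List.getD_eq_getElem?_getD, hj]) _).symm

/-- The value coded by `c` is carried along by embeddings of valued fields, and in particular the
elements which `c` represents in two valued extensions of `K` have the same leading terms in
`K` as soon as one of the extensions is the henselization. -/
theorem Represents.sameLeading_of_isHenselization {V : ValuationSubring K}
    (hW : IsHenselization V W) {F : Type*} [Field F] [Algebra K F] {U : ValuationSubring F}
    (hU : IsValuedExtension V U) {a : List K} {c : ElementCode} {x : L} {x' : F}
    (h : Represents W a c x) (h' : Represents U a c x') {y : K}
    (hy : SameLeading W x (algebraMap K L y)) : SameLeading U x' (algebraMap K F y) := by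
  obtain ⟨O, hO⟩ := exists_valuationSubring_comap_eq U (algebraMap F (AlgebraicClosure F))
  have hVO : IsValuedExtension V O := by
    unfold IsValuedExtension at hU ⊢
    rw [← hU, ← hO, ValuationSubring.comap_comap, ← IsScalarTower.algebraMap_eq]
  obtain ⟨φ, hφ⟩ := hW.exists_algHom hVO (containsHenselZeros_of_isAlgClosed O)
  obtain ⟨-, e, he, rfl⟩ := h
  obtain ⟨-, e', he', rfl⟩ := h'
  have h1 := he.map hφ
  have h2 := he'.map hO
  have hcomm : (a.map (algebraMap K L)).map (φ : L →+* AlgebraicClosure F) =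
      (a.map (algebraMap K F)).map (algebraMap F (AlgebraicClosure F)) := by
    rw [List.map_map, List.map_map]
    refine List.map_congr_left fun k _ => ?_
    rw [Function.comp_apply, Function.comp_apply, ← IsScalarTower.algebraMap_apply]
    exact φ.commutes k
  rw [hcomm] at h1
  have h3 := h1.unique h2
  rw [← SameLeading.of_map hφ, map_evalAt, h3, ← map_evalAt] at hy
  refine (SameLeading.of_map hO).1 ?_
  rw [← IsScalarTower.algebraMap_apply]
  convert hy using 1
  exact (φ.commutes y).symm

end System

/-! ### Polynomials with some variables evaluated -/

section PartialEval

variable {K : Type*} [Field K]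

theorem monVal_eq_toFinsupp_prod {A : Type*} [CommRing A] (z : ℕ → A) (l : List ℕ) :
    monVal z l = l.toFinsupp.prod fun j k => z j ^ k := by
  rw [monVal_eq_prod z l le_rfl, Finsupp.prod_of_support_subset (s := Finset.range l.length)]
  · rfl
  · intro j hj
    rw [Finsupp.mem_support_iff, List.toFinsupp_apply] at hj
    rw [Finset.mem_range]
    by_contra h
    exact hj (List.getD_eq_default _ _ (by omega))
  · simp

/-- The polynomial in the variables of index at least `n`, renumbered from `0`, which is
obtained when the first `n` variables take the values given by the list `a`. -/
noncomputable def partialEval (n : ℕ) (a : List K) (p : IntPoly) : MvPolynomial ℕ K :=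
  (p.map fun m => MvPolynomial.monomial (m.2.drop n).toFinsupp
    ((m.1 : K) * monVal (fun j => a.getD j 1) m.2)).sum

/-- Evaluation in two stages: first the parameters, then the remaining variables. -/
theorem ev_eq_aeval_partialEval {A : Type*} [CommRing A] [Algebra K A] {n : ℕ} {a : List K}
    (ha : a.length = n) {z : ℕ → A} (hz : ∀ j < n, z j = algebraMap K A (a.getD j 1))
    (p : IntPoly) : ev z p = MvPolynomial.aeval (fun j => z (n + j)) (partialEval n a p) := by
  have hmon (l : List ℕ) : monVal z l = algebraMap K A (monVal (fun j => a.getD j 1) l) *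
      monVal (fun j => z (n + j)) (l.drop n) := by
    have h1 : monVal (fun j => a.getD j 1) l = monVal (fun j => a.getD j 1) (l.take n) := by
      rw [monVal_take]
      congr 1
      funext j
      split_ifs with h
      · rfl
      · exact List.getD_eq_default _ _ (by omega)
    rw [h1, map_monVal]
    by_cases hl : n ≤ l.length
    · conv_lhs => rw [← List.take_append_drop n l, monVal_append]
      rw [List.length_take, min_eq_left hl]
      congr 1
      refine monVal_congr fun j hj => hz j ?_
      rw [List.length_take] at hj; omega
    · rw [List.drop_eq_nil_of_le (by omega), monVal_nil, mul_one, List.take_of_length_le (by omega)]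
      exact monVal_congr fun j hj => hz j (by omega)
  induction p with
  | nil => simp [partialEval]
  | cons m p ih =>
    have : partialEval n a (m :: p) = MvPolynomial.monomial (m.2.drop n).toFinsupp
      ((m.1 : K) * monVal (fun j => a.getD j 1) m.2) + partialEval n a p := by
      simp [partialEval]
    rw [ev_cons, this, map_add, ← ih, MvPolynomial.aeval_monomial, ← monVal_eq_toFinsupp_prod,
      hmon m.2, map_mul, map_intCast, mul_assoc]

/-- The exponents of the variables of index at least `n` agree. -/
def sameTail (n : ℕ) (l l' : List ℕ) : Prop :=
  ∀ j < l.length + l'.length, l.getD (n + j) 0 = l'.getD (n + j) 0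

instance (n : ℕ) (l l' : List ℕ) : Decidable (sameTail n l l') :=
  inferInstanceAs (Decidable (∀ j < l.length + l'.length, l.getD (n + j) 0 = l'.getD (n + j) 0))

theorem sameTail_iff {n : ℕ} {l l' : List ℕ} :
    sameTail n l l' ↔ (l.drop n).toFinsupp = (l'.drop n).toFinsupp := by
  have hd (l : List ℕ) (j : ℕ) : (l.drop n).toFinsupp j = l.getD (n + j) 0 := by
    simp [List.getD_eq_getElem?_getD]
  constructor
  · intro h
    ext j
    rw [hd, hd]
    by_cases hj : j < l.length + l'.length
    · exact h j hj
    · rw [List.getD_eq_default _ _ (by omega), List.getD_eq_default _ _ (by omega)]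
  · intro h j _
    rw [← hd, ← hd, h]

/-- The monomials of `p` in which the variables of index at least `n` have the same exponents as
in the monomial `l`. -/
def slice (n : ℕ) (l : List ℕ) (p : IntPoly) : IntPoly := p.filter fun m => sameTail n m.2 l

/-- The coefficients of `partialEval n a p` are values of integer polynomials at `a`, so that they
are accessible to tests. -/
theorem coeff_partialEval (n : ℕ) (a : List K) (l : List ℕ) (p : IntPoly) :
    (partialEval n a p).coeff (l.drop n).toFinsupp = (slice n l p).evalAt a := by
  rw [evalAt_eq_ev]
  induction p with
  | nil => simp [partialEval, slice]
  | cons m p ih =>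
    have : partialEval n a (m :: p) = MvPolynomial.monomial (m.2.drop n).toFinsupp
      ((m.1 : K) * monVal (fun j => a.getD j 1) m.2) + partialEval n a p := by
      simp [partialEval]
    rw [this, MvPolynomial.coeff_add, ih, MvPolynomial.coeff_monomial]
    by_cases h : sameTail n m.2 l
    · have h2 : slice n l (m :: p) = m :: slice n l p := by simp [slice, h]
      rw [h2, ev_cons, if_pos (sameTail_iff.1 h)]
    · have h2 : slice n l (m :: p) = slice n l p := by simp [slice, h]
      rw [h2, if_neg fun e => h (sameTail_iff.2 e), zero_add]

/-- It is decided by finitely many tests whether a polynomial becomes zero when the first `n`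
variables take given values. -/
theorem partialEval_eq_zero_iff (n : ℕ) (a : List K) (p : IntPoly) :
    partialEval n a p = 0 ↔ ∀ m ∈ p, (slice n m.2 p).evalAt a = 0 := by
  constructor
  · intro h m _
    rw [← coeff_partialEval, h, MvPolynomial.coeff_zero]
  · intro h
    ext s
    rw [MvPolynomial.coeff_zero]
    by_cases hs : ∃ m ∈ p, (m.2.drop n).toFinsupp = s
    · obtain ⟨m, hm, rfl⟩ := hs
      rw [coeff_partialEval, h m hm]
    · push Not at hs
      unfold partialEval
      have key : ∀ q : IntPoly, (∀ m ∈ q, (m.2.drop n).toFinsupp ≠ s) →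
          ((q.map fun m => MvPolynomial.monomial (m.2.drop n).toFinsupp
            ((m.1 : K) * monVal (fun j => a.getD j 1) m.2)).sum).coeff s = 0 := by
        intro q hq
        induction q with
        | nil => simp
        | cons m q ih =>
          rw [List.map_cons, List.sum_cons, MvPolynomial.coeff_add,
            ih fun m hm => hq m (List.mem_cons_of_mem _ hm), MvPolynomial.coeff_monomial,
            if_neg (hq m List.mem_cons_self), zero_add]
      exact key p hs

/-- The generic point above the list `a`: the remaining variables are independent. -/
noncomputable def genericPoint (n : ℕ) (a : List K) (j : ℕ) : MvPolynomial ℕ K :=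
  if j < n then MvPolynomial.C (a.getD j 1) else MvPolynomial.X (j - n)

theorem genericPoint_of_lt {n : ℕ} {a : List K} {j : ℕ} (h : j < n) :
    genericPoint n a j = MvPolynomial.C (a.getD j 1) := if_pos h

theorem ev_genericPoint {n : ℕ} {a : List K} (ha : a.length = n) (p : IntPoly) :
    ev (genericPoint n a) p = partialEval n a p := by
  rw [ev_eq_aeval_partialEval ha (z := genericPoint n a) fun j hj => by
    rw [genericPoint_of_lt hj]; rfl]
  have : (fun j => genericPoint n a (n + j)) = MvPolynomial.X := by
    funext j
    simp [genericPoint]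
  rw [this, MvPolynomial.aeval_X_left_apply]

theorem ev_genericPoint_trunc {n : ℕ} {a : List K} (ha : a.length = n) (p : IntPoly) :
    ev (genericPoint n a) (trunc n p) = MvPolynomial.C (p.evalAt a) := by
  rw [ev_trunc, evalAt_eq_ev, map_ev]
  congr 1
  funext j
  split_ifs with h
  · exact genericPoint_of_lt h
  · rw [List.getD_eq_default _ _ (by omega), map_one]

end PartialEval

/-! ### A Positivstellensatz for valued fields -/

section Positivstellensatz

/-- A prime ideal of a ring which is mapped to a field, without elements of the kernel outside the
prime ideal, is the centre of a valuation. -/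
theorem exists_valuationSubring_of_isPrime {B F : Type*} [CommRing B] [Field F] (p : Ideal B)
    [p.IsPrime] (f : B →+* F) (hf : ∀ b ∉ p, f b ≠ 0) : ∃ W : ValuationSubring F,
      (∀ b, f b ∈ W) ∧ (∀ b ∉ p, W.valuation (f b) = 1) ∧ ∀ b ∈ p, W.valuation (f b) < 1 := by
  obtain ⟨A, _, _, _⟩ : ∃ (A : Type _) (_ : CommRing A) (_ : Algebra B A),
      IsLocalization.AtPrime A p :=
    ⟨Localization.AtPrime p, inferInstance, inferInstance, inferInstance⟩
  have := IsLocalization.AtPrime.isLocalRing A p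
  have hunit (b : p.primeCompl) : IsUnit (f b) := (hf b b.2).isUnit
  let ψ : A →+* F := IsLocalization.lift hunit
  have hψ (b : B) : ψ (algebraMap B A b) = f b := IsLocalization.lift_eq hunit b
  obtain ⟨W, hW, hloc⟩ := IsLocalRing.exists_factor_valuationRing ψ
  refine ⟨W, fun b => hψ b ▸ hW _, fun b hb => ?_, fun b hb => ?_⟩
  · have h1 : IsUnit (algebraMap B A b) :=
      IsLocalization.map_units A (⟨b, hb⟩ : p.primeCompl)
    have h2 := h1.map (ψ.codRestrict W.toSubring hW)
    rw [← hψ]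
    exact (W.valuation_eq_one_iff _).1 h2
  · rw [← hψ]
    refine (W.valuation_lt_one_iff (ψ.codRestrict W.toSubring hW (algebraMap B A b))).1 ?_
    rw [IsLocalRing.mem_maximalIdeal, mem_nonunits_iff]
    intro h2
    have h3 := hloc.map_nonunit _ h2
    rw [IsLocalization.AtPrime.isUnit_to_map_iff A p] at h3
    exact h3 hb

variable {K : Type u} [Field K] (V : ValuationSubring K) {R : Type u} [CommRing R] [Algebra K R]

/-- In the `V`-algebra generated by `G`, `N` and `U`, the ideal generated by `N` and by the maximal
ideal of `V`. -/
def smallIdeal (G N U : Set R) : Ideal (Algebra.adjoin V (G ∪ N ∪ U)) :=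
  Ideal.span ({b | (b : R) ∈ N} ∪
    {b | ∃ v : V, V.valuation (v : K) < 1 ∧ b = algebraMap V _ v})

/-- If no product of elements of `U` lies in the ideal `smallIdeal V G N U`, then there is a valued
field above `(K, V)` in which `G` is integral, `N` lies in the maximal ideal and `U` consists of
units. -/
theorem exists_valuationSubring_of_forall_notMem (G N U : Set R)
    (h : ∀ b ∈ smallIdeal V G N U, (b : R) ∉ Submonoid.closure U) :
    ∃ (F : Type u) (_ : Field F) (φ : R →+* F) (W : ValuationSubring F),
      W.comap (φ.comp (algebraMap K R)) = V ∧ (∀ g ∈ G, φ g ∈ W) ∧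
      (∀ g ∈ N, W.valuation (φ g) < 1) ∧ ∀ g ∈ U, W.valuation (φ g) = 1 := by
  set B := Algebra.adjoin V (G ∪ N ∪ U) with hB
  set I : Ideal B := smallIdeal V G N U with hI
  let S : Submonoid B := (Submonoid.closure U).comap B.val
  obtain ⟨p, hp, hIp, hdisj⟩ := Ideal.exists_le_prime_disjoint I S (by
    rw [Set.disjoint_left]
    intro b hb hbS
    exact h b hb hbS)
  let M : Submonoid R := p.primeCompl.map B.val
  have hM0 : (0 : R) ∉ M := by
    rintro ⟨b, hb, hb0⟩
    have : b = 0 := Subtype.ext hb0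
    exact hb (this ▸ zero_mem p)
  have hnt : Nontrivial (Localization M) := by
    rw [← not_subsingleton_iff_nontrivial, IsLocalization.subsingleton_iff (M := M)]
    exact hM0
  obtain ⟨m, hm⟩ := Ideal.exists_maximal (Localization M)
  let F := m.ResidueField
  let φ : R →+* F := (algebraMap (Localization M) F).comp (algebraMap R (Localization M))
  have hunit (b : p.primeCompl) : IsUnit ((φ.comp B.val.toRingHom) b) := by
    have : IsUnit (algebraMap R (Localization M) (b : B)) :=
      IsLocalization.map_units (Localization M) (⟨_, ⟨b, b.2, rfl⟩⟩ : M)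
    exact this.map (algebraMap (Localization M) F)
  obtain ⟨W, hint', hone', hlt'⟩ := exists_valuationSubring_of_isPrime p
    (φ.comp B.val.toRingHom) fun b hb => (hunit ⟨b, hb⟩).ne_zero
  have hint (b : B) : φ (b : R) ∈ W := hint' b
  have hone (b : B) (hb : b ∉ p) : W.valuation (φ (b : R)) = 1 := hone' b hb
  have hlt (b : B) (hb : b ∈ p) : W.valuation (φ (b : R)) < 1 := hlt' b hb
  have hmem {g : R} (hg : g ∈ G ∪ N ∪ U) : g ∈ B := Algebra.subset_adjoin hg
  refine ⟨F, inferInstance, φ, W, ?_, fun g hg => ?_, fun g hg => ?_, fun g hg => ?_⟩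
  · have hVlt (v : K) (hv : V.valuation v < 1) : W.valuation (φ (algebraMap K R v)) < 1 :=
      hlt (algebraMap V B ⟨v, mem_of_valuation_lt_one V hv⟩)
        (hIp (Ideal.subset_span (Or.inr ⟨_, hv, rfl⟩)))
    ext x
    rw [ValuationSubring.mem_comap]
    constructor
    · intro hx
      by_contra hxV
      have h1 : V.valuation x⁻¹ < 1 := by
        rw [valuation_lt_one_iff_inv, inv_inv]; exact Or.inr hxV
      have h2 := hVlt _ h1
      rw [← RingHom.comp_apply, map_inv₀, valuation_lt_one_iff_inv, inv_inv] at h2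
      rcases h2 with h2 | h2
      · rw [inv_eq_zero, map_eq_zero] at h2
        exact hxV (h2 ▸ zero_mem V)
      · exact h2 hx
    · intro hx
      exact hint (algebraMap V B ⟨x, hx⟩)
  · exact hint ⟨g, hmem (Or.inl (Or.inl hg))⟩
  · exact hlt ⟨g, hmem (Or.inl (Or.inr hg))⟩ (hIp (Ideal.subset_span (Or.inl hg)))
  · refine hone ⟨g, hmem (Or.inr hg)⟩ fun hgp => ?_
    exact Set.disjoint_left.1 hdisj hgp (show (⟨g, hmem (Or.inr hg)⟩ : B) ∈ S from
      Submonoid.subset_closure hg)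

end Positivstellensatz

/-! ### Certificates and their soundness -/

section Certificates

/-- A certificate proposes the immediate description `p / q` of the element coded by `c`. It
further consists of a common denominator, a list of indices of units, a list of terms with a
factor from `smallGens`, a list of terms with coefficient in the maximal ideal, and a list of
multiples of relations. -/
abbrev Certificate : Type := (IntPoly × IntPoly × IntPoly) × List ℕ ×
  List (IntPoly × ℕ × List ℕ) × List (IntPoly × List ℕ) × List (ℕ × IntPoly)

/-- The polynomial `q x - p`, where `x` is the element coded by `c`. -/
def defect (c : ElementCode) (p q : IntPoly) : IntPoly :=
  mul (trunc c.1 q) (trunc (c.1 + c.2.1.length) c.2.2) ++ mul (const (-1)) (trunc c.1 p)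

/-- One more variable is used for the inverse of the defect. -/
def defectVar (c : ElementCode) : IntPoly := var (c.1 + c.2.1.length)

/-- All polynomials with values in the valuation ring, under the assumption that `p / q` is not an
immediate description, that is, that `p` is divisible by `q x - p ≠ 0`. -/
def allGens (c : ElementCode) (p : IntPoly) : List IntPoly :=
  mul (trunc c.1 p) (defectVar c) :: (integralGens c ++ smallGens c ++ unitGens c)

/-- All polynomials with value zero, under the assumption that `p / q` is not an immediate
description. -/
def allRelations (c : ElementCode) (p q : IntPoly) : List IntPoly :=
  (mul (defectVar c) (defect c p q) ++ const (-1)) :: relations c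

/-- The product of the members of a list which have the given indices. -/
def prodAt (gens : List IntPoly) (idx : List ℕ) : IntPoly :=
  idx.foldr (fun i s => mul (gens.getD i (const 1)) s) (const 1)

/-- The polynomial which a valid certificate shows to vanish. -/
def certPoly (c : ElementCode) (t : Certificate) : IntPoly :=
  mul (trunc c.1 t.1.2.2) (prodAt (unitGens c) t.2.1) ++
  (t.2.2.1.flatMap fun s => mul (mul (trunc c.1 s.1) ((smallGens c).getD s.2.1 []))
    (prodAt (allGens c t.1.1) s.2.2)) ++
  (t.2.2.2.1.flatMap fun s => mul (trunc c.1 s.1) (prodAt (allGens c t.1.1) s.2)) ++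
  (t.2.2.2.2.flatMap fun s => mul ((allRelations c t.1.1 t.1.2.1).getD s.1 []) s.2)

/-- The tests, with the expected answers, by which a certificate is verified. -/
def certTests (c : ElementCode) (t : Certificate) : List (Test × Bool) :=
  (Sum.inl t.1.2.1, false) :: (Sum.inl t.1.2.2, false) ::
  (t.2.2.1.map (fun s => (Sum.inr (s.1, t.1.2.2), true)) ++
  t.2.2.2.1.map (fun s => (Sum.inr (t.1.2.2, s.1), false)) ++
  (certPoly c t).map (fun m => (Sum.inl (slice c.1 m.2 (certPoly c t)), true)))

/-- The answers in the list are correct. -/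
def Answered {K : Type*} [Field K] (V : ValuationSubring K) (a : List K)
    (l : List (Test × Bool)) : Prop := ∀ t ∈ l, (t.2 = true ↔ t.1.Holds V a)

theorem ev_prodAt {A : Type*} [CommRing A] (z : ℕ → A) (gens : List IntPoly) (idx : List ℕ) :
    ev z (prodAt gens idx) = (idx.map fun i => ev z (gens.getD i (const 1))).prod := by
  induction idx with
  | nil => simp [prodAt]
  | cons i idx ih =>
    have : prodAt gens (i :: idx) = mul (gens.getD i (const 1)) (prodAt gens idx) := rfl
    rw [this, ev_mul, ih, List.map_cons, List.prod_cons]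

theorem ev_flatMap {A B : Type*} [CommRing A] (z : ℕ → A) (l : List B) (f : B → IntPoly) :
    ev z (l.flatMap f) = (l.map fun s => ev z (f s)).sum := by
  induction l with
  | nil => rfl
  | cons s l ih => rw [List.flatMap_cons, ev_append, ih, List.map_cons, List.sum_cons]

theorem forall_getD {α : Type*} {P : α → Prop} {l : List α} {d : α} (hd : P d)
    (h : ∀ x ∈ l, P x) (i : ℕ) : P (l.getD i d) := by
  by_cases hi : i < l.length
  · rw [List.getD_eq_getElem _ _ hi]; exact h _ (List.getElem_mem hi)
  · rwa [List.getD_eq_default _ _ (by omega)]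

theorem divides_iff_valuation_le {K : Type*} [Field K] {V : ValuationSubring K} {x y : K} :
    Divides V x y ↔ V.valuation y ≤ V.valuation x := by
  rw [V.valuation_le_iff]
  constructor
  · rintro ⟨r, hr, h⟩; exact ⟨⟨r, hr⟩, h.symm⟩
  · rintro ⟨r, h⟩; exact ⟨r, r.2, h.symm⟩

theorem holds_inr_iff {K : Type*} [Field K] {V : ValuationSubring K} {a : List K}
    {p q : IntPoly} : Test.Holds V a (Sum.inr (p, q)) ↔
      V.valuation (p.evalAt a) ≤ V.valuation (q.evalAt a) := divides_iff_valuation_le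

/-- A verified certificate gives an immediate description: otherwise, for a suitable value of the
additional variable, a unit would be equal to an element of the maximal ideal. -/
theorem sameLeading_of_answered {K : Type*} [Field K] {V : ValuationSubring K} {L : Type*}
    [Field L] [Algebra K L] {W : ValuationSubring L} (hW : IsValuedExtension V W) {a : List K}
    {c : ElementCode} {x : L} (hx : Represents W a c x) {t : Certificate}
    (ht : Answered V a (certTests c t)) : t.1.2.1.evalAt a ≠ 0 ∧
      SameLeading W x (algebraMap K L (t.1.1.evalAt a / t.1.2.1.evalAt a)) := by
  obtain ⟨⟨p, q, q₀⟩, us, t₁, t₂, hs⟩ := t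
  have hq : q.evalAt a ≠ 0 := fun h =>
    absurd ((ht (Sum.inl q, false) (by simp [certTests])).2 h) (by simp)
  have hq₀ : q₀.evalAt a ≠ 0 := fun h =>
    absurd ((ht (Sum.inl q₀, false) (by simp [certTests])).2 h) (by simp)
  have h₁ : ∀ s ∈ t₁, V.valuation (s.1.evalAt a) ≤ V.valuation (q₀.evalAt a) := fun s hs =>
    holds_inr_iff.1 ((ht (Sum.inr (s.1, q₀), true) (by
      simp only [certTests, List.mem_cons, List.mem_append, List.mem_map]
      exact Or.inr (Or.inr (Or.inl (Or.inl ⟨s, hs, rfl⟩))))).1 rfl)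
  have h₂ : ∀ s ∈ t₂, V.valuation (s.1.evalAt a) < V.valuation (q₀.evalAt a) := fun s hs => by
    have := (ht (Sum.inr (q₀, s.1), false) (by
      simp only [certTests, List.mem_cons, List.mem_append, List.mem_map]
      exact Or.inr (Or.inr (Or.inl (Or.inr ⟨s, hs, rfl⟩))))).2
    rw [holds_inr_iff] at this
    exact not_le.1 fun h => absurd (this h) (by simp)
  have hzero : partialEval c.1 a (certPoly c ((p, q, q₀), us, t₁, t₂, hs)) = 0 := by
    rw [partialEval_eq_zero_iff]
    intro m hm
    exact (ht (Sum.inl _, true) (by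
      simp only [certTests, List.mem_cons, List.mem_append, List.mem_map]
      exact Or.inr (Or.inr (Or.inr ⟨m, hm, rfl⟩)))).1 rfl
  refine ⟨hq, ?_⟩
  obtain ⟨e, hel, hea, hez⟩ := hx.satisfies
  have hlen := hx.1
  set ι := algebraMap K L with hι
  by_contra hno
  have hq' : ι (q.evalAt a) ≠ 0 := by simpa using hq
  have hD : ι (q.evalAt a) * x - ι (p.evalAt a) ≠ 0 := fun h0 => by
    refine hno ⟨0, by simp, ?_⟩
    rw [map_div₀, add_zero, mul_one, eq_div_iff hq']
    linear_combination h0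
  set D := ι (q.evalAt a) * x - ι (p.evalAt a)
  have hDp : ι (p.evalAt a) * D⁻¹ ∈ W := by
    by_contra hmem
    have hp : ι (p.evalAt a) ≠ 0 := fun h0 => hmem (by rw [h0, zero_mul]; exact zero_mem W)
    refine hno ⟨D / ι (p.evalAt a), ?_, ?_⟩
    · rw [valuation_lt_one_iff_inv, inv_div]
      exact Or.inr (by rwa [div_eq_mul_inv])
    · rw [map_div₀]
      field_simp
      ring
  -- the Hensel zeros, followed by the inverse of the defect
  let z : ℕ → L := fun j => if j < e.length then e.getD j 1 else D⁻¹
  obtain ⟨hsat, hxz⟩ := hez z fun j hj => if_pos hj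
  have hza : ∀ j < c.1, z j = ι (a.getD j 1) := fun j hj => by
    rw [← hea j hj]; exact if_pos (by omega)
  have hA (r : IntPoly) : ev z (trunc c.1 r) = ι (r.evalAt a) := by
    rw [map_evalAt]
    refine ev_trunc_eq_evalAt (by simpa using hlen) (fun j hj => ?_) r
    rw [hza j hj, ← map_one ι, List.getD_map]
  have hvar : ev z (defectVar c) = D⁻¹ := by
    rw [defectVar, ev_var]; exact if_neg (by omega)
  have hdef : ev z (defect c p q) = D := by
    rw [defect, ev_append, ev_mul, ev_mul, ev_const, hA, hA, hxz]
    push_cast; ring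
  have hgens : ∀ g ∈ allGens c p, ev z g ∈ W := by
    intro g hg
    simp only [allGens, List.mem_cons, List.mem_append] at hg
    rcases hg with rfl | (hg | hg) | hg
    · rw [ev_mul, hA, hvar]; exact hDp
    · exact hsat.integral g hg
    · exact mem_of_valuation_lt_one W (hsat.small g hg)
    · exact (W.valuation_le_one_iff _).1 (hsat.unit g hg).le
  have hrel : ∀ g ∈ allRelations c p q, ev z g = 0 := by
    intro g hg
    rcases List.mem_cons.1 hg with rfl | hg
    · rw [ev_append, ev_mul, ev_const, hvar, hdef, inv_mul_cancel₀ hD]; simp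
    · exact hsat.relation g hg
  have hprod (idx : List ℕ) : W.valuation (ev z (prodAt (allGens c p) idx)) ≤ 1 := by
    rw [W.valuation_le_one_iff, ev_prodAt]
    refine list_prod_mem fun y hy => ?_
    obtain ⟨i, -, rfl⟩ := List.mem_map.1 hy
    exact forall_getD (P := fun g => ev z g ∈ W) (by simp) hgens i
  have hval : ev z (certPoly c ((p, q, q₀), us, t₁, t₂, hs)) = 0 := by
    rw [ev_eq_aeval_partialEval hlen hza, hzero, map_zero]
  have hq₀' : 0 < W.valuation (ι (q₀.evalAt a)) := by
    rw [zero_lt_iff, Valuation.ne_zero_iff]; simpa using hq₀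
  have hVW (k k' : K) : (V.valuation k ≤ V.valuation k' →
      W.valuation (ι k) ≤ W.valuation (ι k')) ∧ (k' ≠ 0 → V.valuation k < V.valuation k' →
      W.valuation (ι k) < W.valuation (ι k')) := by
    constructor
    · intro hk
      obtain ⟨r, hr⟩ := (V.valuation_le_iff _ _).1 hk
      rw [← hr, map_mul, map_mul]
      exact mul_le_of_le_one_left' ((comap_valuation_le_one hW _).2 (V.valuation_le_one r))
    · intro hk' hk
      have h1 : V.valuation (k / k') < 1 := by
        rw [map_div₀]; exact (div_lt_one₀ (by simpa [zero_lt_iff] using hk')).2 hk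
      rw [← comap_valuation_lt_one hW, map_div₀, map_div₀] at h1
      exact (div_lt_one₀ (by simpa [zero_lt_iff] using hk')).1 h1
  -- the first term is dominant
  have hfirst : W.valuation (ev z (mul (trunc c.1 q₀) (prodAt (unitGens c) us))) =
      W.valuation (ι (q₀.evalAt a)) := by
    have h1 : W.valuation (ev z (prodAt (unitGens c) us)) = 1 := by
      rw [ev_prodAt, map_list_prod]
      refine List.prod_eq_one fun y hy => ?_
      obtain ⟨_, hy', rfl⟩ := List.mem_map.1 hy
      obtain ⟨i, -, rfl⟩ := List.mem_map.1 hy'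
      exact forall_getD (P := fun g => W.valuation (ev z g) = 1) (by simp) hsat.unit i
    rw [ev_mul, hA, map_mul, h1, mul_one]
  have hsumlt {B : Type} (l : List B) (f : B → L)
      (hf : ∀ s ∈ l, W.valuation (f s) < W.valuation (ι (q₀.evalAt a))) :
      W.valuation (l.map f).sum < W.valuation (ι (q₀.evalAt a)) := by
    induction l with
    | nil => simpa using hq₀'
    | cons s l ih =>
      rw [List.map_cons, List.sum_cons]
      exact Valuation.map_add_lt _ (hf s List.mem_cons_self)
        (ih fun r hr => hf r (List.mem_cons_of_mem _ hr))
  unfold certPoly at hval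
  simp only [ev_append, ev_flatMap] at hval
  have hlast : (hs.map fun s => ev z (mul ((allRelations c p q).getD s.1 []) s.2)).sum = 0 := by
    refine List.sum_eq_zero fun y hy => ?_
    obtain ⟨s, -, rfl⟩ := List.mem_map.1 hy
    rw [ev_mul, forall_getD (P := fun g => ev z g = 0) (by simp) hrel s.1, zero_mul]
  have hlt1 := hsumlt t₁ (fun s => ev z (mul (mul (trunc c.1 s.1)
    ((smallGens c).getD s.2.1 [])) (prodAt (allGens c p) s.2.2))) (fun s hs => by
      rw [ev_mul, ev_mul, map_mul, map_mul, hA]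
      refine (mul_le_of_le_one_right' (hprod _)).trans_lt ?_
      have h3 : W.valuation (ev z ((smallGens c).getD s.2.1 [])) < 1 :=
        forall_getD (P := fun g => W.valuation (ev z g) < 1) (by simp) hsat.small _
      by_cases h0 : W.valuation (ι (s.1.evalAt a)) = 0
      · rwa [h0, zero_mul]
      · exact (mul_lt_of_lt_one_right (zero_lt_iff.2 h0) h3).trans_le ((hVW _ _).1 (h₁ s hs)))
  have hlt2 := hsumlt t₂ (fun s => ev z (mul (trunc c.1 s.1) (prodAt (allGens c p) s.2)))
    (fun s hs => by
      rw [ev_mul, map_mul, hA]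
      exact (mul_le_of_le_one_right' (hprod _)).trans_lt ((hVW _ _).2 hq₀ (h₂ s hs)))
  rw [hlast, add_zero, add_assoc] at hval
  have hneg := eq_neg_of_add_eq_zero_left hval
  rw [hneg, Valuation.map_neg] at hfirst
  exact (Valuation.map_add_lt _ hlt1 hlt2).ne hfirst

end Certificates

/-! ### Normal forms of small elements -/

section SmallSums

variable {K : Type u} [Field K] (V : ValuationSubring K) {R : Type u} [CommRing R] [Algebra K R]

/-- `f` is a sum of terms, each the product of the values of some members of `gens` with either the
value of a member of `smalls` and an element of `V`, or an element of the maximal ideal of `V`. -/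
def IsSmallSum (z : ℕ → R) (gens smalls : List IntPoly) (f : R) : Prop :=
  ∃ (t₁ : List (K × ℕ × List ℕ)) (t₂ : List (K × List ℕ)),
    (∀ s ∈ t₁, s.1 ∈ V) ∧ (∀ s ∈ t₂, V.valuation s.1 < 1) ∧
    f = (t₁.map fun s => algebraMap K R s.1 * ev z (smalls.getD s.2.1 []) *
      ev z (prodAt gens s.2.2)).sum +
      (t₂.map fun s => algebraMap K R s.1 * ev z (prodAt gens s.2)).sum

variable {V} {z : ℕ → R} {gens smalls : List IntPoly} {f g : R}

theorem IsSmallSum.add (hf : IsSmallSum V z gens smalls f) (hg : IsSmallSum V z gens smalls g) :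
    IsSmallSum V z gens smalls (f + g) := by
  obtain ⟨t₁, t₂, h₁, h₂, rfl⟩ := hf
  obtain ⟨s₁, s₂, h₃, h₄, rfl⟩ := hg
  refine ⟨t₁ ++ s₁, t₂ ++ s₂, fun s hs => ?_, fun s hs => ?_, ?_⟩
  · exact (List.mem_append.1 hs).elim (h₁ s) (h₃ s)
  · exact (List.mem_append.1 hs).elim (h₂ s) (h₄ s)
  · rw [List.map_append, List.map_append, List.sum_append, List.sum_append]
    ring

theorem IsSmallSum.zero : IsSmallSum V z gens smalls 0 :=
  ⟨[], [], by simp, by simp, by simp⟩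

theorem IsSmallSum.smul {k : K} (hk : k ∈ V) (hf : IsSmallSum V z gens smalls f) :
    IsSmallSum V z gens smalls (algebraMap K R k * f) := by
  obtain ⟨t₁, t₂, h₁, h₂, rfl⟩ := hf
  refine ⟨t₁.map fun s => (k * s.1, s.2), t₂.map fun s => (k * s.1, s.2), fun s hs => ?_,
    fun s hs => ?_, ?_⟩
  · obtain ⟨s, hs', rfl⟩ := List.mem_map.1 hs
    exact mul_mem hk (h₁ s hs')
  · obtain ⟨s, hs', rfl⟩ := List.mem_map.1 hs
    rw [map_mul]
    exact (mul_le_of_le_one_left' ((V.valuation_le_one_iff k).2 hk)).trans_lt (h₂ s hs')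
  · rw [mul_add, ← List.sum_map_mul_left, ← List.sum_map_mul_left, List.map_map, List.map_map]
    simp only [Function.comp_def, map_mul, mul_assoc]

theorem IsSmallSum.mul_gen {p : IntPoly} (hp : p ∈ gens) (hf : IsSmallSum V z gens smalls f) :
    IsSmallSum V z gens smalls (ev z p * f) := by
  obtain ⟨t₁, t₂, h₁, h₂, rfl⟩ := hf
  obtain ⟨i, hi, rfl⟩ := List.getElem_of_mem hp
  have key (l : List ℕ) : ev z (prodAt gens (i :: l)) = ev z gens[i] * ev z (prodAt gens l) := by
    rw [ev_prodAt, ev_prodAt, List.map_cons, List.prod_cons, List.getD_eq_getElem _ _ hi]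
  refine ⟨t₁.map fun s => (s.1, s.2.1, i :: s.2.2), t₂.map fun s => (s.1, i :: s.2),
    fun s hs => ?_, fun s hs => ?_, ?_⟩
  · obtain ⟨s, hs', rfl⟩ := List.mem_map.1 hs
    exact h₁ s hs'
  · obtain ⟨s, hs', rfl⟩ := List.mem_map.1 hs
    exact h₂ s hs'
  · rw [mul_add, ← List.sum_map_mul_left, ← List.sum_map_mul_left, List.map_map, List.map_map]
    simp only [Function.comp_def, key, mul_left_comm]

theorem IsSmallSum.mul_mem_adjoin {S : Set R} (hS : ∀ s ∈ S, ∃ p ∈ gens, ev z p = s) {b : R}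
    (hb : b ∈ Algebra.adjoin V S) (hf : IsSmallSum V z gens smalls f) :
    IsSmallSum V z gens smalls (b * f) := by
  induction hb using Algebra.adjoin_induction generalizing f with
  | mem s hs =>
    obtain ⟨p, hp, rfl⟩ := hS s hs
    exact hf.mul_gen hp
  | algebraMap v => exact hf.smul v.2
  | add a b _ _ ha hb => rw [add_mul]; exact (ha hf).add (hb hf)
  | mul a b _ _ ha hb => rw [mul_assoc]; exact ha (hb hf)

/-- The elements of `smallIdeal` have a normal form, which may be recorded in a certificate. -/
theorem isSmallSum_of_mem_smallIdeal {G N U : Set R}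
    (hS : ∀ s ∈ G ∪ N ∪ U, ∃ p ∈ gens, ev z p = s) (hN : ∀ s ∈ N, ∃ p ∈ smalls, ev z p = s)
    {b : Algebra.adjoin V (G ∪ N ∪ U)} (hb : b ∈ smallIdeal V G N U) :
    IsSmallSum V z gens smalls (b : R) := by
  have hnil : ev z (prodAt gens []) = 1 := by rw [ev_prodAt]; simp
  unfold smallIdeal at hb
  induction hb using Submodule.span_induction with
  | mem b hb =>
    rcases hb with hb | ⟨v, hv, rfl⟩
    · obtain ⟨p, hp, hpb⟩ := hN _ hb
      obtain ⟨i, hi, rfl⟩ := List.getElem_of_mem hp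
      refine ⟨[(1, i, [])], [], by simp [one_mem], by simp, ?_⟩
      simp [hnil, ← hpb, hi]
    · refine ⟨[], [(v, [])], by simp, by simpa using hv, ?_⟩
      simp only [List.map_nil, List.sum_nil, List.map_cons, List.sum_cons, hnil, mul_one, add_zero,
        zero_add]
      rfl
  | zero => exact .zero
  | add a b _ _ ha hb => exact ha.add hb
  | smul a b _ hb => exact hb.mul_mem_adjoin hS a.2

end SmallSums

/-! ### Existence of certificates -/

section Completeness

variable {K : Type u} [Field K]

/-- If `K` is generated by `a`, finitely many polynomials over `K` have a common denominator. -/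
theorem exists_common_denominator {n : ℕ} {a : List K} (ha : a.length = n)
    (hK : ∀ k : K, ∃ p q : IntPoly, q.evalAt a ≠ 0 ∧ k = p.evalAt a / q.evalAt a)
    (l : List (MvPolynomial ℕ K)) : ∃ q : IntPoly, q.evalAt a ≠ 0 ∧ ∀ f ∈ l, ∃ h : IntPoly,
      ev (genericPoint n a) h = MvPolynomial.C (q.evalAt a) * f := by
  have hone (f : MvPolynomial ℕ K) : ∃ q : IntPoly, q.evalAt a ≠ 0 ∧ ∃ h : IntPoly,
      ev (genericPoint n a) h = MvPolynomial.C (q.evalAt a) * f := by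
    induction f using MvPolynomial.induction_on with
    | C k =>
      obtain ⟨p, q, hq, rfl⟩ := hK k
      refine ⟨q, hq, trunc n p, ?_⟩
      rw [ev_genericPoint_trunc ha, ← MvPolynomial.C_mul, mul_div_cancel₀ _ hq]
    | add f g hf hg =>
      obtain ⟨q, hq, h, e⟩ := hf
      obtain ⟨q', hq', h', e'⟩ := hg
      refine ⟨mul q q', by rw [evalAt_mul]; exact mul_ne_zero hq hq',
        mul (trunc n q') h ++ mul (trunc n q) h', ?_⟩
      rw [ev_append, ev_mul, ev_mul, e, e', ev_genericPoint_trunc ha, ev_genericPoint_trunc ha,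
        evalAt_mul, MvPolynomial.C_mul]
      ring
    | mul_X f j hf =>
      obtain ⟨q, hq, h, e⟩ := hf
      refine ⟨q, hq, mul h (var (n + j)), ?_⟩
      rw [ev_mul, e, ev_var, mul_assoc]
      simp [genericPoint]
  induction l with
  | nil => exact ⟨const 1, by simp [evalAt_eq_ev], by simp⟩
  | cons f l ih =>
    obtain ⟨q, hq, h⟩ := ih
    obtain ⟨q', hq', h', e'⟩ := hone f
    refine ⟨mul q q', by rw [evalAt_mul]; exact mul_ne_zero hq hq', fun g hg => ?_⟩
    rcases List.mem_cons.1 hg with rfl | hg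
    · refine ⟨mul (trunc n q) h', ?_⟩
      rw [ev_mul, e', ev_genericPoint_trunc ha, evalAt_mul, MvPolynomial.C_mul, mul_assoc]
    · obtain ⟨h, e⟩ := h g hg
      refine ⟨mul (trunc n q') h, ?_⟩
      rw [ev_mul, e, ev_genericPoint_trunc ha, evalAt_mul, MvPolynomial.C_mul]
      ring

theorem evalAt_eq_of_ev_genericPoint {n : ℕ} {a : List K} (ha : a.length = n) {h : IntPoly}
    {k : K} (e : ev (genericPoint n a) h = MvPolynomial.C k) : h.evalAt a = k := by
  have h1 := congrArg (MvPolynomial.eval fun _ => (1 : K)) e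
  rw [map_ev, MvPolynomial.eval_C] at h1
  rw [← h1, evalAt_eq_ev]
  congr 1
  funext j
  unfold genericPoint
  split_ifs with hj
  · rw [MvPolynomial.eval_C]
  · rw [MvPolynomial.eval_X, List.getD_eq_default _ _ (by omega)]

theorem exists_list_of_mem_span {A : Type*} [CommRing A] (E : IntPoly → A) (l : List IntPoly)
    {f : A} (hf : f ∈ Ideal.span {g | ∃ p ∈ l, E p = g}) :
    ∃ hs : List (ℕ × A), f = (hs.map fun s => E (l.getD s.1 []) * s.2).sum := by
  induction hf using Submodule.span_induction with
  | mem g hg =>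
    obtain ⟨p, hp, rfl⟩ := hg
    obtain ⟨i, hi, rfl⟩ := List.getElem_of_mem hp
    exact ⟨[(i, 1)], by simp [hi]⟩
  | zero => exact ⟨[], by simp⟩
  | add f g _ _ hf hg =>
    obtain ⟨hs, rfl⟩ := hf
    obtain ⟨hs', rfl⟩ := hg
    exact ⟨hs ++ hs', by simp⟩
  | smul b f _ hf =>
    obtain ⟨hs, rfl⟩ := hf
    refine ⟨hs.map fun s => (s.1, b * s.2), ?_⟩
    rw [smul_eq_mul, ← List.sum_map_mul_left, List.map_map]
    simp only [Function.comp_def, mul_left_comm]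

variable {V : ValuationSubring K} {L : Type*} [Field L] [Algebra K L] {W : ValuationSubring L}

/-- If `p / q` is an immediate description of the element coded by `c`, then there is no valued
field above `(K, V)` which witnesses the contrary; hence a certificate exists. -/
theorem exists_answered_of_forall_eq_div (hW : IsHenselization V W) {a : List K} {c : ElementCode}
    {x : L} (hx : Represents W a c x) {p q : IntPoly} (hq : q.evalAt a ≠ 0)
    (hxy : SameLeading W x (algebraMap K L (p.evalAt a / q.evalAt a)))
    (hK : ∀ k : K, ∃ p q : IntPoly, q.evalAt a ≠ 0 ∧ k = p.evalAt a / q.evalAt a) :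
    ∃ t, Answered V a (certTests c t) := by
  have ha := hx.1
  set n := c.1 with hn
  set J : Ideal (MvPolynomial ℕ K) :=
    Ideal.span {f | ∃ g ∈ allRelations c p q, partialEval n a g = f} with hJ
  let R := MvPolynomial ℕ K ⧸ J
  let z : ℕ → R := fun j => Ideal.Quotient.mk J (genericPoint n a j)
  have hz (g : IntPoly) : ev z g = Ideal.Quotient.mk J (ev (genericPoint n a) g) :=
    (map_ev _ _ _).symm
  have hz' (g : IntPoly) (hg : g ∈ allRelations c p q) : ev z g = 0 := by
    rw [hz, ev_genericPoint ha, Ideal.Quotient.eq_zero_iff_mem]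
    exact Ideal.subset_span ⟨g, hg, rfl⟩
  let vals (l : List IntPoly) : Set R := {f | ∃ g ∈ l, ev z g = f}
  let G := vals (mul (trunc n p) (defectVar c) :: integralGens c)
  by_cases h : ∀ b ∈ smallIdeal V G (vals (smallGens c)) (vals (unitGens c)),
    (b : R) ∉ Submonoid.closure (vals (unitGens c))
  · exfalso
    obtain ⟨F, _, φ, U, hU, hG, hN, hUn⟩ := exists_valuationSubring_of_forall_notMem V _ _ _ h
    let _ : Algebra K F := (φ.comp (algebraMap K R)).toAlgebra
    have hVU : IsValuedExtension V U := hU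
    have hev (g : IntPoly) : ev (fun j => φ (z j)) g = φ (ev z g) := (map_ev _ _ _).symm
    have hsat : Satisfies U (fun j => φ (z j)) c := by
      refine ⟨fun g hg => ?_, fun g hg => ?_, fun g hg => ?_, fun g hg => ?_⟩
      · rw [hev]; exact hG _ ⟨g, List.mem_cons_of_mem _ hg, rfl⟩
      · rw [hev]; exact hN _ ⟨g, hg, rfl⟩
      · rw [hev]; exact hUn _ ⟨g, hg, rfl⟩
      · rw [hev, hz' g (List.mem_cons_of_mem _ hg), map_zero]
    have hza : ∀ j < n, φ (z j) = algebraMap K F (a.getD j 1) := fun j hj => by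
      simp only [z, genericPoint_of_lt hj]; rfl
    have hA (r : IntPoly) : ev (fun j => φ (z j)) (trunc n r) = algebraMap K F (r.evalAt a) := by
      rw [hev, hz, ev_genericPoint_trunc ha]; rfl
    obtain ⟨μ, hμ, e⟩ := hx.sameLeading_of_isHenselization hW hVU (hsat.represents ha hza) hxy
    have hZ := hev (mul (defectVar c) (defect c p q) ++ const (-1))
    rw [hz' _ List.mem_cons_self, map_zero, ev_append, ev_mul, ev_const, defect, ev_append, ev_mul,
      ev_mul, hA, hA, ev_const, e, map_div₀] at hZ
    have hpZ := hG _ ⟨_, List.mem_cons_self, rfl⟩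
    rw [← hev, ev_mul, hA, ← U.valuation_le_one_iff] at hpZ
    have hq' : algebraMap K F (q.evalAt a) ≠ 0 := by simpa using hq
    have hone : algebraMap K F (p.evalAt a) * ev (fun j => φ (z j)) (defectVar c) * μ = 1 := by
      push_cast at hZ
      field_simp at hZ
      linear_combination hZ
    have h1 := congrArg U.valuation hone
    rw [map_mul, map_one] at h1
    exact ((mul_le_of_le_one_left' hpZ).trans_lt hμ).ne h1
  push Not at h
  obtain ⟨b, hb, hbU⟩ := h
  obtain ⟨t₁, t₂, h₁, h₂, e⟩ := isSmallSum_of_mem_smallIdeal (z := z) (gens := allGens c p)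
    (smalls := smallGens c) (fun s hs => by
      rcases hs with (⟨g, hg, rfl⟩ | ⟨g, hg, rfl⟩) | ⟨g, hg, rfl⟩
      · refine ⟨g, ?_, rfl⟩
        rcases List.mem_cons.1 hg with rfl | hg <;> simp [allGens, *]
      · exact ⟨g, by simp [allGens, hg], rfl⟩
      · exact ⟨g, by simp [allGens, hg], rfl⟩) (fun s hs => hs) hb
  have hprod (w : R) (hw : w ∈ Submonoid.closure (vals (unitGens c))) :
      ∃ us, w = ev z (prodAt (unitGens c) us) := by
    induction hw using Submonoid.closure_induction with
    | mem x hx =>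
      obtain ⟨g, hg, rfl⟩ := hx
      obtain ⟨i, hi, rfl⟩ := List.getElem_of_mem hg
      exact ⟨[i], by rw [ev_prodAt]; simp [hi]⟩
    | one => exact ⟨[], by rw [ev_prodAt]; simp⟩
    | mul x y _ _ hx hy =>
      obtain ⟨us, rfl⟩ := hx
      obtain ⟨us', rfl⟩ := hy
      exact ⟨us ++ us', by simp [ev_prodAt]⟩
  obtain ⟨us, hus⟩ := hprod _ hbU
  set gp := genericPoint n a with hgp
  obtain ⟨hs, ehs⟩ := exists_list_of_mem_span (partialEval n a) (allRelations c p q)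
    (f := ev gp (prodAt (unitGens c) us) -
      ((t₁.map fun s => MvPolynomial.C s.1 * ev gp ((smallGens c).getD s.2.1 []) *
      ev gp (prodAt (allGens c p) s.2.2)).sum +
      (t₂.map fun s => MvPolynomial.C s.1 * ev gp (prodAt (allGens c p) s.2)).sum)) (by
    rw [← hJ, ← Ideal.Quotient.eq_zero_iff_mem, map_sub, map_add, ← hz, ← hus, e, map_list_sum,
      map_list_sum, List.map_map, List.map_map, sub_eq_zero]
    simp only [Function.comp_def, map_mul, ← hz]
    rfl)
  obtain ⟨q₀, hq₀, hl⟩ := exists_common_denominator ha hK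
    (t₁.map (fun s => MvPolynomial.C s.1) ++ t₂.map (fun s => MvPolynomial.C s.1) ++
      hs.map fun s => s.2)
  choose! H hH using hl
  have hHC (k : K) (hk : ev gp (H (MvPolynomial.C k)) =
      MvPolynomial.C (q₀.evalAt a) * MvPolynomial.C k) :
      (mul (const (-1)) (H (MvPolynomial.C k))).evalAt a = -(q₀.evalAt a * k) := by
    rw [← MvPolynomial.C_mul] at hk
    rw [← evalAt_eq_of_ev_genericPoint ha hk, evalAt_eq_ev, evalAt_eq_ev, ev_mul, ev_const]
    push_cast; ring
  have hH₁ : ∀ s ∈ t₁, _ := fun s hs => hHC s.1 (hH _ (by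
    simp only [List.mem_append, List.mem_map]; exact Or.inl (Or.inl ⟨s, hs, rfl⟩)))
  have hH₂ : ∀ s ∈ t₂, _ := fun s hs => hHC s.1 (hH _ (by
    simp only [List.mem_append, List.mem_map]; exact Or.inl (Or.inr ⟨s, hs, rfl⟩)))
  have hH₃ : ∀ s ∈ hs, _ := fun s hs' => hH s.2 (by
    simp only [List.mem_append, List.mem_map]; exact Or.inr ⟨s, hs', rfl⟩)
  have hq₀v : 0 < V.valuation (q₀.evalAt a) := zero_lt_iff.2 (by simpa using hq₀)
  -- the terms of the certificate are moved to the side of the product of units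
  let t : Certificate := ((p, q, q₀), us,
    t₁.map (fun s => (mul (const (-1)) (H (MvPolynomial.C s.1)), s.2)),
    t₂.map (fun s => (mul (const (-1)) (H (MvPolynomial.C s.1)), s.2)),
    hs.map (fun s => (s.1, mul (const (-1)) (H s.2))))
  refine ⟨t, ?_⟩
  have hzero : partialEval c.1 a (certPoly c t) = 0 := by
    rw [← hn, ← ev_genericPoint ha, ← hgp, certPoly, ev_append, ev_append, ev_append,
      ev_flatMap, ev_flatMap, ev_flatMap]
    have e₁ : (t₁.map fun s => ev gp (mul (mul (trunc n (mul (const (-1)) (H (MvPolynomial.C s.1))))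
        ((smallGens c).getD s.2.1 [])) (prodAt (allGens c p) s.2.2))) =
        t₁.map fun s => -MvPolynomial.C (q₀.evalAt a) * (MvPolynomial.C s.1 *
          ev gp ((smallGens c).getD s.2.1 []) * ev gp (prodAt (allGens c p) s.2.2)) :=
      List.map_congr_left fun s hs => by
        rw [ev_mul, ev_mul, ev_genericPoint_trunc ha, hH₁ s hs, MvPolynomial.C_neg,
          MvPolynomial.C_mul]
        ring
    have e₂ : (t₂.map fun s => ev gp (mul (trunc n (mul (const (-1)) (H (MvPolynomial.C s.1))))
        (prodAt (allGens c p) s.2))) =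
        t₂.map fun s => -MvPolynomial.C (q₀.evalAt a) * (MvPolynomial.C s.1 *
          ev gp (prodAt (allGens c p) s.2)) :=
      List.map_congr_left fun s hs => by
        rw [ev_mul, ev_genericPoint_trunc ha, hH₂ s hs, MvPolynomial.C_neg, MvPolynomial.C_mul]
        ring
    have e₃ : (hs.map fun s => ev gp (mul ((allRelations c p q).getD s.1 [])
        (mul (const (-1)) (H s.2)))) = hs.map fun s => -MvPolynomial.C (q₀.evalAt a) *
          (partialEval n a ((allRelations c p q).getD s.1 []) * s.2) :=
      List.map_congr_left fun s hs' => by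
        rw [ev_mul, ev_mul, ev_const, hH₃ s hs', ev_genericPoint ha]
        push_cast; ring
    have e₀ := congrArg (MvPolynomial.C (q₀.evalAt a) * ·) ehs
    simp only [t, List.map_map, Function.comp_def]
    rw [e₁, e₂, e₃, List.sum_map_mul_left, List.sum_map_mul_left, List.sum_map_mul_left, ev_mul,
      ev_genericPoint_trunc ha]
    linear_combination e₀
  intro s hs
  simp only [certTests, t, List.mem_cons, List.mem_append, List.mem_map] at hs
  rcases hs with rfl | rfl | (⟨_, ⟨s, hs, rfl⟩, rfl⟩ | ⟨_, ⟨s, hs, rfl⟩, rfl⟩) | ⟨m, hm, rfl⟩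
  · exact ⟨fun h => absurd h (by simp), fun h => absurd h hq⟩
  · exact ⟨fun h => absurd h (by simp), fun h => absurd h hq₀⟩
  · refine ⟨fun _ => holds_inr_iff.2 ?_, fun _ => rfl⟩
    rw [hH₁ s hs, Valuation.map_neg, map_mul]
    exact mul_le_of_le_one_right' ((V.valuation_le_one_iff _).2 (h₁ s hs))
  · refine ⟨fun h => absurd h (by simp), fun h => ?_⟩
    rw [holds_inr_iff, hH₂ s hs, Valuation.map_neg, map_mul] at h
    exact absurd (mul_lt_of_lt_one_right hq₀v (h₂ s hs)) (not_lt.2 h)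
  · exact ⟨fun _ => (partialEval_eq_zero_iff _ _ _).1 hzero m hm, fun _ => rfl⟩

end Completeness

/-! ### Reduction to the field generated by the parameters -/

section Transfer

theorem divides_map_iff {K L : Type*} [Field K] [Field L] {V : ValuationSubring K}
    {W : ValuationSubring L} {f : K →+* L} (hf : W.comap f = V) {x y : K} :
    Divides W (f x) (f y) ↔ Divides V x y := by
  constructor
  · rintro ⟨r, hr, e⟩
    by_cases hx : x = 0
    · rw [hx, map_zero, mul_zero, map_eq_zero] at e
      exact ⟨0, zero_mem V, by rw [e, hx, mul_zero]⟩
    · have hx' : f x ≠ 0 := by simpa using hx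
      refine ⟨y / x, ?_, (div_mul_cancel₀ y hx).symm⟩
      rw [← hf, ValuationSubring.mem_comap, map_div₀, e, mul_div_cancel_right₀ _ hx']
      exact hr
  · rintro ⟨r, hr, rfl⟩
    rw [← hf, ValuationSubring.mem_comap] at hr
    exact ⟨f r, hr, map_mul f r x⟩

theorem answered_map_iff {K L : Type*} [Field K] [Field L] {V : ValuationSubring K}
    {W : ValuationSubring L} {f : K →+* L} (hf : W.comap f = V) {a : List K}
    {l : List (Test × Bool)} : Answered W (a.map f) l ↔ Answered V a l := by
  have h (t : Test) : t.Holds W (a.map f) ↔ t.Holds V a := by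
    rcases t with p | ⟨p, q⟩
    · change p.evalAt (a.map f) = 0 ↔ p.evalAt a = 0
      rw [← map_evalAt, map_eq_zero]
    · change Divides W (q.evalAt (a.map f)) (p.evalAt (a.map f)) ↔ Divides V _ _
      rw [← map_evalAt, ← map_evalAt, divides_map_iff hf]
  unfold Answered
  simp only [h]

theorem exists_eq_evalAt_div {K : Type*} [Field K] {a : List K} {k : K}
    (hk : k ∈ Subfield.closure {x | x ∈ a}) :
    ∃ p q : IntPoly, q.evalAt a ≠ 0 ∧ k = p.evalAt a / q.evalAt a := by
  have hle : Subring.closure {x | x ∈ a} ≤ valSubring a :=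
    Subring.closure_le.2 fun x hx => mem_valSubring_of_mem hx
  obtain ⟨y, hy, z, hz, rfl⟩ := Subfield.mem_closure_iff.1 hk
  obtain ⟨p, rfl⟩ := hle hy
  obtain ⟨q, rfl⟩ := hle hz
  by_cases hq : q.evalAt a = 0
  · exact ⟨[], const 1, by simp [evalAt_eq_ev], by simp [hq, evalAt_eq_ev]⟩
  · exact ⟨p, q, hq, rfl⟩

/-- Since codes and tests are insensitive to extensions of the base field, only the field generated
by the parameters matters, and its elements are quotients of values of integer polynomials. -/
theorem exists_answered {K : Type u} [Field K] {V : ValuationSubring K} {L : Type*} [Field L]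
    [Algebra K L] {W : ValuationSubring L} (hW : IsHenselization V W) {a : List K}
    {c : ElementCode} {x : L} (hx : Represents W a c x) : ∃ t, Answered V a (certTests c t) := by
  let K₀ := Subfield.closure {x | x ∈ a}
  obtain ⟨a₀, ha₀⟩ : ∃ a₀ : List K₀, a₀.map K₀.subtype = a := by
    refine ⟨a.attach.map fun x => ⟨x.1, Subfield.subset_closure x.2⟩, ?_⟩
    rw [List.map_map]
    exact List.attach_map_subtype_val a
  let V₀ := V.comap K₀.subtype
  obtain ⟨L₀, _, _, W₀, hW₀, him⟩ := exists_isHenselization_immediate V₀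
  let _ : Algebra K₀ L := ((algebraMap K L).comp K₀.subtype).toAlgebra
  have hVW : IsValuedExtension V₀ W := by
    have := hW.isValuedExtension
    unfold IsValuedExtension at this
    change W.comap ((algebraMap K L).comp K₀.subtype) = V.comap K₀.subtype
    rw [← this, ValuationSubring.comap_comap]
  obtain ⟨φ, hφ⟩ := hW₀.exists_algHom hVW hW.containsHenselZeros
  obtain ⟨ha, e, he, -⟩ := hx
  have hmap : a.map (algebraMap K L) = (a₀.map (algebraMap K₀ L₀)).map (φ : L₀ →+* L) := by
    conv_lhs => rw [← ha₀]
    rw [List.map_map, List.map_map]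
    exact List.map_congr_left fun k _ => (φ.commutes k).symm
  rw [hmap] at he
  obtain ⟨e₀, -, he₀⟩ := he.exists_of_map hφ hW₀.containsHenselZeros
  have hx₀ : Represents W₀ a₀ c (c.2.2.evalAt e₀) := ⟨by rw [← ha, ← ha₀, List.length_map], e₀,
    he₀, rfl⟩
  have hK (k : K₀) : ∃ p q : IntPoly, q.evalAt a₀ ≠ 0 ∧ k = p.evalAt a₀ / q.evalAt a₀ := by
    obtain ⟨p, q, hq, e⟩ := exists_eq_evalAt_div k.2
    rw [← ha₀, ← map_evalAt] at hq e
    rw [← map_evalAt, ← map_div₀] at e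
    exact ⟨p, q, by simpa using hq, Subtype.ext e⟩
  obtain ⟨y, hy⟩ := him (c.2.2.evalAt e₀)
  obtain ⟨p, q, hq, rfl⟩ := hK y
  obtain ⟨t, ht⟩ := exists_answered_of_forall_eq_div hW₀ hx₀ hq hy hK
  exact ⟨t, by rw [← ha₀]; exact (answered_map_iff rfl).2 ht⟩

end Transfer

/-! ### Primitive recursiveness -/

section PrimitiveRecursion

/-- The multiplication of integers is reduced to that of natural numbers, by means of the encoding
of `n` by `2 n` and of `-(n + 1)` by `2 n + 1`. -/
theorem primrec_int_mul : Primrec₂ ((· * ·) : ℤ → ℤ → ℤ) := by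
  have henc (n : ℕ) : Encodable.encode (n : ℤ) = 2 * n := rfl
  have henc' (n : ℕ) : Encodable.encode (Int.negSucc n) = 2 * n + 1 := rfl
  let sgn (z : ℤ) : Bool := (Encodable.encode z).bodd
  have hsgn : Primrec sgn := Primrec.nat_bodd.comp Primrec.encode
  have habs : Primrec Int.natAbs := by
    have h : Primrec fun z : ℤ => (Encodable.encode z + 1).div2 :=
      Primrec.nat_div2.comp (Primrec.succ.comp Primrec.encode)
    refine h.of_eq fun z => ?_
    rcases z with n | n
    · rw [Int.ofNat_eq_natCast, henc, Nat.div2_val, Int.natAbs_natCast]; omega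
    · rw [henc', Nat.div2_val, Int.natAbs_negSucc]; omega
  have hpos : Primrec fun n : ℕ => (n : ℤ) := Primrec.encode_iff.1 Primrec.nat_double
  have hneg : Primrec fun n : ℕ => -(n : ℤ) := by
    refine Primrec.encode_iff.1 ((Primrec.pred.comp Primrec.nat_double).of_eq fun n => ?_)
    rcases n with _ | n
    · rfl
    · rw [show -((n + 1 : ℕ) : ℤ) = Int.negSucc n from rfl, henc', Nat.pred_eq_sub_one]; omega
  have hz (z : ℤ) : z = if sgn z = true then -(z.natAbs : ℤ) else z.natAbs := by
    rcases z with n | n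
    · simp [sgn, henc]
    · have : sgn (Int.negSucc n) = true := by simp only [sgn, henc']; simp
      rw [this, if_pos rfl, Int.natAbs_negSucc]; rfl
  have hmul : Primrec₂ fun a b : ℤ => a.natAbs * b.natAbs :=
    Primrec.nat_mul.comp₂ (habs.comp Primrec.fst) (habs.comp Primrec.snd)
  have h : Primrec₂ fun a b : ℤ => if sgn a = sgn b then ((a.natAbs * b.natAbs : ℕ) : ℤ)
      else -((a.natAbs * b.natAbs : ℕ) : ℤ) :=
    Primrec.ite (Primrec.eq.comp (hsgn.comp Primrec.fst) (hsgn.comp Primrec.snd))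
      (hpos.comp hmul) (hneg.comp hmul)
  refine h.of_eq fun a b => ?_
  conv_rhs => rw [hz a, hz b]
  cases sgn a <;> cases sgn b <;> simp

theorem primrec_addExp : Primrec₂ addExp :=
  Primrec.list_map (Primrec.list_range.comp (Primrec.nat_max.comp
    (Primrec.list_length.comp Primrec.fst) (Primrec.list_length.comp Primrec.snd)))
    (Primrec.nat_add.comp₂
      ((Primrec.list_getD 0).comp₂ (Primrec.fst.comp Primrec.fst).to₂ Primrec₂.right)
      ((Primrec.list_getD 0).comp₂ (Primrec.snd.comp Primrec.fst).to₂ Primrec₂.right))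

theorem primrec_mul : Primrec₂ mul := by
  have h : Primrec₂ fun (s : (IntPoly × IntPoly) × ℤ × List ℕ) (m' : ℤ × List ℕ) =>
      (s.2.1 * m'.1, addExp s.2.2 m'.2) :=
    Primrec.pair
      (primrec_int_mul.comp (Primrec.fst.comp (Primrec.snd.comp Primrec.fst))
        (Primrec.fst.comp Primrec.snd))
      (primrec_addExp.comp (Primrec.snd.comp (Primrec.snd.comp Primrec.fst))
        (Primrec.snd.comp Primrec.snd))
  have h' : Primrec₂ fun (s : IntPoly × IntPoly) (m : ℤ × List ℕ) =>
      s.2.map fun m' => (m.1 * m'.1, addExp m.2 m'.2) :=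
    Primrec.list_map (Primrec.snd.comp Primrec.fst) h
  exact Primrec.list_flatMap Primrec.fst h'

theorem primrec_trunc : Primrec₂ trunc :=
  Primrec.list_map Primrec.snd (Primrec₂.pair.comp₂ (Primrec.fst.comp Primrec.snd).to₂
    (Primrec.list_take.comp₂ (Primrec.fst.comp Primrec.fst).to₂ (Primrec.snd.comp Primrec.snd).to₂))

theorem primrec_var : Primrec var :=
  Primrec.list_cons.comp (Primrec.pair (Primrec.const 1) (Primrec.list_append.comp
    (Primrec.list_map Primrec.list_range (Primrec₂.const 0)) (Primrec.const [1])))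
    (Primrec.const [])

theorem primrec_horner : Primrec₂ horner := by
  have h : Primrec₂ fun (s : IntPoly × List IntPoly) (t : IntPoly × IntPoly) =>
      t.1 ++ mul s.1 t.2 :=
    Primrec.list_append.comp (Primrec.fst.comp Primrec.snd)
      (primrec_mul.comp (Primrec.fst.comp Primrec.fst) (Primrec.snd.comp Primrec.snd))
  exact Primrec.list_foldr Primrec.snd (Primrec.const []) h

theorem primrec_horner₂ : Primrec₂ horner₂ := by
  have h : Primrec₂ fun (s : IntPoly × List IntPoly) (t : IntPoly × IntPoly × IntPoly) =>
      (t.1 ++ mul s.1 t.2.1, t.2.1 ++ mul s.1 t.2.2) := by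
    have h₁ : Primrec fun s : (IntPoly × List IntPoly) × IntPoly × IntPoly × IntPoly => s.2.2.1 :=
      Primrec.fst.comp (Primrec.snd.comp Primrec.snd)
    have h₂ : Primrec fun s : (IntPoly × List IntPoly) × IntPoly × IntPoly × IntPoly => s.2.2.2 :=
      Primrec.snd.comp (Primrec.snd.comp Primrec.snd)
    exact Primrec.pair
      (Primrec.list_append.comp (Primrec.fst.comp Primrec.snd)
        (primrec_mul.comp (Primrec.fst.comp Primrec.fst) h₁))
      (Primrec.list_append.comp h₁ (primrec_mul.comp (Primrec.fst.comp Primrec.fst) h₂))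
  exact Primrec.list_foldr Primrec.snd (Primrec.const ([], [])) h

theorem primrec_stepCoeffs : Primrec₂ stepCoeffs :=
  Primrec.list_map (Primrec.fst.comp Primrec.snd)
    (primrec_trunc.comp₂ (Primrec.fst.comp Primrec.fst).to₂ Primrec₂.right)

theorem primrec_stepBase : Primrec₂ stepBase :=
  primrec_trunc.comp₂ Primrec₂.left (Primrec.snd.comp Primrec.snd).to₂

theorem primrec_steps : Primrec fun c : ElementCode => c.2.1 := Primrec.fst.comp Primrec.snd

theorem primrec_stepAt : Primrec₂ stepAt :=
  (Primrec.list_getD ([], [])).comp₂ (primrec_steps.comp Primrec.fst).to₂ Primrec₂.right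

theorem primrec_stepIndex : Primrec₂ fun (c : ElementCode) (i : ℕ) => c.1 + i :=
  Primrec.nat_add.comp₂ (Primrec.fst.comp Primrec.fst).to₂ Primrec₂.right

theorem primrec_stepRange : Primrec fun c : ElementCode => List.range c.2.1.length :=
  Primrec.list_range.comp (Primrec.list_length.comp primrec_steps)

theorem primrec_base :
    Primrec₂ fun (c : ElementCode) (i : ℕ) => stepBase (c.1 + i) (stepAt c i) :=
  primrec_stepBase.comp₂ primrec_stepIndex primrec_stepAt

theorem primrec_coeffs :
    Primrec₂ fun (c : ElementCode) (i : ℕ) => stepCoeffs (c.1 + i) (stepAt c i) :=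
  primrec_stepCoeffs.comp₂ primrec_stepIndex primrec_stepAt

theorem primrec_integralGens : Primrec integralGens :=
  Primrec.list_flatMap primrec_stepRange (Primrec.list_cons.comp₂ primrec_base primrec_coeffs)

theorem primrec_smallGens : Primrec smallGens :=
  Primrec.list_map primrec_stepRange (Primrec.list_append.comp₂
    (primrec_var.comp₂ primrec_stepIndex) (primrec_mul.comp₂ (Primrec₂.const _) primrec_base))

theorem primrec_unitGens : Primrec unitGens :=
  Primrec.list_map primrec_stepRange
    (Primrec.snd.comp₂ (primrec_horner₂.comp₂ primrec_base primrec_coeffs))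

theorem primrec_relations : Primrec relations :=
  Primrec.list_map primrec_stepRange
    (primrec_horner.comp₂ (primrec_var.comp₂ primrec_stepIndex) primrec_coeffs)

theorem primrec_codeLength : Primrec fun c : ElementCode => c.1 + c.2.1.length :=
  Primrec.nat_add.comp Primrec.fst (Primrec.list_length.comp primrec_steps)

theorem primrec_defectVar : Primrec defectVar := primrec_var.comp primrec_codeLength

theorem primrec_defect :
    Primrec fun s : ElementCode × IntPoly × IntPoly => defect s.1 s.2.1 s.2.2 := by
  have hn : Primrec fun s : ElementCode × IntPoly × IntPoly => s.1.1 :=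
    Primrec.fst.comp Primrec.fst
  have hp : Primrec fun s : ElementCode × IntPoly × IntPoly => s.2.1 :=
    Primrec.fst.comp Primrec.snd
  have hq : Primrec fun s : ElementCode × IntPoly × IntPoly => s.2.2 :=
    Primrec.snd.comp Primrec.snd
  have hr : Primrec fun s : ElementCode × IntPoly × IntPoly => s.1.2.2 :=
    Primrec.snd.comp (Primrec.snd.comp Primrec.fst)
  exact Primrec.list_append.comp
    (primrec_mul.comp (primrec_trunc.comp hn hq)
      (primrec_trunc.comp (primrec_codeLength.comp Primrec.fst) hr))
    (primrec_mul.comp (Primrec.const _) (primrec_trunc.comp hn hp))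

theorem primrec_allGens : Primrec₂ allGens := by
  refine Primrec.list_cons.comp (primrec_mul.comp (primrec_trunc.comp
    (Primrec.fst.comp Primrec.fst) Primrec.snd) (primrec_defectVar.comp Primrec.fst)) ?_
  exact (Primrec.list_append.comp (Primrec.list_append.comp primrec_integralGens
    primrec_smallGens) primrec_unitGens).comp Primrec.fst

theorem primrec_allRelations :
    Primrec fun s : ElementCode × IntPoly × IntPoly => allRelations s.1 s.2.1 s.2.2 :=
  Primrec.list_cons.comp (Primrec.list_append.comp
    (primrec_mul.comp (primrec_defectVar.comp Primrec.fst) primrec_defect) (Primrec.const _))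
    (primrec_relations.comp Primrec.fst)

theorem primrec_prodAt : Primrec₂ prodAt := by
  have h : Primrec₂ fun (s : List IntPoly × List ℕ) (t : ℕ × IntPoly) =>
      mul (s.1.getD t.1 (const 1)) t.2 :=
    primrec_mul.comp ((Primrec.list_getD _).comp (Primrec.fst.comp Primrec.fst)
      (Primrec.fst.comp Primrec.snd)) (Primrec.snd.comp Primrec.snd)
  exact Primrec.list_foldr Primrec.snd (Primrec.const _) h

theorem primrec_slice :
    Primrec fun s : ℕ × List ℕ × IntPoly => slice s.1 s.2.1 s.2.2 := by
  have hN : Primrec fun s : (ℤ × List ℕ) × ℕ × List ℕ => s.1.2.length + s.2.2.length :=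
    Primrec.nat_add.comp (Primrec.list_length.comp (Primrec.snd.comp Primrec.fst))
      (Primrec.list_length.comp (Primrec.snd.comp Primrec.snd))
  have hR : PrimrecRel fun (j : ℕ) (s : (ℤ × List ℕ) × ℕ × List ℕ) =>
      s.1.2.getD (s.2.1 + j) 0 = s.2.2.getD (s.2.1 + j) 0 := by
    have hj : Primrec fun s : ℕ × (ℤ × List ℕ) × ℕ × List ℕ => s.2.2.1 + s.1 :=
      Primrec.nat_add.comp (Primrec.fst.comp (Primrec.snd.comp Primrec.snd)) Primrec.fst
    exact Primrec.eq.comp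
      ((Primrec.list_getD 0).comp (Primrec.snd.comp (Primrec.fst.comp Primrec.snd)) hj)
      ((Primrec.list_getD 0).comp (Primrec.snd.comp (Primrec.snd.comp Primrec.snd)) hj)
  have hT : PrimrecRel fun (m : ℤ × List ℕ) (s : ℕ × List ℕ) => sameTail s.1 m.2 s.2 :=
    ((hR.forall_mem_list.comp (Primrec.list_range.comp hN) Primrec.id).of_eq fun s => by
      simp [sameTail])
  exact hT.listFilter.comp (Primrec.snd.comp Primrec.snd)
    (Primrec.pair Primrec.fst (Primrec.fst.comp Primrec.snd))

theorem primrec_certPoly : Primrec₂ certPoly := by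
  have hn : Primrec fun s : ElementCode × Certificate => s.1.1 := Primrec.fst.comp Primrec.fst
  have hpq : Primrec fun s : ElementCode × Certificate => s.2.1 := Primrec.fst.comp Primrec.snd
  have hp : Primrec fun s : ElementCode × Certificate => s.2.1.1 := Primrec.fst.comp hpq
  have hq : Primrec fun s : ElementCode × Certificate => s.2.1.2.1 :=
    Primrec.fst.comp (Primrec.snd.comp hpq)
  have hq₀ : Primrec fun s : ElementCode × Certificate => s.2.1.2.2 :=
    Primrec.snd.comp (Primrec.snd.comp hpq)
  have ht : Primrec fun s : ElementCode × Certificate => s.2.2 := Primrec.snd.comp Primrec.snd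
  have hus : Primrec fun s : ElementCode × Certificate => s.2.2.1 := Primrec.fst.comp ht
  have ht₁ : Primrec fun s : ElementCode × Certificate => s.2.2.2.1 :=
    Primrec.fst.comp (Primrec.snd.comp ht)
  have ht₂ : Primrec fun s : ElementCode × Certificate => s.2.2.2.2.1 :=
    Primrec.fst.comp (Primrec.snd.comp (Primrec.snd.comp ht))
  have hhs : Primrec fun s : ElementCode × Certificate => s.2.2.2.2.2 :=
    Primrec.snd.comp (Primrec.snd.comp (Primrec.snd.comp ht))
  have hgens : Primrec fun s : ElementCode × Certificate => allGens s.1 s.2.1.1 :=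
    primrec_allGens.comp Primrec.fst hp
  have hrels : Primrec fun s : ElementCode × Certificate =>
      allRelations s.1 s.2.1.1 s.2.1.2.1 := by
    have h := primrec_allRelations.comp (Primrec.pair Primrec.fst (Primrec.pair hp hq))
    exact h
  have h₀ : Primrec fun s : ElementCode × Certificate =>
      mul (trunc s.1.1 s.2.1.2.2) (prodAt (unitGens s.1) s.2.2.1) :=
    primrec_mul.comp (primrec_trunc.comp hn hq₀)
      (primrec_prodAt.comp (primrec_unitGens.comp Primrec.fst) hus)
  have h₁ : Primrec₂ fun (s : ElementCode × Certificate) (r : IntPoly × ℕ × List ℕ) =>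
      mul (mul (trunc s.1.1 r.1) ((smallGens s.1).getD r.2.1 []))
        (prodAt (allGens s.1 s.2.1.1) r.2.2) :=
    primrec_mul.comp (primrec_mul.comp
      (primrec_trunc.comp (hn.comp Primrec.fst) (Primrec.fst.comp Primrec.snd))
      ((Primrec.list_getD _).comp (primrec_smallGens.comp (Primrec.fst.comp Primrec.fst))
        (Primrec.fst.comp (Primrec.snd.comp Primrec.snd))))
      (primrec_prodAt.comp (hgens.comp Primrec.fst)
        (Primrec.snd.comp (Primrec.snd.comp Primrec.snd)))
  have h₂ : Primrec₂ fun (s : ElementCode × Certificate) (r : IntPoly × List ℕ) =>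
      mul (trunc s.1.1 r.1) (prodAt (allGens s.1 s.2.1.1) r.2) :=
    primrec_mul.comp
      (primrec_trunc.comp (hn.comp Primrec.fst) (Primrec.fst.comp Primrec.snd))
      (primrec_prodAt.comp (hgens.comp Primrec.fst) (Primrec.snd.comp Primrec.snd))
  have h₃ : Primrec₂ fun (s : ElementCode × Certificate) (r : ℕ × IntPoly) =>
      mul ((allRelations s.1 s.2.1.1 s.2.1.2.1).getD r.1 []) r.2 :=
    primrec_mul.comp ((Primrec.list_getD _).comp (hrels.comp Primrec.fst)
      (Primrec.fst.comp Primrec.snd)) (Primrec.snd.comp Primrec.snd)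
  exact Primrec.list_append.comp (Primrec.list_append.comp (Primrec.list_append.comp h₀
    (Primrec.list_flatMap ht₁ h₁)) (Primrec.list_flatMap ht₂ h₂)) (Primrec.list_flatMap hhs h₃)

theorem primrec_certTests : Primrec₂ certTests := by
  have hpq : Primrec fun s : ElementCode × Certificate => s.2.1 := Primrec.fst.comp Primrec.snd
  have hq : Primrec fun s : ElementCode × Certificate => s.2.1.2.1 :=
    Primrec.fst.comp (Primrec.snd.comp hpq)
  have hq₀ : Primrec fun s : ElementCode × Certificate => s.2.1.2.2 :=
    Primrec.snd.comp (Primrec.snd.comp hpq)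
  have ht : Primrec fun s : ElementCode × Certificate => s.2.2.2 :=
    Primrec.snd.comp (Primrec.snd.comp Primrec.snd)
  have h₀ {α : Type} [Primcodable α] {f : α → IntPoly} (hf : Primrec f) (b : Bool) :
      Primrec fun s => ((Sum.inl (f s), b) : Test × Bool) :=
    Primrec.pair (Primrec.sumInl.comp hf) (Primrec.const b)
  have h₁ {α : Type} [Primcodable α] {f g : α → IntPoly} (hf : Primrec f) (hg : Primrec g)
      (b : Bool) : Primrec fun s => ((Sum.inr (f s, g s), b) : Test × Bool) :=
    Primrec.pair (Primrec.sumInr.comp (Primrec.pair hf hg)) (Primrec.const b)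
  have hs₁ : Primrec₂ fun (s : ElementCode × Certificate) (r : IntPoly × ℕ × List ℕ) =>
      ((Sum.inr (r.1, s.2.1.2.2), true) : Test × Bool) :=
    h₁ (Primrec.fst.comp Primrec.snd) (hq₀.comp Primrec.fst) true
  have hs₂ : Primrec₂ fun (s : ElementCode × Certificate) (r : IntPoly × List ℕ) =>
      ((Sum.inr (s.2.1.2.2, r.1), false) : Test × Bool) :=
    h₁ (hq₀.comp Primrec.fst) (Primrec.fst.comp Primrec.snd) false
  have hs₃ : Primrec₂ fun (s : ElementCode × Certificate) (m : ℤ × List ℕ) =>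
      ((Sum.inl (slice s.1.1 m.2 (certPoly s.1 s.2)), true) : Test × Bool) :=
    h₀ (primrec_slice.comp (Primrec.pair (Primrec.fst.comp (Primrec.fst.comp Primrec.fst))
      (Primrec.pair (Primrec.snd.comp Primrec.snd) (primrec_certPoly.comp
        (Primrec.fst.comp Primrec.fst) (Primrec.snd.comp Primrec.fst))))) true
  exact Primrec.list_cons.comp (h₀ hq false) (Primrec.list_cons.comp (h₀ hq₀ false)
    (Primrec.list_append.comp (Primrec.list_append.comp
      (Primrec.list_map (Primrec.fst.comp ht) hs₁)
      (Primrec.list_map (Primrec.fst.comp (Primrec.snd.comp ht)) hs₂))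
      (Primrec.list_map primrec_certPoly hs₃)))

end PrimitiveRecursion

/-! ### Algorithms which search -/

section Search

variable {I D O : Type} [Primcodable D]

/-- The enumeration of all tests. -/
def testOf (n : ℕ) : Test := (Encodable.decode n).getD (Sum.inl [])

theorem testOf_encode (t : Test) : testOf (Encodable.encode t) = t := by
  simp [testOf]

/-- If `h` lists the answers to the tests `testOf n` for `n < h.length` (the most recent one first),
then the expected answers in the list `l` are among them. -/
def Confirmed (l : List (Test × Bool)) (h : List Bool) : Prop :=
  ∀ t ∈ l, h.reverse[Encodable.encode t.1]? = some t.2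

instance (l : List (Test × Bool)) (h : List Bool) : Decidable (Confirmed l h) :=
  inferInstanceAs (Decidable (∀ t ∈ l, h.reverse[Encodable.encode t.1]? = some t.2))

/-- The outputs proposed by the confirmed candidates of code at most the number of the answers. -/
def searchResults (f : I × D → List (Test × Bool) × O) (s : I × List Bool) : List O :=
  (List.range (s.2.length + 1)).filterMap fun k => (Encodable.decode k : Option D).bind fun d =>
    if Confirmed (f (s.1, d)).1 s.2 then some (f (s.1, d)).2 else none

/-- One step of the search for a confirmed candidate. -/
def searchStep (f : I × D → List (Test × Bool) × O) (s : I × List Bool) : Test ⊕ O :=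
  (searchResults f s).head?.elim (Sum.inl (testOf s.2.length)) Sum.inr

variable {f : I × D → List (Test × Bool) × O} {i : I}

theorem searchStep_eq_inl {s : I × List Bool} {q : Test} (h : searchStep f s = Sum.inl q) :
    q = testOf s.2.length := by
  unfold searchStep at h
  cases hr : (searchResults f s).head? with
  | none => rw [hr] at h; exact (Sum.inl_injective h).symm
  | some o => rw [hr] at h; exact absurd h (by simp)

theorem exists_of_searchStep_eq_inr {h : List Bool} {o : O}
    (hs : searchStep f (i, h) = Sum.inr o) :
    ∃ d, o = (f (i, d)).2 ∧ Confirmed (f (i, d)).1 h := by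
  unfold searchStep at hs
  cases hr : (searchResults f (i, h)).head? with
  | none => rw [hr] at hs; exact absurd hs (by simp)
  | some o' =>
    rw [hr] at hs
    obtain rfl : o' = o := Sum.inr_injective hs
    have hmem := List.mem_of_head? hr
    obtain ⟨k, -, hk⟩ := List.mem_filterMap.1 hmem
    obtain ⟨d, -, hd⟩ := Option.bind_eq_some_iff.1 hk
    split_ifs at hd with hc
    exact ⟨d, (Option.some_injective _ hd).symm, hc⟩

theorem exists_searchStep_eq_inr {h : List Bool} {d : D} (hd : Encodable.encode d ≤ h.length)
    (hc : Confirmed (f (i, d)).1 h) : ∃ o, searchStep f (i, h) = Sum.inr o := by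
  unfold searchStep
  cases hr : (searchResults f (i, h)).head? with
  | some o => exact ⟨o, rfl⟩
  | none =>
    rw [List.head?_eq_none_iff, searchResults, List.filterMap_eq_nil_iff] at hr
    have := hr (Encodable.encode d) (List.mem_range.2 (Nat.lt_succ_of_le hd))
    simp [Encodable.encodek, hc] at this

variable [Primcodable I] [Primcodable O]

theorem primrec_testOf : Primrec testOf :=
  Primrec.option_getD.comp Primrec.decode (Primrec.const _)

theorem primrec_confirmed : PrimrecRel Confirmed := by
  have h : PrimrecRel fun (t : Test × Bool) (h : List Bool) =>
      h.reverse[Encodable.encode t.1]? = some t.2 :=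
    Primrec.eq.comp (Primrec.list_getElem?.comp (Primrec.list_reverse.comp Primrec.snd)
      (Primrec.encode.comp (Primrec.fst.comp Primrec.fst)))
      (Primrec.option_some.comp (Primrec.snd.comp Primrec.fst))
  exact h.forall_mem_list

theorem primrec_searchStep (hf : Primrec f) :
    Primrec (searchStep f) := by
  have hd : Primrec₂ fun (s : (I × List Bool) × ℕ) (d : D) =>
      if Confirmed (f (s.1.1, d)).1 s.1.2 then some (f (s.1.1, d)).2 else none := by
    have h : Primrec fun s : ((I × List Bool) × ℕ) × D => f (s.1.1.1, s.2) :=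
      hf.comp (Primrec.pair (Primrec.fst.comp (Primrec.fst.comp Primrec.fst)) Primrec.snd)
    exact Primrec.ite (primrec_confirmed.comp (Primrec.fst.comp h)
      (Primrec.snd.comp (Primrec.fst.comp Primrec.fst)))
      (Primrec.option_some.comp (Primrec.snd.comp h)) (Primrec.const none)
  have hr : Primrec (searchResults f) :=
    Primrec.listFilterMap (Primrec.list_range.comp (Primrec.succ.comp
      (Primrec.list_length.comp Primrec.snd)))
      (Primrec.option_bind (Primrec.decode.comp Primrec.snd) hd)
  have h := Primrec.option_casesOn (Primrec.list_head?.comp hr)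
    (Primrec.sumInl.comp (primrec_testOf.comp (Primrec.list_length.comp Primrec.snd)) :
      Primrec fun s : I × List Bool => (Sum.inl (testOf s.2.length) : Test ⊕ O))
    (Primrec.sumInr.comp Primrec.snd).to₂
  refine h.of_eq fun s => ?_
  unfold searchStep
  cases (searchResults f s).head? <;> rfl

/-- The algorithm which performs all tests successively, until it finds a candidate `d` such that
the answers prescribed by `(f (i, d)).1` are confirmed, and then outputs `(f (i, d)).2`. -/
def searchAlgorithm (f : I × D → List (Test × Bool) × O) (hf : Primrec f) :
    UniformAlgorithm I O := ⟨searchStep f, (primrec_searchStep hf).to_comp⟩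

variable {hf : Primrec f} {K : Type u} [Field K] {V : ValuationSubring K} {a : List K}

/-- In a run, the `n`-th answer (in chronological order) is the answer to `testOf n`. -/
theorem reaches_answers {h : List Bool} (hr : (searchAlgorithm f hf).Reaches V a i h) :
    ∀ n < h.length, ∃ b, h.reverse[n]? = some b ∧ (b = true ↔ (testOf n).Holds V a) := by
  induction hr with
  | start => intro n hn; simp at hn
  | @ask h q b _ hs hb ih =>
    intro n hn
    rw [List.reverse_cons]
    by_cases hn' : n < h.length
    · rw [List.getElem?_append_left (by simpa using hn')]
      exact ih n hn'
    · obtain rfl : n = h.length := by rw [List.length_cons] at hn; omega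
      refine ⟨b, by simp, ?_⟩
      rw [hb, searchStep_eq_inl hs]

theorem confirmed_iff_answered {h : List Bool} (hr : (searchAlgorithm f hf).Reaches V a i h)
    {l : List (Test × Bool)} :
    Confirmed l h ↔ Answered V a l ∧ ∀ t ∈ l, Encodable.encode t.1 < h.length := by
  constructor
  · intro hc
    have hlt : ∀ t ∈ l, Encodable.encode t.1 < h.length := fun t ht => by
      have := (List.getElem?_eq_some_iff.1 (hc t ht)).1
      simpa using this
    refine ⟨fun t ht => ?_, hlt⟩
    obtain ⟨b, hb, hb'⟩ := reaches_answers hr _ (hlt t ht)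
    rw [hc t ht, testOf_encode] at *
    rw [← hb', Option.some_injective _ hb]
  · rintro ⟨hA, hlt⟩ t ht
    obtain ⟨b, hb, hb'⟩ := reaches_answers hr _ (hlt t ht)
    rw [testOf_encode, ← hA t ht] at hb'
    rw [hb, Bool.eq_iff_iff.2 hb']

theorem searchAlgorithm_sound {o : O} (h : (searchAlgorithm f hf).Outputs V a i o) :
    ∃ d, o = (f (i, d)).2 ∧ Answered V a (f (i, d)).1 := by
  obtain ⟨h, hr, hs⟩ := h
  obtain ⟨d, rfl, hc⟩ := exists_of_searchStep_eq_inr hs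
  exact ⟨d, rfl, ((confirmed_iff_answered hr).1 hc).1⟩

/-- The search stops as soon as a candidate with correct answers exists: otherwise, there are runs
of any length, in particular one that includes the candidate and all tests it requires. -/
theorem searchAlgorithm_stops {d : D} (hd : Answered V a (f (i, d)).1) :
    ∃ o, (searchAlgorithm f hf).Outputs V a i o := by
  by_contra! hno
  have hlong (n : ℕ) : ∃ h : List Bool, (searchAlgorithm f hf).Reaches V a i h ∧ h.length = n := by
    induction n with
    | zero => exact ⟨[], .start, rfl⟩
    | succ n ih =>
      obtain ⟨h, hr, hn⟩ := ih
      cases hs : searchStep f (i, h) with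
      | inr o => exact absurd ⟨h, hr, hs⟩ (hno o)
      | inl q =>
        classical
        exact ⟨decide (q.Holds V a) :: h, .ask hr hs (by simp), by simp [hn]⟩
  obtain ⟨N, hN⟩ : ∃ N, ∀ t ∈ (f (i, d)).1, Encodable.encode t.1 < N := by
    induction (f (i, d)).1 with
    | nil => exact ⟨0, by simp⟩
    | cons t l ih =>
      obtain ⟨N, hN⟩ := ih
      refine ⟨max N (Encodable.encode t.1 + 1), fun s hs => ?_⟩
      rcases List.mem_cons.1 hs with rfl | hs
      · omega
      · exact (hN s hs).trans_le (le_max_left _ _)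
  obtain ⟨h, hr, hn⟩ := hlong (max N (Encodable.encode d))
  obtain ⟨o, ho⟩ := exists_searchStep_eq_inr (f := f) (i := i) (d := d) (h := h) (by omega)
    ((confirmed_iff_answered hr).2 ⟨hd, fun t ht => (hN t ht).trans_le (by omega)⟩)
  exact hno o ⟨h, hr, ho⟩

end Search

/-! ### Two codes with common parameters -/

section Merge

/-- The list of exponents in which `k` variables are inserted before the variable of index `n`. -/
def insertExp (n k : ℕ) (l : List ℕ) : List ℕ :=
  (List.range (n + k)).map (fun j => if j < n then l.getD j 0 else 0) ++ l.drop n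

/-- The polynomial in which `k` variables are inserted before the variable of index `n`. -/
def insertVars (n k : ℕ) (p : IntPoly) : IntPoly := p.map fun m => (m.1, insertExp n k m.2)

/-- The Hensel codes in which `k` variables are inserted before the variable of index `n`. -/
def insertSteps (n k : ℕ) (T : List (List IntPoly × IntPoly)) : List (List IntPoly × IntPoly) :=
  T.map fun t => (t.1.map (insertVars n k), insertVars n k t.2)

theorem monVal_insertExp {A : Type*} [CommRing A] (z : ℕ → A) (n k : ℕ) (l : List ℕ) :
    monVal z (insertExp n k l) = monVal (fun j => if j < n then z j else z (k + j)) l := by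
  have h1 : monVal z ((List.range (n + k)).map fun j => if j < n then l.getD j 0 else 0) =
      ∏ j ∈ Finset.range n, z j ^ l.getD j 0 := by
    rw [monVal_eq_prod z _ (N := n + k) (by simp), Finset.prod_range_add,
      Finset.prod_congr rfl (g := fun j => z j ^ l.getD j 0), Finset.prod_eq_one (s := Finset.range k), mul_one]
    · intro j hj
      have := Finset.mem_range.1 hj
      simp [List.getD_eq_getElem?_getD, this]
    · intro j hj
      have := Finset.mem_range.1 hj
      simp [List.getD_eq_getElem?_getD, this, show j < n + k by omega]
  rw [insertExp, monVal_append, h1, monVal_eq_prod _ (l.drop n) (N := l.length) (by simp),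
    monVal_eq_prod _ l (N := n + l.length) (by omega), Finset.prod_range_add]
  congr 1
  · exact Finset.prod_congr rfl fun j hj => by rw [if_pos (Finset.mem_range.1 hj)]
  · refine Finset.prod_congr rfl fun j _ => ?_
    rw [if_neg (by omega)]
    simp [List.getD_eq_getElem?_getD, add_assoc, add_left_comm]

theorem evalAt_insertVars {L : Type*} [Field L] {n k : ℕ} {e f s : List L} (he : e.length = n)
    (hf : f.length = k) (p : IntPoly) :
    (insertVars n k p).evalAt (e ++ (f ++ s)) = p.evalAt (e ++ s) := by
  have h : (fun j => if j < n then (e ++ (f ++ s)).getD j 1 else (e ++ (f ++ s)).getD (k + j) 1) =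
      fun j => (e ++ s).getD j 1 := by
    funext j
    split_ifs with hj
    · rw [List.getD_append _ _ _ _ (by omega), List.getD_append _ _ _ _ (by omega)]
    · rw [List.getD_append_right _ _ _ _ (by omega), List.getD_append_right _ _ _ _ (by omega),
        List.getD_append_right _ _ _ _ (by omega)]
      congr 1
      omega
  rw [evalAt_eq_ev, evalAt_eq_ev, ← h]
  induction p with
  | nil => rfl
  | cons m p ih =>
    rw [ev_cons, ← ih, ← monVal_insertExp]
    exact ev_cons _ _ _

/-- Additional elements `f` may be inserted into the list, if the codes are renumbered. -/
theorem Adjoins.insert {L : Type*} [Field L] {W : ValuationSubring L} {n k : ℕ}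
    {e f s e' : List L} {T : List (List IntPoly × IntPoly)} (he : e.length = n)
    (hf : f.length = k) (h : Adjoins W (e ++ s) T (e ++ e')) :
    Adjoins W (e ++ (f ++ s)) (insertSteps n k T) (e ++ (f ++ e')) := by
  induction T generalizing s with
  | nil =>
    rw [adjoins_nil_iff] at h
    rw [List.append_cancel_left h]
    exact .nil _
  | cons t T ih =>
    rw [adjoins_cons_iff] at h
    obtain ⟨ξ, hξ, h⟩ := h
    refine adjoins_cons_iff.2 ⟨ξ, ?_, ?_⟩
    · have h1 : ((t.1.map (insertVars n k)).map fun p => p.evalAt (e ++ (f ++ s))) =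
          t.1.map fun p => p.evalAt (e ++ s) := by
        rw [List.map_map]
        exact List.map_congr_left fun p _ => evalAt_insertVars he hf p
      rw [h1, evalAt_insertVars he hf]
      exact hξ
    · rw [List.append_assoc] at h
      have := ih h
      rwa [List.append_assoc, List.append_assoc]

theorem evalAt_trunc_append {L : Type*} [Field L] {n : ℕ} {e s : List L} (he : e.length = n)
    (p : IntPoly) : (trunc n p).evalAt (e ++ s) = p.evalAt e := by
  rw [evalAt_eq_ev]
  exact ev_trunc_eq_evalAt he (fun j hj => List.getD_append _ _ _ _ (by omega)) p

/-- The Hensel zeros prescribed by two codes, one after the other, for the concatenated list of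
parameters. -/
def mergeSteps (c d : ElementCode) : List (List IntPoly × IntPoly) :=
  insertSteps c.1 d.1 c.2.1 ++
    insertSteps (c.1 + d.1) c.2.1.length (insertSteps 0 c.1 d.2.1)

/-- The element coded by `c`, as a polynomial in all parameters and Hensel zeros of `c` and `d`. -/
def mergeLeft (c d : ElementCode) : IntPoly :=
  insertVars c.1 d.1 (trunc (c.1 + c.2.1.length) c.2.2)

/-- The element coded by `d`, as a polynomial in all parameters and Hensel zeros of `c` and `d`. -/
def mergeRight (c d : ElementCode) : IntPoly :=
  insertVars (c.1 + d.1) c.2.1.length (insertVars 0 c.1 d.2.2)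

/-- The elements coded by `c` and `d` are values of polynomials at one and the same list. -/
theorem exists_adjoins_merge {K L : Type*} [Field K] [Field L] [Algebra K L]
    {W : ValuationSubring L} {a b : List K} {c d : ElementCode} {x y : L}
    (hx : Represents W a c x) (hy : Represents W b d y) :
    ∃ e, Adjoins W ((a ++ b).map (algebraMap K L)) (mergeSteps c d) e ∧
      (mergeLeft c d).evalAt e = x ∧ (mergeRight c d).evalAt e = y := by
  obtain ⟨ha, _, he, rfl⟩ := hx
  obtain ⟨hb, _, hf, rfl⟩ := hy
  rw [← List.length_map (algebraMap K L)] at ha hb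
  rw [List.map_append]
  set a' := a.map (algebraMap K L)
  set b' := b.map (algebraMap K L)
  obtain ⟨s, rfl, hs⟩ := he.exists_append
  obtain ⟨t, rfl, ht⟩ := hf.exists_append
  have h1 : Adjoins W (a' ++ b') (insertSteps c.1 d.1 c.2.1) (a' ++ b' ++ s) := by
    have he' : Adjoins W (a' ++ []) c.2.1 (a' ++ s) := by rwa [List.append_nil]
    have := he'.insert ha hb
    rwa [List.append_nil, ← List.append_assoc] at this
  have h2 : Adjoins W (a' ++ b') (insertSteps 0 c.1 d.2.1) (a' ++ b' ++ t) := by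
    have := Adjoins.insert (e := []) (f := a') (n := 0) rfl ha hf
    simpa using this
  have h2' : Adjoins W (a' ++ b' ++ []) (insertSteps 0 c.1 d.2.1) (a' ++ b' ++ t) := by
    rwa [List.append_nil]
  have h3 := h2'.insert (n := c.1 + d.1) (by rw [List.length_append, ha, hb]) hs
  rw [List.append_nil] at h3
  refine ⟨_, h1.trans h3, ?_, ?_⟩
  · rw [mergeLeft, List.append_assoc, evalAt_insertVars ha hb, ← List.append_assoc,
      evalAt_trunc_append (by rw [List.length_append, ha, hs])]
  · rw [mergeRight, evalAt_insertVars (by rw [List.length_append, ha, hb]) hs]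
    have := evalAt_insertVars (e := []) (n := 0) (f := a') (s := b' ++ t) rfl ha d.2.2
    simpa using this

/-- The code of the element with value `r` in the merged system of `c` and `d`. -/
def mergeCode (c d : ElementCode) (r : IntPoly) : ElementCode :=
  (c.1 + d.1, mergeSteps c d, r)

theorem primrec_insertVars {α : Type} [Primcodable α] {n k : α → ℕ} {p : α → IntPoly}
    (hn : Primrec n) (hk : Primrec k) (hp : Primrec p) :
    Primrec fun s => insertVars (n s) (k s) (p s) := by
  have he : Primrec₂ fun (s : α × ℤ × List ℕ) (j : ℕ) =>
      if j < n s.1 then s.2.2.getD j 0 else 0 :=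
    Primrec.ite (Primrec.nat_lt.comp Primrec.snd (hn.comp (Primrec.fst.comp Primrec.fst)))
      ((Primrec.list_getD 0).comp (Primrec.snd.comp (Primrec.snd.comp Primrec.fst)) Primrec.snd)
      (Primrec.const 0)
  have hl : Primrec fun s : α × ℤ × List ℕ => insertExp (n s.1) (k s.1) s.2.2 :=
    Primrec.list_append.comp (Primrec.list_map (Primrec.list_range.comp
      (Primrec.nat_add.comp (hn.comp Primrec.fst) (hk.comp Primrec.fst))) he)
      (Primrec.list_drop.comp (hn.comp Primrec.fst) (Primrec.snd.comp Primrec.snd))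
  have hm : Primrec₂ fun (s : α) (m : ℤ × List ℕ) => (m.1, insertExp (n s) (k s) m.2) :=
    Primrec.pair (Primrec.fst.comp Primrec.snd) hl
  exact Primrec.list_map hp hm

theorem primrec_insertSteps {α : Type} [Primcodable α] {n k : α → ℕ}
    {T : α → List (List IntPoly × IntPoly)} (hn : Primrec n) (hk : Primrec k) (hT : Primrec T) :
    Primrec fun s => insertSteps (n s) (k s) (T s) := by
  have h₁ : Primrec₂ fun (s : α × List IntPoly × IntPoly) (p : IntPoly) =>
      insertVars (n s.1) (k s.1) p :=
    primrec_insertVars (hn.comp (Primrec.fst.comp Primrec.fst))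
      (hk.comp (Primrec.fst.comp Primrec.fst)) Primrec.snd
  have h₂ : Primrec₂ fun (s : α) (t : List IntPoly × IntPoly) =>
      (t.1.map (insertVars (n s) (k s)), insertVars (n s) (k s) t.2) :=
    Primrec.pair (Primrec.list_map (Primrec.fst.comp Primrec.snd) h₁)
      (primrec_insertVars (hn.comp Primrec.fst) (hk.comp Primrec.fst)
        (Primrec.snd.comp Primrec.snd))
  exact Primrec.list_map hT h₂

theorem primrec_totalParameters : Primrec fun s : ElementCode × ElementCode => s.1.1 + s.2.1 :=
  Primrec.nat_add.comp (Primrec.fst.comp Primrec.fst) (Primrec.fst.comp Primrec.snd)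

theorem primrec_leftSteps : Primrec fun s : ElementCode × ElementCode => s.1.2.1.length :=
  Primrec.list_length.comp (primrec_steps.comp Primrec.fst)

theorem primrec_mergeSteps : Primrec₂ mergeSteps :=
  Primrec.list_append.comp
    (primrec_insertSteps (Primrec.fst.comp Primrec.fst) (Primrec.fst.comp Primrec.snd)
      (primrec_steps.comp Primrec.fst))
    (primrec_insertSteps primrec_totalParameters primrec_leftSteps
      (primrec_insertSteps (Primrec.const 0) (Primrec.fst.comp Primrec.fst)
        (primrec_steps.comp Primrec.snd)))

theorem primrec_value : Primrec fun c : ElementCode => c.2.2 := Primrec.snd.comp Primrec.snd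

theorem primrec_mergeLeft : Primrec₂ mergeLeft :=
  primrec_insertVars (Primrec.fst.comp Primrec.fst) (Primrec.fst.comp Primrec.snd)
    (primrec_trunc.comp (primrec_codeLength.comp Primrec.fst) (primrec_value.comp Primrec.fst))

theorem primrec_mergeRight : Primrec₂ mergeRight :=
  primrec_insertVars primrec_totalParameters primrec_leftSteps
    (primrec_insertVars (Primrec.const 0) (Primrec.fst.comp Primrec.fst)
      (primrec_value.comp Primrec.snd))

theorem primrec_mergeCode {r : ElementCode → ElementCode → IntPoly} (hr : Primrec₂ r) :
    Primrec₂ fun c d => mergeCode c d (r c d) :=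
  Primrec.pair primrec_totalParameters (Primrec.pair primrec_mergeSteps hr)

end Merge

/-! ### The algorithms -/

section Algorithms

/-- The code of the difference of the elements coded by `c` and `d`. -/
def mergeSub (c d : ElementCode) : ElementCode :=
  mergeCode c d (mergeLeft c d ++ mul (const (-1)) (mergeRight c d))

/-- The search for an immediate description of a coded element. -/
def descrSearch (s : ElementCode × Certificate) : List (Test × Bool) × IntPoly × IntPoly :=
  (certTests s.1 s.2, s.2.1.1, s.2.1.2.1)

/-- The search for an immediate description of the difference of two coded elements, and for the
information whether it is zero. -/
def eqSearch (s : (ElementCode × ElementCode) × Certificate × Bool) :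
    List (Test × Bool) × Bool :=
  ((Sum.inl s.2.1.1.1, s.2.2) :: certTests (mergeSub s.1.1 s.1.2) s.2.1, s.2.2)

/-- The search for immediate descriptions of two coded elements, and for the information whether
the first description divides the second. -/
def dvdSearch (s : (ElementCode × ElementCode) × (Certificate × Certificate) × Bool) :
    List (Test × Bool) × Bool :=
  ((Sum.inr (mul s.2.1.2.1.1 s.2.1.1.1.2.1, mul s.2.1.1.1.1 s.2.1.2.1.2.1), s.2.2) ::
    (certTests (mergeCode s.1.1 s.1.2 (mergeLeft s.1.1 s.1.2)) s.2.1.1 ++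
      certTests (mergeCode s.1.1 s.1.2 (mergeRight s.1.1 s.1.2)) s.2.1.2), s.2.2)

theorem primrec_numerator : Primrec fun t : Certificate => t.1.1 := Primrec.fst.comp Primrec.fst

theorem primrec_denominator : Primrec fun t : Certificate => t.1.2.1 :=
  Primrec.fst.comp (Primrec.snd.comp Primrec.fst)

theorem primrec_descrSearch : Primrec descrSearch :=
  Primrec.pair primrec_certTests (Primrec.pair (primrec_numerator.comp Primrec.snd)
    (primrec_denominator.comp Primrec.snd))

theorem primrec_mergeSub : Primrec₂ mergeSub :=
  primrec_mergeCode (Primrec.list_append.comp primrec_mergeLeft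
    (primrec_mul.comp (Primrec.const _) primrec_mergeRight))

theorem primrec_eqSearch : Primrec eqSearch := by
  have hc : Primrec fun s : (ElementCode × ElementCode) × Certificate × Bool =>
      mergeSub s.1.1 s.1.2 :=
    primrec_mergeSub.comp (Primrec.fst.comp Primrec.fst) (Primrec.snd.comp Primrec.fst)
  have ht : Primrec fun s : (ElementCode × ElementCode) × Certificate × Bool => s.2.1 :=
    Primrec.fst.comp Primrec.snd
  have hb : Primrec fun s : (ElementCode × ElementCode) × Certificate × Bool => s.2.2 :=
    Primrec.snd.comp Primrec.snd
  have h := primrec_certTests.comp hc ht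
  exact Primrec.pair (Primrec.list_cons.comp
    (Primrec.pair (Primrec.sumInl.comp (primrec_numerator.comp ht)) hb) h) hb

set_option synthInstance.maxSize 1000 in
theorem primrec_dvdSearch : Primrec dvdSearch := by
  have hc {r : ElementCode → ElementCode → IntPoly} (hr : Primrec₂ r) :
      Primrec fun s : (ElementCode × ElementCode) × (Certificate × Certificate) × Bool =>
        mergeCode s.1.1 s.1.2 (r s.1.1 s.1.2) := by
    have h := (primrec_mergeCode hr).comp
      (Primrec.fst.comp (Primrec.fst (α := ElementCode × ElementCode)
        (β := (Certificate × Certificate) × Bool))) (Primrec.snd.comp Primrec.fst)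
    exact h
  have ht : Primrec fun s : (ElementCode × ElementCode) × (Certificate × Certificate) × Bool =>
      s.2.1.1 := Primrec.fst.comp (Primrec.fst.comp Primrec.snd)
  have ht' : Primrec fun s : (ElementCode × ElementCode) × (Certificate × Certificate) × Bool =>
      s.2.1.2 := Primrec.snd.comp (Primrec.fst.comp Primrec.snd)
  have hb : Primrec fun s : (ElementCode × ElementCode) × (Certificate × Certificate) × Bool =>
      s.2.2 := Primrec.snd.comp Primrec.snd
  have h := primrec_certTests.comp (hc primrec_mergeLeft) ht
  have h' := primrec_certTests.comp (hc primrec_mergeRight) ht'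
  have hq := primrec_mul.comp (primrec_numerator.comp ht') (primrec_denominator.comp ht)
  have hq' := primrec_mul.comp (primrec_numerator.comp ht) (primrec_denominator.comp ht')
  exact Primrec.pair (Primrec.list_cons.comp
    (Primrec.pair (Primrec.sumInr.comp (Primrec.pair hq hq')) hb)
    (Primrec.list_append.comp h h')) hb

/-- The algorithm which computes immediate descriptions. -/
def descrAlgorithm : UniformAlgorithm ElementCode (IntPoly × IntPoly) :=
  searchAlgorithm descrSearch primrec_descrSearch

/-- The algorithm which tests equality. -/
def eqAlgorithm : UniformAlgorithm (ElementCode × ElementCode) Bool :=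
  searchAlgorithm eqSearch primrec_eqSearch

set_option synthInstance.maxSize 1000 in
/-- The algorithm which tests divisibility. -/
def dvdAlgorithm : UniformAlgorithm (ElementCode × ElementCode) Bool :=
  searchAlgorithm dvdSearch primrec_dvdSearch

theorem answered_cons_iff {K : Type*} [Field K] {V : ValuationSubring K} {a : List K}
    {t : Test × Bool} {l : List (Test × Bool)} :
    Answered V a (t :: l) ↔ (t.2 = true ↔ t.1.Holds V a) ∧ Answered V a l := by
  simp [Answered]

theorem answered_append_iff {K : Type*} [Field K] {V : ValuationSubring K} {a : List K}
    {l l' : List (Test × Bool)} :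
    Answered V a (l ++ l') ↔ Answered V a l ∧ Answered V a l' := by
  simp [Answered, or_imp, forall_and]

variable {K : Type u} [Field K] {V : ValuationSubring K} {L : Type*} [Field L] [Algebra K L]
  {W : ValuationSubring L}

theorem exists_outputs_descrAlgorithm (hW : IsHenselization V W) {a : List K} {c : ElementCode}
    {x : L} (hx : Represents W a c x) : ∃ p q : IntPoly,
      descrAlgorithm.Outputs V a c (p, q) ∧ q.evalAt a ≠ 0 ∧
      SameLeading W x (algebraMap K L (p.evalAt a / q.evalAt a)) := by
  obtain ⟨t, ht⟩ := exists_answered hW hx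
  obtain ⟨o, ho⟩ := searchAlgorithm_stops (f := descrSearch) (hf := primrec_descrSearch) (i := c)
    (d := t) ht
  obtain ⟨t', rfl, ht'⟩ := searchAlgorithm_sound ho
  exact ⟨_, _, ho, sameLeading_of_answered hW.isValuedExtension hx ht'⟩

theorem Represents.merge {a b : List K} {c d : ElementCode} {x y : L} (hx : Represents W a c x)
    (hy : Represents W b d y) : Represents W (a ++ b) (mergeCode c d (mergeLeft c d)) x ∧
      Represents W (a ++ b) (mergeCode c d (mergeRight c d)) y ∧
      Represents W (a ++ b) (mergeSub c d) (x - y) := by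
  have hlen : (a ++ b).length = c.1 + d.1 := by rw [List.length_append, hx.1, hy.1]
  obtain ⟨e, he, h1, h2⟩ := exists_adjoins_merge hx hy
  refine ⟨⟨hlen, e, he, h1⟩, ⟨hlen, e, he, h2⟩, hlen, e, he, ?_⟩
  change IntPoly.evalAt (mergeLeft c d ++ mul (const (-1)) (mergeRight c d)) e = x - y
  rw [evalAt_eq_ev, ev_append, ev_mul, ev_const, ← evalAt_eq_ev, ← evalAt_eq_ev, h1, h2]
  push_cast; ring

theorem exists_outputs_eqAlgorithm (hW : IsHenselization V W) {a b : List K} {c d : ElementCode}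
    {x y : L} (hx : Represents W a c x) (hy : Represents W b d y) :
    ∃ t : Bool, eqAlgorithm.Outputs V (a ++ b) (c, d) t ∧ (t = true ↔ x = y) := by
  classical
  obtain ⟨-, -, hxy⟩ := hx.merge hy
  obtain ⟨t, ht⟩ := exists_answered hW hxy
  obtain ⟨o, ho⟩ := searchAlgorithm_stops (f := eqSearch) (hf := primrec_eqSearch) (i := (c, d))
    (d := (t, decide (t.1.1.evalAt (a ++ b) = 0))) (V := V) (a := a ++ b)
    (answered_cons_iff.2 ⟨by simp [Test.Holds], ht⟩)
  refine ⟨o, ho, ?_⟩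
  obtain ⟨⟨t', o⟩, rfl, ht'⟩ := searchAlgorithm_sound ho
  obtain ⟨h1, h2⟩ := answered_cons_iff.1 ht'
  obtain ⟨hq, hs⟩ := sameLeading_of_answered hW.isValuedExtension hxy h2
  rw [← sub_eq_zero (a := x), hs.eq_zero_iff, map_eq_zero, div_eq_zero_iff, or_iff_left hq]
  exact h1

set_option synthInstance.maxSize 1000 in
theorem exists_outputs_dvdAlgorithm (hW : IsHenselization V W) {a b : List K} {c d : ElementCode}
    {x y : L} (hx : Represents W a c x) (hy : Represents W b d y) :
    ∃ t : Bool, dvdAlgorithm.Outputs V (a ++ b) (c, d) t ∧ (t = true ↔ Divides W x y) := by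
  classical
  obtain ⟨hx', hy', -⟩ := hx.merge hy
  obtain ⟨t, ht⟩ := exists_answered hW hx'
  obtain ⟨s, hs⟩ := exists_answered hW hy'
  obtain ⟨o, ho⟩ := searchAlgorithm_stops (f := dvdSearch) (hf := primrec_dvdSearch) (i := (c, d))
    (d := ((t, s), decide (Test.Holds V (a ++ b) (Sum.inr (mul s.1.1 t.1.2.1, mul t.1.1 s.1.2.1)))))
    (V := V) (a := a ++ b)
    (answered_cons_iff.2 ⟨by simp, answered_append_iff.2 ⟨ht, hs⟩⟩)
  refine ⟨o, ho, ?_⟩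
  obtain ⟨⟨⟨t', s'⟩, o⟩, rfl, ht'⟩ := searchAlgorithm_sound ho
  obtain ⟨h1, h2⟩ := answered_cons_iff.1 ht'
  obtain ⟨h2, h3⟩ := answered_append_iff.1 h2
  obtain ⟨hq, hs⟩ := sameLeading_of_answered hW.isValuedExtension hx' h2
  obtain ⟨hq', hs'⟩ := sameLeading_of_answered hW.isValuedExtension hy' h3
  rw [divides_iff_valuation_le, hs.valuation_eq, hs'.valuation_eq, ← divides_iff_valuation_le,
    divides_map_iff hW.isValuedExtension, divides_iff_valuation_le]
  refine h1.trans (holds_inr_iff.trans ?_)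
  have hv : 0 < V.valuation (t'.1.2.1.evalAt (a ++ b)) := zero_lt_iff.2 (by simpa using hq)
  have hv' : 0 < V.valuation (s'.1.2.1.evalAt (a ++ b)) := zero_lt_iff.2 (by simpa using hq')
  rw [evalAt_mul, evalAt_mul, map_mul, map_mul, map_div₀, map_div₀, div_le_div_iff₀ hv' hv]

end Algorithms

end HenselizationOfValuedField

open HenselizationOfValuedField in
theorem mainTheorem1 :
    -- algorithms which do not depend on the valued field
    ∃ (eqTest : UniformAlgorithm (ElementCode × ElementCode) Bool)
      (dvdTest : UniformAlgorithm (ElementCode × ElementCode) Bool)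
      (descr : UniformAlgorithm ElementCode (IntPoly × IntPoly)),
    ∀ (K : Type u) [Field K] (V : ValuationSubring K),
    ∃ (L : Type u) (_ : Field L) (_ : Algebra K L) (W : ValuationSubring L),
      -- `(L, W)` is a valued extension with all Hensel zeros, generated by Hensel zeros
      IsHenselization V W ∧
      -- it is unique up to unique `(K, V)`-isomorphism
      (∀ (L' : Type v) [Field L'] [Algebra K L'] (W' : ValuationSubring L'),
        IsHenselization V W' → ∃! φ : L ≃ₐ[K] L', ∀ x : L, φ x ∈ W' ↔ x ∈ W) ∧
      -- every element is obtained by finitely many successive adjunctions of Hensel zeros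
      (∀ x : L, ∃ (a : List K) (c : ElementCode), Represents W a c x) ∧
      -- the extension is immediate
      (∀ x : L, ∃ y : K, IsImmediateDescription W y x) ∧
      -- explicitly: immediate descriptions are computed uniformly in `(K, V)`
      (∀ (a : List K) (c : ElementCode) (x : L), Represents W a c x →
        ∃ p q : IntPoly, descr.Outputs V a c (p, q) ∧ q.evalAt a ≠ 0 ∧
          IsImmediateDescription W (p.evalAt a / q.evalAt a) x) ∧
      -- equality and divisibility are testable, by computations which are uniform in `(K, V)`
      (∀ (a b : List K) (c d : ElementCode) (x y : L), Represents W a c x → Represents W b d y →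
        (∃ t : Bool, eqTest.Outputs V (a ++ b) (c, d) t ∧ (t = true ↔ x = y)) ∧
        (∃ t : Bool, dvdTest.Outputs V (a ++ b) (c, d) t ∧ (t = true ↔ Divides W x y))) := by
  refine ⟨eqAlgorithm, dvdAlgorithm, descrAlgorithm, fun K _ V => ?_⟩
  obtain ⟨L, _, _, W, hW, him⟩ := exists_isHenselization_immediate V
  refine ⟨L, inferInstance, inferInstance, W, hW,
    fun L' _ _ W' hW' => existsUnique_algEquiv_of_isHenselization hW hW',
    exists_represents hW.isGenerated him,
    fun x => (him x).imp fun y hy => isImmediateDescription_iff.2 hy,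
    fun a c x hx => ?_,
    fun a b c d x y hx hy =>
      ⟨exists_outputs_eqAlgorithm hW hx hy, exists_outputs_dvdAlgorithm hW hx hy⟩⟩
  obtain ⟨p, q, ho, hq, hs⟩ := exists_outputs_descrAlgorithm hW hx
  exact ⟨p, q, ho, hq, isImmediateDescription_iff.2 hs⟩
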